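/- Setting. Let $\mathcal H_{\mathcal S},\mathcal H_{\mathcal E}$ be finite-dimensional non-zero complex Hilbert spaces, $h_{\mathcal S}$ a self-adjoint operator on $\mathcal H_{\mathcal S}$, $\tau>0$, $\lambda\in\mathbb R$, and let $s\mapsto h_{\mathcal E}(s)$ (self-adjoint on $\mathcal H_{\mathcal E}$), $s\mapsto\beta(s)\in\mathbb R$ and $s\mapsto v(s)$ (self-adjoint on $\mathcal H_{\mathcal S}\otimes\mathcal H_{\mathcal E}$) be $C^2$ on $[0,1]$. Put $$U(s)=e^{-\mathrm i\tau(h_{\mathcal S}\otimes\mathrm{Id}+\mathrm{Id}\otimes h_{\mathcal E}(s)+\lambda v(s))},\qquad \xi_s=\frac{e^{-\beta(s)h_{\mathcal E}(s)}}{\operatorname{Tr}e^{-\beta(s)h_{\mathcal E}(s)}},\qquad \mathcal L(s)(\eta)=\operatorname{Tr}_{\mathcal E}\big(U(s)(\eta\otimes\xi_s)U(s)^*\big).$$ A state is a non-negative operator of trace one; $\|A\|_1=\operatorname{Tr}\sqrt{A^*A}$, and linear maps on operators on $\mathcal H_{\mathcal S}$ carry the operator norm induced by $\|\cdot\|_1$;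 $S(\eta|\nu)=\operatorname{Tr}(\eta(\log\eta-\log\nu))$ (with $\log 0:=0$ on kernels, where $\ker\nu\subset\ker\eta$). For integers $m,T\ge1$ and an initial state $\rho^{\mathrm i}$ on $\mathcal H_{\mathcal S}$, the $m$-repeated system with adiabatic parameter $T$ has, for $k=1,\dots,mT$, the parameter values $s_k=(\lfloor (k-1)/m\rfloor+1)/T$, the states $\rho_0=\rho^{\mathrm i}$, $\rho_k=\mathcal L(s_k)(\rho_{k-1})$, and the total entropy production $$\sigma_T^{\mathrm{tot}}=\sum_{k=1}^{mT}S\big(U(s_k)(\rho_{k-1}\otimes\xi_{s_k})U(s_k)^*\,\big|\,\mathcal L(s_k)(\rho_{k-1})\otimes\xi_{s_k}\big).$$ A linear map $\Phi$ on operators on $\mathcal H_{\mathcal S}$ is irreducible if the only self-adjoint projections $p$ with $\Phi(p\,\cdot\,p)\subset p\,\mathcal B(\mathcal H_{\mathcal S})\,p$ are $0$ and $\mathrm{Id}$. For a family $\Phi(s)$, $s\in[0,1]$, let $P(s)$ be the spectral projector of $\Phi(s)$ on its peripheral spectrum $\operatorname{sp}\Phi(s)\cap S^1$ and $Q(s)=\mathrm{Id}-P(s)$.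 Consider the conditions: (H1) $\|\Phi(s)\|\le1$ for all $s$; (H2) the peripheral eigenvalues are (algebraically) simple and, for some $\epsilon>0$ and all $s$, distinct ones are more than $2\epsilon$ apart; (H3) $s\mapsto\Phi(s)P(s)$ is $C^2$ on $[0,1]$; (H4) $\sup_s\|\Phi(s)Q(s)\|<1$; (wH4) $\ell':=\sup_s\operatorname{spr}\big(\Phi(s)Q(s)\big)<1$. Corollary. Assume that $\mathcal L(s)$ is irreducible for all $s\in[0,1]$ and that either (i) $m=1$ and $\mathcal L$ satisfies (H4); or (ii) $\mathcal L$ satisfies (wH4), and $m\ge1$ is such that for some $\ell\in(\ell',1)$ the family $s\mapsto\mathcal L(s)^m$ satisfies (H1)–(H4) with $\sup_s\|\mathcal L(s)^mQ(s)\|\le\ell$, where $Q(s)$ is the projector belonging to $\mathcal L(s)^m$. Then for every $s\in[0,1]$ the map $\mathcal L(s)$ has a unique invariant state $\rho_s^{\mathrm{inv}}$. Let $X(s)=U(s)(\rho_s^{\mathrm{inv}}\otimes\xi_s)U(s)^*-\rho_s^{\mathrm{inv}}\otimes\xi_s$. For every initial state $\rho^{\mathrm i}$: - if $X(s)=0$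 for all $s\in[0,1]$ and $\rho^{\mathrm i}=\rho_0^{\mathrm{inv}}$, then $\lim_{T\to\infty}\sigma_T^{\mathrm{tot}}=0$; - if $X(s)=0$ for all $s\in[0,1]$ and $\rho^{\mathrm i}\ne\rho_0^{\mathrm{inv}}$, then $\lim_{T\to\infty}\sigma_T^{\mathrm{tot}}$ exists and is finite; - if $\sup_{s\in[0,1]}\|X(s)\|_1>0$, then $\sigma_T^{\mathrm{tot}}\to+\infty$ as $T\to\infty$. In the second situation the limit may be non-zero: there are a system with $\dim\mathcal H_{\mathcal S}=\dim\mathcal H_{\mathcal E}=2$ and an $m$ satisfying both (i) and (ii), with $X\equiv0$, and an initial state $\rho^{\mathrm i}\neq\rho_0^{\mathrm{inv}}$, for which the limit is not zero. -/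

import Mathlib

open scoped Kronecker ENNReal Topology ComplexOrder

noncomputable section

namespace RIS

/-! ### States, trace norm, relative entropy

Operators on the finite-dimensional Hilbert space `ℂ^ι` are matrices; `ℂ^S ⊗ ℂ^E` is `ℂ^(S × E)`. -/

section Matrices

variable {ι S E : Type*} [Fintype ι] [DecidableEq ι] [Fintype S] [DecidableEq S]
  [Fintype E] [DecidableEq E]

/-- A state: a nonnegative operator of trace one. -/
def IsState (ρ : Matrix ι ι ℂ) : Prop := ρ.PosSemidef ∧ ρ.trace = 1

/-- The trace norm `‖A‖₁ = Tr √(A* A)`. -/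
def traceNorm (A : Matrix ι ι ℂ) : ℝ := (cfc Real.sqrt (A.conjTranspose * A)).trace.re

/-- The relative entropy `S(η|ν) = Tr (η (log η - log ν))`. The functional calculus uses
`Real.log 0 = 0`, so that this is the usual value whenever `ker ν ⊆ ker η`; in particular for
faithful `ν`, and for `η` any state on `S × E` and `ν = Tr_E η ⊗ ξ` with `ξ` faithful. -/
def relEntropy (η ν : Matrix ι ι ℂ) : ℝ := (η * (cfc Real.log η - cfc Real.log ν)).trace.re

/-- The partial trace over the second factor. -/
def partialTrace : Matrix (S × E) (S × E) ℂ →ₗ[ℂ] Matrix S S ℂ where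
  toFun M := Matrix.of fun i j => ∑ e, M (i, e) (j, e)
  map_add' M N := by ext i j; simp [Finset.sum_add_distrib]
  map_smul' c M := by ext i j; simp [Finset.mul_sum]

/-- The Gibbs state of the Hamiltonian `h` at inverse temperature `β`. -/
def gibbs (β : ℝ) (h : Matrix ι ι ℂ) : Matrix ι ι ℂ :=
  (NormedSpace.exp (-(β : ℂ) • h)).trace⁻¹ • NormedSpace.exp (-(β : ℂ) • h)

/-- The map `η ↦ Tr_E (U (η ⊗ ξ) U*)`. -/
def channel (U : Matrix (S × E) (S × E) ℂ) (ξ : Matrix E E ℂ) :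
    Module.End ℂ (Matrix S S ℂ) where
  toFun η := partialTrace (U * (η ⊗ₖ ξ) * U.conjTranspose)
  map_add' η ν := by simp [Matrix.add_kronecker, mul_add, add_mul]
  map_smul' c η := by simp [Matrix.smul_kronecker]

/-- Irreducibility: the only self-adjoint projections `P` with `Φ (P I₁ P) ⊆ P I₁ P` are
`0` and `1`. -/
def IsIrreducible (Φ : Module.End ℂ (Matrix ι ι ℂ)) : Prop :=
  ∀ P : Matrix ι ι ℂ, IsStarProjection P →
    (∀ A, ∃ B, Φ (P * A * P) = P * B * P) → P = 0 ∨ P = 1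

/-- `ρ` is a state invariant under `Φ`. -/
def IsInvariantState (Φ : Module.End ℂ (Matrix ι ι ℂ)) (ρ : Matrix ι ι ℂ) : Prop :=
  IsState ρ ∧ Φ ρ = ρ

end Matrices

/-! ### Spectral projectors -/

section Spectral

variable {V : Type*} [AddCommGroup V] [Module ℂ V] [FiniteDimensional ℂ V]

/-- The sum of the generalized eigenspaces of `Φ` for the eigenvalues in `Ω`. -/
def spectralSubspace (Φ : Module.End ℂ V) (Ω : Set ℂ) : Submodule ℂ V :=
  ⨆ μ ∈ Ω, Φ.maxGenEigenspace μ

theorem isCompl_spectralSubspace (Φ : Module.End ℂ V) (Ω : Set ℂ) :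
    IsCompl (spectralSubspace Φ Ω) (spectralSubspace Φ Ωᶜ) := by
  constructor
  · exact (Module.End.independent_maxGenEigenspace Φ).disjoint_biSup_biSup
      disjoint_compl_right
  · rw [codisjoint_iff, eq_top_iff, ← Module.End.iSup_maxGenEigenspace_eq_top Φ]
    refine iSup_le fun μ => ?_
    by_cases h : μ ∈ Ω
    · exact le_sup_of_le_left (le_biSup (fun μ => Φ.maxGenEigenspace μ) h)
    · exact le_sup_of_le_right
        (le_biSup (fun μ => Φ.maxGenEigenspace μ) (show μ ∈ Ωᶜ from h))

/-- The spectral (Riesz) projector of `Φ` on the part of its spectrum that lies in `Ω`: in finite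
dimension, the projection onto the generalized eigenspaces for the eigenvalues in `Ω`, along those
for the other eigenvalues. -/
def spectralProjector (Φ : Module.End ℂ V) (Ω : Set ℂ) : Module.End ℂ V :=
  (spectralSubspace Φ Ω).projection (spectralSubspace Φ Ωᶜ) (isCompl_spectralSubspace Φ Ω)

/-- The peripheral spectral projector `P`. -/
def peripheralProj (Φ : Module.End ℂ V) : Module.End ℂ V :=
  spectralProjector Φ (Metric.sphere 0 1)

/-- The complementary projector `Q = Id - P`. -/
def contractingProj (Φ : Module.End ℂ V) : Module.End ℂ V := 1 - peripheralProj Φ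

end Spectral

/-! ### The hypotheses on a family of maps `s ↦ 𝓛 s`, `s ∈ [0,1]`

The maps act on the matrices equipped with the trace norm. -/

section Hypotheses

variable {ι : Type*} [Fintype ι] [DecidableEq ι]

/-- Every `𝓛 s` is a contraction. -/
def H1 (𝓛 : ℝ → Module.End ℂ (Matrix ι ι ℂ)) : Prop :=
  ∀ s ∈ Set.Icc (0 : ℝ) 1, ∀ A, traceNorm (𝓛 s A) ≤ traceNorm A

/-- The peripheral eigenvalues are simple, with a uniform gap between them. -/
def H2 (𝓛 : ℝ → Module.End ℂ (Matrix ι ι ℂ)) : Prop :=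
  (∀ s ∈ Set.Icc (0 : ℝ) 1, ∀ e ∈ spectrum ℂ (𝓛 s) ∩ Metric.sphere 0 1,
    Module.finrank ℂ ((𝓛 s).maxGenEigenspace e) = 1) ∧
  ∃ ε > 0, ∀ s ∈ Set.Icc (0 : ℝ) 1, ∀ e ∈ spectrum ℂ (𝓛 s) ∩ Metric.sphere 0 1,
    ∀ e' ∈ spectrum ℂ (𝓛 s) ∩ Metric.sphere 0 1, e ≠ e' → 2 * ε < ‖e - e'‖

/-- `s ↦ 𝓛 s ∘ P s` is `C²` on `[0,1]` (all of its matrix elements are). -/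
def H3 (𝓛 : ℝ → Module.End ℂ (Matrix ι ι ℂ)) : Prop :=
  ∀ (A : Matrix ι ι ℂ) (i j : ι),
    ContDiffOn ℝ 2 (fun s => (𝓛 s * peripheralProj (𝓛 s)) A i j) (Set.Icc 0 1)

/-- `sup_s ‖𝓛 s ∘ Q s‖ ≤ ℓ`, with the operator norm on maps between matrices with the
trace norm. -/
def H4With (𝓛 : ℝ → Module.End ℂ (Matrix ι ι ℂ)) (ℓ : ℝ) : Prop :=
  ∀ s ∈ Set.Icc (0 : ℝ) 1, ∀ A,
    traceNorm ((𝓛 s * contractingProj (𝓛 s)) A) ≤ ℓ * traceNorm A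

/-- `sup_s ‖𝓛 s ∘ Q s‖ < 1`. -/
def H4 (𝓛 : ℝ → Module.End ℂ (Matrix ι ι ℂ)) : Prop := ∃ ℓ < 1, H4With 𝓛 ℓ

/-- `ℓ' = sup_s spr (𝓛 s ∘ Q s)`. -/
def supSpr (𝓛 : ℝ → Module.End ℂ (Matrix ι ι ℂ)) : ℝ≥0∞ :=
  ⨆ s ∈ Set.Icc (0 : ℝ) 1, spectralRadius ℂ (𝓛 s * contractingProj (𝓛 s))

/-- The weak form of `H4`: `sup_s spr (𝓛 s ∘ Q s) < 1`. -/
def WeakH4 (𝓛 : ℝ → Module.End ℂ (Matrix ι ι ℂ)) : Prop := supSpr 𝓛 < 1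

end Hypotheses

/-! ### Adiabatic repeated interaction systems -/

/-- The data of an adiabatic repeated interaction system on `ℂ^S ⊗ ℂ^E`: system Hamiltonian,
interaction time and coupling constant, and `C²` functions on `[0,1]` giving the probe Hamiltonian,
the inverse temperature and the interaction. (Values outside `[0,1]` play no role.) -/
structure ADRIS (S E : Type*) where
  hS : Matrix S S ℂ
  τ : ℝ
  coupling : ℝ
  hE : ℝ → Matrix E E ℂ
  β : ℝ → ℝ
  v : ℝ → Matrix (S × E) (S × E) ℂ
  hS_herm : hS.IsHermitian
  τ_pos : 0 < τ
  hE_herm : ∀ s ∈ Set.Icc (0 : ℝ) 1, (hE s).IsHermitian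
  v_herm : ∀ s ∈ Set.Icc (0 : ℝ) 1, (v s).IsHermitian
  hE_C2 : ∀ i j, ContDiffOn ℝ 2 (fun s => hE s i j) (Set.Icc 0 1)
  β_C2 : ContDiffOn ℝ 2 β (Set.Icc 0 1)
  v_C2 : ∀ i j, ContDiffOn ℝ 2 (fun s => v s i j) (Set.Icc 0 1)

namespace ADRIS

variable {S E : Type*} [Fintype S] [DecidableEq S] [Fintype E] [DecidableEq E]

/-- `U(s) = exp (-iτ (h_S ⊗ 1 + 1 ⊗ h_E(s) + λ v(s)))`. -/
def U (R : ADRIS S E) (s : ℝ) : Matrix (S × E) (S × E) ℂ :=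
  NormedSpace.exp ((-(Complex.I * (R.τ : ℂ))) •
    (R.hS ⊗ₖ (1 : Matrix E E ℂ) + (1 : Matrix S S ℂ) ⊗ₖ R.hE s + (R.coupling : ℂ) • R.v s))

/-- The probe state `ξ(s)`. -/
def ξ (R : ADRIS S E) (s : ℝ) : Matrix E E ℂ := gibbs (R.β s) (R.hE s)

/-- The reduced dynamics `𝓛(s)(η) = Tr_E (U(s) (η ⊗ ξ(s)) U(s)*)`. -/
def L (R : ADRIS S E) (s : ℝ) : Module.End ℂ (Matrix S S ℂ) := channel (R.U s) (R.ξ s)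

/-- The invariant state of `𝓛(s)`. -/
def ρinv (R : ADRIS S E) (s : ℝ) : Matrix S S ℂ :=
  Classical.epsilon fun ρ => IsInvariantState (R.L s) ρ

/-- `X(s) = U(s) (ρ_s^inv ⊗ ξ(s)) U(s)* - ρ_s^inv ⊗ ξ(s)`. -/
def X (R : ADRIS S E) (s : ℝ) : Matrix (S × E) (S × E) ℂ :=
  R.U s * (R.ρinv s ⊗ₖ R.ξ s) * (R.U s).conjTranspose - R.ρinv s ⊗ₖ R.ξ s

/-- The parameter `([(k-1)/m] + 1)/T` of the `k`-th probe, `k = 1, …, mT`, of the `m`-repeated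
version of the system; for `m = 1` this is `k/T`. -/
def param (m T k : ℕ) : ℝ := (((k - 1) / m + 1 : ℕ) : ℝ) / (T : ℝ)

/-- The state of the system after the first `k` interactions in the `m`-repeated version. -/
def state (R : ADRIS S E) (m T : ℕ) (ρi : Matrix S S ℂ) : ℕ → Matrix S S ℂ
  | 0 => ρi
  | k + 1 => R.L (param m T (k + 1)) (state R m T ρi k)

/-- The entropy production of the `k`-th interaction (`k ≥ 1`) in the `m`-repeated version. -/
def entropyProd (R : ADRIS S E) (m T : ℕ) (ρi : Matrix S S ℂ) (k : ℕ) : ℝ :=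
  let s := param m T k
  let ρ := R.state m T ρi (k - 1)
  relEntropy (R.U s * (ρ ⊗ₖ R.ξ s) * (R.U s).conjTranspose) (R.L s ρ ⊗ₖ R.ξ s)

/-- The total entropy production `σ_T^tot` of the `m`-repeated version. -/
def totalEntropyProd (R : ADRIS S E) (m : ℕ) (ρi : Matrix S S ℂ) (T : ℕ) : ℝ :=
  ∑ k ∈ Finset.Icc 1 (m * T), R.entropyProd m T ρi k

/-- The system itself (`m = 1`), with irreducible reduced dynamics satisfying `H4`. -/
def CaseI (R : ADRIS S E) (m : ℕ) : Prop :=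
  m = 1 ∧ (∀ s ∈ Set.Icc (0 : ℝ) 1, IsIrreducible (R.L s)) ∧ H4 R.L

/-- The `m`-repeated version, with irreducible reduced dynamics satisfying the weak form of `H4`,
where `m ≥ 1` goes with some `ℓ ∈ (ℓ', 1)`, that is, `s ↦ 𝓛(s)^m` satisfies `H1`, `H2`, `H3`, and
`H4` with the bound `ℓ`. -/
def CaseII (R : ADRIS S E) (m : ℕ) : Prop :=
  1 ≤ m ∧ (∀ s ∈ Set.Icc (0 : ℝ) 1, IsIrreducible (R.L s)) ∧ WeakH4 R.L ∧
    ∃ ℓ : ℝ, supSpr R.L < ENNReal.ofReal ℓ ∧ ℓ < 1 ∧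
      H1 (fun s => R.L s ^ m) ∧ H2 (fun s => R.L s ^ m) ∧ H3 (fun s => R.L s ^ m) ∧
      H4With (fun s => R.L s ^ m) ℓ

end ADRIS

end RIS

end

/-! Write `M s = L(s)^m`, `K s = log ρ_s^inv` and `y_j` for the state after `j` blocks of `m`
interactions.

Entropy balance. Unitary invariance of the entropy, additivity of the logarithm on products and the
Gibbs form of the probe turn one relative entropy into a drop of `Tr ρ log ρ` plus a linear energy
flux (`ADRIS.relEntropy_eq_flux`). The entropies telescope along the evolution, so everything hinges
on the sum of the fluxes.

Case `X = 0`. Then `U` commutes with `log (ρ_s^inv ⊗ ξ)`, and the flux of `A` is `Tr (L(A) K) - Tr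
(A K)` (`ADRIS.flux_eq_of_commute`). Summation by parts gives `S(ρ^i|ρ_0^inv) - S(y_T|ρ_1^inv)`
minus the sum of `Tr (y_j (K(s_{j+1}) - K(s_j)))`. The last sum vanishes as `T → ∞`. The invariant
part of `y_j` sees only second order increments, since `-Tr (ρ_s^inv (K t - K s))` is a relative
entropy that is dominated by its symmetrization (`Regular.exists_trace_increment_le`). The traceless
remainder lies in the range of `1 - M` and is summed by parts (`tendsto_sum_increments`). No
derivative of the logarithm is taken: on traceless operators `K` equals minus the flux composed with
the reduced resolvent (`Regular.exists_kappa`). What remains is the limit of `S(y_T|ρ_1^inv)`. By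
the adiabatic theorem (`exists_adiabatic_limit`) `y_T` approaches the periodic orbit of a state `ω`
under `M 1`; relative entropy to `ρ_1^inv` decreases under `L(1)`, hence is constant on that orbit.
An initial invariant state is transported to an invariant state, and both terms are zero.

Case `X(s) ≠ 0`. Each interaction produces at least half the squared Hilbert-Schmidt norm of the
correlations it creates (`half_sq_le_relEntropy`). Averaging the states over a window of about `δT`
parameters near `s` gives an almost invariant state, and by compactness such a state gets correlated
by a definite amount (`Regular.exists_pos_le`). Cauchy-Schwarz makes the production grow linearly in
`T`.

Spectral input. Irreducibility makes the invariant state faithful and unique, and the peripheral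
eigenvalues roots of unity whose order is bounded by the dimension of the operator space
(`IsDilation.pow_factorial_eq_one`). Hence one exponent `n` satisfies `M(s)^n P(s) = P(s)` for all
`s`, the eigenprojections are averages over a period, and no eigenvalue has to be followed in `s`.
The gap bounds the reduced resolvents uniformly, and resolvent identities pass the regularity of `M`
on to them. Regularity is recorded as bounds on first and second differences (`TwiceLip`), the only
form in which the discrete time evolution uses it.

The example swaps a qubit with a maximally mixed one: the first interaction forgets the initial
state, and a pure initial state costs `log 2`. -/

noncomputable section

namespace RIS

open Filter Asymptotics Set

/-! ### Families with bounded second differences -/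

/-- The pairs `(s, h)` such that `s` and `s + 2h` lie in `[0,1]`. -/
def stepSet : Set (ℝ × ℝ) := {p | p.1 ∈ Icc (0 : ℝ) 1 ∧ p.1 + 2 * p.2 ∈ Icc (0 : ℝ) 1}

/-- A family on `[0,1]` that is bounded and Lipschitz, with second differences of order `h²`. -/
structure TwiceLip {F : Type*} [NormedAddCommGroup F] (f : ℝ → F) : Prop where
  bdd : f =O[𝓟 (Icc 0 1)] (fun _ => (1 : ℝ))
  lip : (fun p : ℝ × ℝ => f p.1 - f p.2) =O[𝓟 (Icc 0 1 ×ˢ Icc 0 1)] (fun p => p.1 - p.2)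
  snd : (fun p : ℝ × ℝ => (f (p.1 + 2 * p.2) - f (p.1 + p.2)) - (f (p.1 + p.2) - f p.1))
    =O[𝓟 stepSet] (fun p => p.2 ^ 2)

section TwiceLip

variable {𝔸 : Type*} [NormedRing 𝔸] {F : Type*} [NormedAddCommGroup F]

theorem stepSet_mid {p : ℝ × ℝ} (hp : p ∈ stepSet) : p.1 + p.2 ∈ Icc (0 : ℝ) 1 := by
  obtain ⟨⟨h1, h2⟩, h3, h4⟩ := hp
  constructor <;> linarith

theorem bdd_comp {f : ℝ → F} (hf : f =O[𝓟 (Icc 0 1)] (fun _ => (1 : ℝ))) {g : ℝ × ℝ → ℝ}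
    (hg : ∀ p ∈ stepSet, g p ∈ Icc (0 : ℝ) 1) :
    (fun p => f (g p)) =O[𝓟 stepSet] (fun _ => (1 : ℝ)) :=
  hf.comp_tendsto (tendsto_principal_principal.2 hg)

theorem lip_comp {f : ℝ → F}
    (hf : (fun p : ℝ × ℝ => f p.1 - f p.2) =O[𝓟 (Icc 0 1 ×ˢ Icc 0 1)] (fun p => p.1 - p.2))
    {g k : ℝ × ℝ → ℝ} (hg : ∀ p ∈ stepSet, g p ∈ Icc (0 : ℝ) 1)
    (hk : ∀ p ∈ stepSet, k p ∈ Icc (0 : ℝ) 1) (h : ∀ p : ℝ × ℝ, g p - k p = p.2) :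
    (fun p => f (g p) - f (k p)) =O[𝓟 stepSet] (fun p => p.2) := by
  have hgk : Tendsto (fun p => (g p, k p)) (𝓟 stepSet) (𝓟 (Icc 0 1 ×ˢ Icc 0 1)) :=
    tendsto_principal_principal.2 fun p hp => ⟨hg p hp, hk p hp⟩
  have := hf.comp_tendsto hgk
  simpa [Function.comp_def, h] using this

theorem TwiceLip.const (a : F) : TwiceLip (fun _ : ℝ => a) where
  bdd := isBigO_const_const a one_ne_zero _
  lip := by simpa using isBigO_zero _ _
  snd := by simpa using isBigO_zero _ _

theorem TwiceLip.add {f g : ℝ → F} (hf : TwiceLip f) (hg : TwiceLip g) :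
    TwiceLip (fun s => f s + g s) where
  bdd := hf.bdd.add hg.bdd
  lip := (hf.lip.add hg.lip).congr_left fun p => by abel
  snd := (hf.snd.add hg.snd).congr_left fun p => by abel

theorem TwiceLip.neg {f : ℝ → F} (hf : TwiceLip f) : TwiceLip (fun s => - f s) where
  bdd := hf.bdd.neg_left
  lip := hf.lip.neg_left.congr_left fun p => by abel
  snd := hf.snd.neg_left.congr_left fun p => by abel

theorem TwiceLip.sub {f g : ℝ → F} (hf : TwiceLip f) (hg : TwiceLip g) :
    TwiceLip (fun s => f s - g s) := by
  simpa only [sub_eq_add_neg] using hf.add hg.neg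

theorem bdd_mul {α : Type*} {l : Filter α} {f g : α → 𝔸} (hf : f =O[l] (fun _ => (1 : ℝ)))
    (hg : g =O[l] (fun _ => (1 : ℝ))) : (fun s => f s * g s) =O[l] (fun _ => (1 : ℝ)) := by
  simpa using hf.mul hg

theorem lip_mul {f g : ℝ → 𝔸} (hf : f =O[𝓟 (Icc 0 1)] (fun _ => (1 : ℝ)))
    (hg : g =O[𝓟 (Icc 0 1)] (fun _ => (1 : ℝ)))
    (hf' : (fun p : ℝ × ℝ => f p.1 - f p.2) =O[𝓟 (Icc 0 1 ×ˢ Icc 0 1)] (fun p => p.1 - p.2))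
    (hg' : (fun p : ℝ × ℝ => g p.1 - g p.2) =O[𝓟 (Icc 0 1 ×ˢ Icc 0 1)] (fun p => p.1 - p.2)) :
    (fun p : ℝ × ℝ => f p.1 * g p.1 - f p.2 * g p.2) =O[𝓟 (Icc 0 1 ×ˢ Icc 0 1)]
      (fun p => p.1 - p.2) := by
  have h1 : (fun p : ℝ × ℝ => f p.2) =O[𝓟 (Icc 0 1 ×ˢ Icc 0 1)] (fun _ => (1 : ℝ)) :=
    hf.comp_tendsto (tendsto_principal_principal.2 fun p hp => hp.2)
  have h2 : (fun p : ℝ × ℝ => g p.1) =O[𝓟 (Icc 0 1 ×ˢ Icc 0 1)] (fun _ => (1 : ℝ)) :=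
    hg.comp_tendsto (tendsto_principal_principal.2 fun p hp => hp.1)
  have := (hf'.mul h2).add ((h1.mul hg').congr_right (g₂ := fun p => (p.1 - p.2) * 1)
    fun p => by ring)
  refine (this.congr_left fun p => ?_).congr_right fun p => by ring
  noncomm_ring

/-- Discrete Leibniz rule: with values `f₀, f₁, f₂` and `g₀, g₁, g₂` on the three points, the second
difference of the product is `(Δ²f) g₂ + f₀ (Δ²g) + 2 (f₁ - f₀)(g₂ - g₁)`. -/
theorem TwiceLip.mul {f g : ℝ → 𝔸} (hf : TwiceLip f) (hg : TwiceLip g) :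
    TwiceLip (fun s => f s * g s) where
  bdd := bdd_mul hf.bdd hg.bdd
  lip := lip_mul hf.bdd hg.bdd hf.lip hg.lip
  snd := by
    have h0 := bdd_comp hf.bdd (g := fun p => p.1) fun p hp => hp.1
    have h2 := bdd_comp hg.bdd (g := fun p => p.1 + 2 * p.2) fun p hp => hp.2
    have h3 := lip_comp hf.lip (g := fun p => p.1 + p.2) (k := fun p => p.1)
      (fun p hp => stepSet_mid hp) (fun p hp => hp.1) (fun p => by ring)
    have h4 := lip_comp hg.lip (g := fun p => p.1 + 2 * p.2) (k := fun p => p.1 + p.2)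
      (fun p hp => hp.2) (fun p hp => stepSet_mid hp) (fun p => by ring)
    have e1 := hf.snd.mul h2
    have e2 := h0.mul hg.snd
    have e3 := h3.mul h4
    have := ((e1.congr_right (g₂ := fun p => p.2 ^ 2) fun p => by ring).add
      (e2.congr_right (g₂ := fun p => p.2 ^ 2) fun p => by ring)).add
      ((e3.add e3).congr_right (g₂ := fun p => p.2 ^ 2) fun p => by ring)
    refine this.congr_left fun p => ?_
    noncomm_ring

theorem TwiceLip.pow {f : ℝ → 𝔸} (hf : TwiceLip f) (n : ℕ) : TwiceLip (fun s => f s ^ n) := by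
  induction n with
  | zero => simpa using TwiceLip.const (1 : 𝔸)
  | succ n ih => simpa only [pow_succ] using ih.mul hf

theorem TwiceLip.sum {ι : Type*} (t : Finset ι) {f : ι → ℝ → F} (hf : ∀ i ∈ t, TwiceLip (f i)) :
    TwiceLip (fun s => ∑ i ∈ t, f i s) := by
  classical
  induction t using Finset.induction_on with
  | empty => simpa using TwiceLip.const (0 : F)
  | insert a t ha ih =>
    simp only [Finset.sum_insert ha]
    exact (hf _ (by simp)).add (ih fun i hi => hf _ (by simp [hi]))

theorem TwiceLip.congr {f g : ℝ → F} (hf : TwiceLip f) (h : ∀ s ∈ Icc (0 : ℝ) 1, f s = g s) :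
    TwiceLip g where
  bdd := hf.bdd.congr' (eventually_principal.2 fun s hs => h s hs) .rfl
  lip := hf.lip.congr' (eventually_principal.2 fun p hp => by
    simp only [h _ hp.1, h _ hp.2]) .rfl
  snd := hf.snd.congr' (eventually_principal.2 fun p hp => by
    simp only [h _ hp.1, h _ hp.2, h _ (stepSet_mid hp)]) .rfl

theorem TwiceLip.clm {E F : Type*} [NormedAddCommGroup E] [NormedAddCommGroup F]
    [NormedSpace ℝ E] [NormedSpace ℝ F] (Λ : E →L[ℝ] F) {f : ℝ → E}
    (hf : TwiceLip f) : TwiceLip (fun s => Λ (f s)) where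
  bdd := (Λ.isBigO_comp f _).trans hf.bdd
  lip := ((Λ.isBigO_comp _ _).trans hf.lip).congr_left fun p => by simp
  snd := ((Λ.isBigO_comp _ _).trans hf.snd).congr_left fun p => by simp

/-! ### Regularity of eigenprojections and reduced resolvents -/

/-- `R` is the eigenprojection of `M` at the eigenvalue `1`, and `G` the reduced resolvent. -/
structure RedRes (M R G : ℝ → 𝔸) : Prop where
  RM : ∀ s ∈ Icc (0 : ℝ) 1, R s * M s = R s
  MR : ∀ s ∈ Icc (0 : ℝ) 1, M s * R s = R s
  RR : ∀ s ∈ Icc (0 : ℝ) 1, R s * R s = R s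
  RG : ∀ s ∈ Icc (0 : ℝ) 1, R s * G s = 0
  GR : ∀ s ∈ Icc (0 : ℝ) 1, G s * R s = 0
  MG : ∀ s ∈ Icc (0 : ℝ) 1, (1 - M s) * G s = 1 - R s
  GM : ∀ s ∈ Icc (0 : ℝ) 1, G s * (1 - M s) = 1 - R s
  bddR : R =O[𝓟 (Icc 0 1)] (fun _ => (1 : ℝ))
  bddG : G =O[𝓟 (Icc 0 1)] (fun _ => (1 : ℝ))

variable {M R G : ℝ → 𝔸}

/-- The two terms are `R s (1 - R t)` and `-(1 - R s) R t`, because `R s` absorbs `M s` and `M t` is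
absorbed by `R t`. An increment of `R` is thus an increment of `M` between bounded factors. -/
theorem RedRes.R_sub (h : RedRes M R G) {s t : ℝ} (hs : s ∈ Icc (0 : ℝ) 1)
    (ht : t ∈ Icc (0 : ℝ) 1) :
    R s - R t = R s * (M s - M t) * G t + G s * (M s - M t) * R t := by
  have h1 : R s * (M s - M t) * G t = R s * (1 - R t) := by
    rw [← h.MG t ht, mul_sub, h.RM s hs]; noncomm_ring
  have h2 : G s * (M s - M t) * R t = -((1 - R s) * R t) := by
    rw [← h.GM s hs, mul_assoc, sub_mul, h.MR t ht]; noncomm_ring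
  rw [h1, h2]; noncomm_ring

/-- `G + R` is a genuine two-sided inverse, of `1 - M + R`, so that this is the second resolvent
identity. -/
theorem RedRes.GR_sub (h : RedRes M R G) {s t : ℝ} (hs : s ∈ Icc (0 : ℝ) 1)
    (ht : t ∈ Icc (0 : ℝ) 1) :
    (G s + R s) - (G t + R t) =
      (G s + R s) * ((M s - R s) - (M t - R t)) * (G t + R t) := by
  have h1 : (G s + R s) * (1 - M s + R s) = 1 := by
    have : (G s + R s) * (1 - M s + R s)
      = G s * (1 - M s) + G s * R s + (R s - R s * M s) + R s * R s := by noncomm_ring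
    rw [this, h.GM s hs, h.GR s hs, h.RM s hs, h.RR s hs]; noncomm_ring
  have h2 : (1 - M t + R t) * (G t + R t) = 1 := by
    have : (1 - M t + R t) * (G t + R t)
      = (1 - M t) * G t + (R t - M t * R t) + R t * G t + R t * R t := by noncomm_ring
    rw [this, h.MG t ht, h.RG t ht, h.MR t ht, h.RR t ht]; noncomm_ring
  calc (G s + R s) - (G t + R t)
      = (G s + R s) * ((1 - M t + R t) * (G t + R t)) -
        ((G s + R s) * (1 - M s + R s)) * (G t + R t) := by rw [h1, h2]; noncomm_ring
    _ = _ := by noncomm_ring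

theorem pair_bdd {f : ℝ → F} (hf : f =O[𝓟 (Icc 0 1)] (fun _ => (1 : ℝ))) :
    (fun p : ℝ × ℝ => f p.1) =O[𝓟 (Icc 0 1 ×ˢ Icc 0 1)] (fun _ => (1 : ℝ)) ∧
    (fun p : ℝ × ℝ => f p.2) =O[𝓟 (Icc 0 1 ×ˢ Icc 0 1)] (fun _ => (1 : ℝ)) :=
  ⟨hf.comp_tendsto (tendsto_principal_principal.2 fun _ hp => hp.1),
   hf.comp_tendsto (tendsto_principal_principal.2 fun _ hp => hp.2)⟩

theorem mul3_bigO {α : Type*} {l : Filter α} {f g k : α → 𝔸} {φ : α → ℝ}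
    (hf : f =O[l] (fun _ => (1 : ℝ))) (hg : g =O[l] φ) (hk : k =O[l] (fun _ => (1 : ℝ))) :
    (fun x => f x * g x * k x) =O[l] φ := by
  simpa using (hf.mul hg).mul hk

/-- Families whose increments factor through those of a `TwiceLip` family are `TwiceLip`. -/
theorem snd_of_factor {a b N : ℝ → 𝔸} (hN : TwiceLip N)
    (ha : a =O[𝓟 (Icc 0 1)] (fun _ => (1 : ℝ))) (hb : b =O[𝓟 (Icc 0 1)] (fun _ => (1 : ℝ)))
    (ha' : (fun p : ℝ × ℝ => a p.1 - a p.2) =O[𝓟 (Icc 0 1 ×ˢ Icc 0 1)] (fun p => p.1 - p.2))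
    (hb' : (fun p : ℝ × ℝ => b p.1 - b p.2) =O[𝓟 (Icc 0 1 ×ˢ Icc 0 1)] (fun p => p.1 - p.2)) :
    (fun p : ℝ × ℝ => a (p.1 + 2 * p.2) * (N (p.1 + 2 * p.2) - N (p.1 + p.2)) * b (p.1 + p.2)
      - a (p.1 + p.2) * (N (p.1 + p.2) - N p.1) * b p.1) =O[𝓟 stepSet] (fun p => p.2 ^ 2) := by
  have a1 := bdd_comp ha (g := fun p => p.1 + p.2) fun p hp => stepSet_mid hp
  have a2 := bdd_comp ha (g := fun p => p.1 + 2 * p.2) fun p hp => hp.2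
  have b1 := bdd_comp hb (g := fun p => p.1 + p.2) fun p hp => stepSet_mid hp
  have da := lip_comp ha' (g := fun p => p.1 + 2 * p.2) (k := fun p => p.1 + p.2)
      (fun p hp => hp.2) (fun p hp => stepSet_mid hp) (fun p => by ring)
  have db := lip_comp hb' (g := fun p => p.1 + p.2) (k := fun p => p.1)
      (fun p hp => stepSet_mid hp) (fun p hp => hp.1) (fun p => by ring)
  have dN := lip_comp hN.lip (g := fun p => p.1 + p.2) (k := fun p => p.1)
      (fun p hp => stepSet_mid hp) (fun p hp => hp.1) (fun p => by ring)
  -- Three sources of second order: the second difference of `N`, and the increments of `a` and of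
  -- `b`, each multiplied by an increment of `N`.
  have e1 := mul3_bigO a2 hN.snd b1
  have e2 := ((da.mul dN).mul b1).congr_right (g₂ := fun p => p.2 ^ 2) fun p => by ring
  have e3 := ((a1.mul dN).mul db).congr_right (g₂ := fun p => p.2 ^ 2) fun p => by ring
  refine ((e1.add e2).add e3).congr_left fun p => ?_
  noncomm_ring

theorem RedRes.lipR (h : RedRes M R G) (hM : TwiceLip M) :
    (fun p : ℝ × ℝ => R p.1 - R p.2) =O[𝓟 (Icc 0 1 ×ˢ Icc 0 1)] (fun p => p.1 - p.2) := by
  have := (mul3_bigO (pair_bdd h.bddR).1 hM.lip (pair_bdd h.bddG).2).add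
    (mul3_bigO (pair_bdd h.bddG).1 hM.lip (pair_bdd h.bddR).2)
  exact this.congr' (eventually_principal.2 fun p hp => (h.R_sub hp.1 hp.2).symm) .rfl

theorem RedRes.lipGR (h : RedRes M R G) (hM : TwiceLip M) :
    (fun p : ℝ × ℝ => (G p.1 + R p.1) - (G p.2 + R p.2)) =O[𝓟 (Icc 0 1 ×ˢ Icc 0 1)]
      (fun p => p.1 - p.2) := by
  have hb := h.bddG.add h.bddR
  have := mul3_bigO (pair_bdd hb).1 (hM.lip.sub (h.lipR hM)) (pair_bdd hb).2
  refine this.congr' (eventually_principal.2 fun p hp => ?_) .rfl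
  simp only [h.GR_sub hp.1 hp.2]
  noncomm_ring

theorem RedRes.lipG (h : RedRes M R G) (hM : TwiceLip M) :
    (fun p : ℝ × ℝ => G p.1 - G p.2) =O[𝓟 (Icc 0 1 ×ˢ Icc 0 1)] (fun p => p.1 - p.2) :=
  ((h.lipGR hM).sub (h.lipR hM)).congr_left fun p => by abel

theorem RedRes.twiceLipR (h : RedRes M R G) (hM : TwiceLip M) : TwiceLip R where
  bdd := h.bddR
  lip := h.lipR hM
  snd := by
    have e1 := snd_of_factor hM h.bddR h.bddG (h.lipR hM) (h.lipG hM)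
    have e2 := snd_of_factor hM h.bddG h.bddR (h.lipG hM) (h.lipR hM)
    refine (e1.add e2).congr' (eventually_principal.2 fun p hp => ?_) .rfl
    simp only
    rw [h.R_sub hp.2 (stepSet_mid hp), h.R_sub (stepSet_mid hp) hp.1]
    abel

/-- The increments of `G + R` factor through those of `M - R`, so the regularity of `R` has to be
known beforehand. -/
theorem RedRes.twiceLipG (h : RedRes M R G) (hM : TwiceLip M) : TwiceLip G := by
  have hGR : TwiceLip (fun s => G s + R s) :=
    { bdd := h.bddG.add h.bddR
      lip := h.lipGR hM
      snd := by
        have e1 := snd_of_factor (hM.sub (h.twiceLipR hM)) (h.bddG.add h.bddR)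
          (h.bddG.add h.bddR) (h.lipGR hM) (h.lipGR hM)
        refine e1.congr' (eventually_principal.2 fun p hp => ?_) .rfl
        simp only
        rw [h.GR_sub hp.2 (stepSet_mid hp), h.GR_sub (stepSet_mid hp) hp.1] }
  simpa using hGR.sub (h.twiceLipR hM)

end TwiceLip

end RIS

end

noncomputable section

namespace RIS

open Filter Asymptotics Set

/-! ### Adiabatic evolution on the grid `k / T` -/

section Adiabatic

variable {𝔸 : Type*} [NormedRing 𝔸]

/-- The time-ordered product `M (k / T) ⋯ M (2 / T) M (1 / T)`. -/
def evol (M : ℝ → 𝔸) (T : ℕ) : ℕ → 𝔸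
  | 0 => 1
  | k + 1 => M ((k + 1 : ℕ) / T) * evol M T k

theorem grid_mem {T k : ℕ} (h : k ≤ T) : (k : ℝ) / T ∈ Icc (0 : ℝ) 1 := by
  constructor
  · positivity
  · exact div_le_one_of_le₀ (by exact_mod_cast h) (by positivity)

theorem TwiceLip.exists_bound {F : Type*} [NormedAddCommGroup F] {f : ℝ → F} (hf : TwiceLip f) :
    ∃ C > 0, (∀ s ∈ Icc (0 : ℝ) 1, ‖f s‖ ≤ C) ∧
      (∀ s ∈ Icc (0 : ℝ) 1, ∀ t ∈ Icc (0 : ℝ) 1, ‖f s - f t‖ ≤ C * |s - t|) ∧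
      (∀ T k : ℕ, k + 1 < T →
        ‖(f ((k + 2 : ℕ) / T) - f ((k + 1 : ℕ) / T)) - (f ((k + 1 : ℕ) / T) - f (k / T))‖
          ≤ C * (1 / T) ^ 2) := by
  obtain ⟨C₁, h₁⟩ := hf.bdd.bound
  obtain ⟨C₂, h₂⟩ := hf.lip.bound
  obtain ⟨C₃, h₃⟩ := hf.snd.bound
  rw [eventually_principal] at h₁ h₂ h₃
  -- One constant serves all three bounds; the `1` only makes it positive.
  refine ⟨max 1 (max C₁ (max C₂ C₃)), by positivity, fun s hs => ?_, fun s hs t ht => ?_,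
    fun T k hk => ?_⟩
  · refine (h₁ s hs).trans ?_
    simp
  · refine (h₂ (s, t) ⟨hs, ht⟩).trans ?_
    simp only [Real.norm_eq_abs]
    gcongr
    simp
  · have hT : (T : ℝ) ≠ 0 := by exact_mod_cast (by omega : T ≠ 0)
    have hp : ((k : ℝ) / T, 1 / (T : ℝ)) ∈ stepSet := by
      refine ⟨grid_mem (by omega), ?_⟩
      have := grid_mem (T := T) (k := k + 2) (by omega)
      convert this using 1
      push_cast; field_simp
    have h := h₃ _ hp
    simp only [norm_pow, Real.norm_eq_abs, sq_abs] at h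
    have e1 : (k : ℝ) / T + 2 * (1 / T) = (k + 2 : ℕ) / T := by push_cast; field_simp
    have e2 : (k : ℝ) / T + 1 / T = (k + 1 : ℕ) / T := by push_cast; field_simp
    rw [e1, e2] at h
    refine h.trans ?_
    gcongr
    simp

theorem grid_step (T k : ℕ) : |((k + 1 : ℕ) : ℝ) / T - k / T| = 1 / T := by
  rw [← sub_div]; push_cast; rw [add_sub_cancel_left, abs_of_nonneg (by positivity)]

theorem sum_abel (Γ Z : ℕ → 𝔸) (N : ℕ) :
    ∑ k ∈ Finset.range (N + 1), Γ k * (Z k - Z (k + 1)) =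
      Γ 0 * Z 0 - Γ N * Z (N + 1) + ∑ k ∈ Finset.range N, (Γ (k + 1) - Γ k) * Z (k + 1) := by
  induction N with
  | zero => simp [mul_sub]
  | succ N ih => rw [Finset.sum_range_succ, ih, Finset.sum_range_succ _ N]; noncomm_ring

theorem norm_sum_le_card_mul {F : Type*} [NormedAddCommGroup F] {N : ℕ} {f : ℕ → F} {c : ℝ}
    (h : ∀ k < N, ‖f k‖ ≤ c) : ‖∑ k ∈ Finset.range N, f k‖ ≤ N * c := by
  have := norm_sum_le_of_le (Finset.range N) (f := f) (n := fun _ => c)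
    fun k hk => h k (Finset.mem_range.1 hk)
  simpa using this

/-- Summation by parts along the evolution. -/
theorem norm_sum_one_sub_le {M : ℝ → 𝔸} (hM : TwiceLip M) {B : ℝ}
    (hZ : ∀ T k, k ≤ T → ‖evol M T k‖ ≤ B) (C : ℝ) (hC : 0 ≤ C) :
    ∃ D, ∀ (T : ℕ) (Γ : ℕ → 𝔸), 0 < T → (∀ k < T, ‖Γ k‖ ≤ C * (1 / T)) →
      (∀ k, k + 1 < T → ‖Γ (k + 1) - Γ k‖ ≤ C * (1 / T) ^ 2) →
      ‖∑ k ∈ Finset.range T, Γ k * ((1 - M (k / T)) * evol M T k)‖ ≤ D * (1 / T) := by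
  obtain ⟨A, hA, -, hlip, -⟩ := hM.exists_bound
  have hB : 0 ≤ B := (norm_nonneg _).trans (hZ 0 0 le_rfl)
  refine ⟨C * B + C * B + C * B + C * A * B, fun T Γ hT hΓ hdΓ => ?_⟩
  have hT' : (0 : ℝ) < T := by exact_mod_cast hT
  -- Up to replacing `M (k / T)` by the `M ((k + 1) / T)` that drives the next step, `1 - M` acts as
  -- a discrete derivative of the evolution. Summation by parts moves it onto `Γ`: two boundary
  -- terms of size `1 / T`, and sums of about `T` terms of size `1 / T²`.
  have key : ∀ k : ℕ, (1 - M (k / T)) * evol M T k = (evol M T k - evol M T (k + 1)) +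
      (M ((k + 1 : ℕ) / T) - M (k / T)) * evol M T k := by
    intro k
    simp only [evol]
    noncomm_ring
  simp only [key, mul_add, Finset.sum_add_distrib]
  obtain ⟨N, rfl⟩ : ∃ N, T = N + 1 := ⟨T - 1, by omega⟩
  rw [sum_abel]
  set h : ℝ := 1 / ((N + 1 : ℕ) : ℝ) with hh
  have hh0 : 0 ≤ h := by positivity
  have hN : ((N + 1 : ℕ) : ℝ) * h = 1 := by rw [hh]; field_simp
  have hN' : (N : ℝ) * h ≤ 1 := by push_cast at hN; nlinarith
  have b1 : ‖Γ 0 * evol M (N + 1) 0‖ ≤ C * B * h := by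
    refine (norm_mul_le _ _).trans ?_
    calc _ ≤ (C * h) * B := by
          gcongr
          · exact hΓ 0 hT
          · exact hZ _ _ (by omega)
      _ = _ := by ring
  have b2 : ‖Γ N * evol M (N + 1) (N + 1)‖ ≤ C * B * h := by
    refine (norm_mul_le _ _).trans ?_
    calc _ ≤ (C * h) * B := by
          gcongr
          · exact hΓ N (by omega)
          · exact hZ _ _ (by omega)
      _ = _ := by ring
  have b3 : ‖∑ k ∈ Finset.range N, (Γ (k + 1) - Γ k) * evol M (N + 1) (k + 1)‖ ≤ C * B * h := by
    refine (norm_sum_le_card_mul (c := C * h ^ 2 * B) fun k hk => ?_).trans ?_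
    · refine (norm_mul_le _ _).trans ?_
      gcongr
      · exact hdΓ k (by omega)
      · exact hZ _ _ (by omega)
    · calc (N : ℝ) * (C * h ^ 2 * B) = (C * B * h) * (N * h) := by ring
        _ ≤ (C * B * h) * 1 := by gcongr
        _ = _ := by ring
  have b4 : ‖∑ k ∈ Finset.range (N + 1), Γ k *
      ((M ((k + 1 : ℕ) / (N + 1 : ℕ)) - M (k / (N + 1 : ℕ))) * evol M (N + 1) k)‖
      ≤ C * A * B * h := by
    refine (norm_sum_le_card_mul (c := C * h * (A * h * B)) fun k hk => ?_).trans ?_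
    · refine (norm_mul_le _ _).trans ?_
      gcongr
      · exact hΓ k hk
      · refine (norm_mul_le _ _).trans ?_
        gcongr
        · have := hlip _ (grid_mem (T := N + 1) (k := k + 1) (by omega)) _
            (grid_mem (T := N + 1) (k := k) (by omega))
          rwa [grid_step] at this
        · exact hZ _ _ (by omega)
    · calc ((N + 1 : ℕ) : ℝ) * (C * h * (A * h * B)) = C * A * B * h * ((N + 1 : ℕ) * h) := by ring
        _ ≤ _ := by rw [hN, mul_one]
  calc _ ≤ ‖Γ 0 * evol M (N + 1) 0‖ + ‖Γ N * evol M (N + 1) (N + 1)‖ +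
        ‖∑ k ∈ Finset.range N, (Γ (k + 1) - Γ k) * evol M (N + 1) (k + 1)‖ +
        ‖∑ k ∈ Finset.range (N + 1), Γ k *
      ((M ((k + 1 : ℕ) / (N + 1 : ℕ)) - M (k / (N + 1 : ℕ))) * evol M (N + 1) k)‖ := by
        refine (norm_add_le _ _).trans ?_
        gcongr
        refine (norm_add_le _ _).trans ?_
        gcongr
        exact norm_sub_le _ _
    _ ≤ C * B * h + C * B * h + C * B * h + C * A * B * h := by gcongr
    _ = _ := by ring

theorem tendsto_zero_of_norm_le_div {F : Type*} [NormedAddCommGroup F] {f : ℕ → F} {D : ℝ}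
    (h : ∀ T : ℕ, 0 < T → ‖f T‖ ≤ D * (1 / T)) : Tendsto f atTop (𝓝 0) := by
  refine squeeze_zero_norm' (a := fun T : ℕ => D * (1 / (T : ℝ))) ?_ ?_
  · filter_upwards [eventually_gt_atTop 0] with T hT using h T hT
  · simpa using (tendsto_one_div_atTop_nhds_zero_nat (𝕜 := ℝ)).const_mul D

variable {M R G : ℝ → 𝔸}

/-- The increments of a slowly varying observable only see the invariant part of the evolution. -/
theorem tendsto_sum_increments (h : RedRes M R G) (hM : TwiceLip M) {B : ℝ}
    (hZ : ∀ T k, k ≤ T → ‖evol M T k‖ ≤ B) {κ : ℝ → 𝔸} (hκ : TwiceLip κ) :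
    Tendsto (fun T : ℕ => ∑ k ∈ Finset.range T,
      (κ ((k + 1 : ℕ) / T) - κ (k / T)) * ((1 - R (k / T)) * evol M T k)) atTop (𝓝 0) := by
  obtain ⟨A, hA, -, hlip, hsnd⟩ := hκ.exists_bound
  obtain ⟨A', hA', hb', hlip', -⟩ := (h.twiceLipG hM).exists_bound
  obtain ⟨D, hD⟩ := norm_sum_one_sub_le hM hZ (A * A' + A * A') (by positivity)
  refine tendsto_zero_of_norm_le_div (D := D) fun T hT => ?_
  -- Since `G (1 - M) = 1 - R`, the weight containing `G` reproduces the summand once `1 - M` is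
  -- applied to the evolution. Its own increments are of second order by the bound on the second
  -- differences of `κ`.
  have := hD T (fun k => (κ ((k + 1 : ℕ) / T) - κ (k / T)) * G (k / T)) hT ?_ ?_
  · refine le_of_eq_of_le (congrArg _ (Finset.sum_congr rfl fun k hk => ?_)) this
    rw [← h.GM _ (grid_mem (Finset.mem_range.1 hk).le)]
    noncomm_ring
  · intro k hk
    refine (norm_mul_le _ _).trans ?_
    have h1 := hlip _ (grid_mem (T := T) (k := k + 1) (by omega)) _ (grid_mem (T := T) hk.le)
    rw [grid_step] at h1
    calc _ ≤ (A * (1 / T)) * A' := by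
          gcongr
          exact hb' _ (grid_mem hk.le)
      _ ≤ _ := by
          rw [add_mul]
          have : 0 ≤ A * A' * (1 / T : ℝ) := by positivity
          linarith [this, mul_right_comm A (1 / T : ℝ) A']
  · intro k hk
    have h1 := hlip _ (grid_mem (T := T) (k := k + 1) (by omega)) _
      (grid_mem (T := T) (k := k) (by omega))
    rw [grid_step] at h1
    have h2 := hlip' _ (grid_mem (T := T) (k := k + 1) (by omega)) _
      (grid_mem (T := T) (k := k) (by omega))
    rw [grid_step] at h2
    have e : (κ ((k + 1 + 1 : ℕ) / T) - κ ((k + 1 : ℕ) / T)) * G ((k + 1 : ℕ) / T) -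
        (κ ((k + 1 : ℕ) / T) - κ (k / T)) * G (k / T) =
        ((κ ((k + 2 : ℕ) / T) - κ ((k + 1 : ℕ) / T)) - (κ ((k + 1 : ℕ) / T) - κ (k / T))) *
          G ((k + 1 : ℕ) / T) +
        (κ ((k + 1 : ℕ) / T) - κ (k / T)) * (G ((k + 1 : ℕ) / T) - G (k / T)) := by
      noncomm_ring
    rw [e]
    refine (norm_add_le _ _).trans ?_
    calc _ ≤ (A * (1 / T) ^ 2) * A' + (A * (1 / T)) * (A' * (1 / T)) := by
          refine add_le_add ((norm_mul_le _ _).trans ?_) ((norm_mul_le _ _).trans ?_)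
          · gcongr
            · exact hsnd T k hk
            · exact hb' _ (grid_mem (by omega))
          · gcongr
      _ = _ := by ring

/-! ### Parallel transport as a limit of products of projections -/

/-- The descending product `f (a + n - 1) ⋯ f (a + 1) f a`. -/
def dprod (f : ℕ → 𝔸) (a : ℕ) : ℕ → 𝔸
  | 0 => 1
  | n + 1 => f (a + n) * dprod f a n

theorem dprod_add (f : ℕ → 𝔸) (a m n : ℕ) :
    dprod f a (n + m) = dprod f (a + n) m * dprod f a n := by
  induction m with
  | zero => simp [dprod]
  | succ m ih => rw [← add_assoc, dprod, ih, dprod, mul_assoc, add_assoc]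

theorem dprod_succ' (f : ℕ → 𝔸) (a n : ℕ) : dprod f a (n + 1) = dprod f (a + 1) n * f a := by
  rw [add_comm n 1, dprod_add]; simp [dprod]

theorem mul_dprod_succ {f : ℕ → 𝔸} {a n : ℕ} (h : f (a + n) * f (a + n) = f (a + n)) :
    f (a + n) * dprod f a (n + 1) = dprod f a (n + 1) := by
  rw [dprod, ← mul_assoc, h]

/-- Products of a Lipschitz family of projections along an increasing sequence of points. -/
theorem norm_dprod_le {R : ℝ → 𝔸} {C : ℝ}
    (hRR : ∀ s ∈ Icc (0 : ℝ) 1, R s * R s = R s) (hb : ∀ s ∈ Icc (0 : ℝ) 1, ‖R s‖ ≤ C)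
    (hlip : ∀ s ∈ Icc (0 : ℝ) 1, ∀ t ∈ Icc (0 : ℝ) 1, ‖R s - R t‖ ≤ C * |s - t|)
    {x : ℕ → ℝ} (hx : Monotone x) (a n : ℕ) (hI : ∀ k ≤ a + n, x k ∈ Icc (0 : ℝ) 1) :
    ‖dprod (fun k => R (x k)) a (n + 1)‖ ≤ C * Real.exp (C * (x (a + n) - x a)) := by
  induction n with
  | zero => simpa [dprod] using hb _ (hI _ le_rfl)
  | succ n ih =>
    have ih := ih fun k hk => hI k (by omega)
    have hs := hI (a + n) (by omega)
    -- The leftmost projection leaves the product unchanged, so a new factor costs only `1 + C ·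
    -- step ≤ exp (C · step)`. This keeps long products bounded even if the projections have norm
    -- larger than one.
    have e : dprod (fun k => R (x k)) a (n + 1 + 1) = (R (x (a + (n + 1))) - R (x (a + n))) *
        dprod (fun k => R (x k)) a (n + 1) + dprod (fun k => R (x k)) a (n + 1) := by
      conv_rhs => rw [sub_mul, mul_dprod_succ (f := fun k => R (x k)) (hRR _ hs)]
      rw [sub_add_cancel]; rfl
    have hmono : x (a + n) ≤ x (a + (n + 1)) := hx (by omega)
    have h1 := hlip _ (hI (a + (n + 1)) le_rfl) _ hs
    rw [abs_of_nonneg (by linarith)] at h1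
    have h2 : C * (x (a + (n + 1)) - x (a + n)) + 1 ≤
        Real.exp (C * (x (a + (n + 1)) - x (a + n))) := Real.add_one_le_exp _
    rw [e]
    calc _ ≤ ‖R (x (a + (n + 1))) - R (x (a + n))‖ * ‖dprod (fun k => R (x k)) a (n + 1)‖ +
          ‖dprod (fun k => R (x k)) a (n + 1)‖ :=
          (norm_add_le _ _).trans (by gcongr; exact norm_mul_le _ _)
      _ = (‖R (x (a + (n + 1))) - R (x (a + n))‖ + 1) *
          ‖dprod (fun k => R (x k)) a (n + 1)‖ := by ring
      _ ≤ Real.exp (C * (x (a + (n + 1)) - x (a + n))) *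
          (C * Real.exp (C * (x (a + n) - x a))) := by
          gcongr
          linarith
      _ = C * (Real.exp (C * (x (a + (n + 1)) - x (a + n))) *
            Real.exp (C * (x (a + n) - x a))) := by ring
      _ = _ := by rw [← Real.exp_add]; ring_nf

/-- Inserting intermediate points into a product of projections is a second order change. -/
theorem norm_dprod_sub_le {R : ℝ → 𝔸} {C : ℝ} (hC : 0 ≤ C)
    (hRR : ∀ s ∈ Icc (0 : ℝ) 1, R s * R s = R s) (hb : ∀ s ∈ Icc (0 : ℝ) 1, ‖R s‖ ≤ C)
    (hlip : ∀ s ∈ Icc (0 : ℝ) 1, ∀ t ∈ Icc (0 : ℝ) 1, ‖R s - R t‖ ≤ C * |s - t|)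
    {x : ℕ → ℝ} (hx : Monotone x) (a n : ℕ) (hI : ∀ k ≤ a + n, x k ∈ Icc (0 : ℝ) 1) :
    ‖dprod (fun k => R (x k)) a (n + 1) - R (x (a + n)) * R (x a)‖ ≤
      C ^ 3 * (x (a + n) - x a) ^ 2 * Real.exp (C * (x (a + n) - x a)) := by
  induction n with
  | zero => simp [dprod, hRR _ (hI a le_rfl)]
  | succ n ih =>
    have ih := ih fun k hk => hI k (by omega)
    have hs := hI (a + n) (by omega)
    have ha := hI a (by omega)
    have ht := hI (a + (n + 1)) le_rfl
    set E := dprod (fun k => R (x k)) a (n + 1) - R (x (a + n)) * R (x a) with hE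
    have hRE : R (x (a + n)) * E = E := by
      rw [hE, mul_sub, mul_dprod_succ (f := fun k => R (x k)) (hRR _ hs), ← mul_assoc, hRR _ hs]
    -- Writing `q, r, p` for the projections at the new, the last and the initial point, the old
    -- error is multiplied by `1 + (q - r)` and the new error is `(q - r)(r - p)p`, a product of two
    -- increments because `p` and `r` are idempotent.
    have e : dprod (fun k => R (x k)) a (n + 1 + 1) - R (x (a + (n + 1))) * R (x a) =
        ((R (x (a + (n + 1))) - R (x (a + n))) * E + E) +
        (R (x (a + (n + 1))) - R (x (a + n))) * (R (x (a + n)) - R (x a)) * R (x a) := by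
      have e1 : dprod (fun k => R (x k)) a (n + 1 + 1) = R (x (a + (n + 1))) * E +
          R (x (a + (n + 1))) * (R (x (a + n)) * R (x a)) := by
        rw [← mul_add, hE, sub_add_cancel]; rfl
      have h2 := hRR _ hs
      have h3 := hRR _ ha
      rw [e1, sub_mul, hRE]
      set r := R (x (a + n))
      set q := R (x (a + (n + 1)))
      set p := R (x a)
      have e2 : (q - r) * (r - p) * p = q * (r * p) - q * (p * p) - (r * r) * p + r * (p * p) := by
        noncomm_ring
      rw [e2, h2, h3]
      noncomm_ring
    have hδ0 : 0 ≤ x (a + (n + 1)) - x (a + n) := sub_nonneg.2 (hx (by omega))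
    have hd0 : 0 ≤ x (a + n) - x a := sub_nonneg.2 (hx (by omega))
    have h1 := hlip _ ht _ hs
    rw [abs_of_nonneg hδ0] at h1
    have h1' := hlip _ hs _ ha
    rw [abs_of_nonneg hd0] at h1'
    have hx' : x (a + (n + 1)) - x a = (x (a + n) - x a) + (x (a + (n + 1)) - x (a + n)) := by ring
    rw [e, hx']
    generalize x (a + (n + 1)) - x (a + n) = δ at *
    generalize x (a + n) - x a = d at *
    have h2 : C * δ + 1 ≤ Real.exp (C * δ) := Real.add_one_le_exp _
    have h3 : 1 ≤ Real.exp (C * (d + δ)) := Real.one_le_exp (by positivity)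
    calc _ ≤ (‖R (x (a + (n + 1))) - R (x (a + n))‖ * ‖E‖ + ‖E‖) +
          ‖R (x (a + (n + 1))) - R (x (a + n))‖ * ‖R (x (a + n)) - R (x a)‖ * ‖R (x a)‖ := by
          refine (norm_add_le _ _).trans (add_le_add ((norm_add_le _ _).trans ?_) ?_)
          · gcongr; exact norm_mul_le _ _
          · exact norm_mul₃_le
      _ = (‖R (x (a + (n + 1))) - R (x (a + n))‖ + 1) * ‖E‖ +
          ‖R (x (a + (n + 1))) - R (x (a + n))‖ * ‖R (x (a + n)) - R (x a)‖ * ‖R (x a)‖ := by ring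
      _ ≤ Real.exp (C * δ) * (C ^ 3 * d ^ 2 * Real.exp (C * d)) + C * δ * (C * d) * C * 1 := by
          rw [mul_one]
          gcongr
          · linarith
          · exact hb _ ha
      _ ≤ C ^ 3 * d ^ 2 * (Real.exp (C * d) * Real.exp (C * δ)) +
          C ^ 3 * (d * δ) * Real.exp (C * (d + δ)) := by
          refine add_le_add (le_of_eq (by ring)) ?_
          calc _ = C ^ 3 * (d * δ) * 1 := by ring
            _ ≤ _ := by gcongr
      _ = C ^ 3 * (d ^ 2 + d * δ) * Real.exp (C * (d + δ)) := by
          rw [← Real.exp_add]; ring_nf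
      _ ≤ _ := by
          gcongr
          nlinarith [mul_nonneg hd0 hδ0, sq_nonneg δ]

theorem monotone_grid (T : ℕ) : Monotone fun k : ℕ => (k : ℝ) / T := fun a b h => by
  have : (a : ℝ) ≤ b := by exact_mod_cast h
  dsimp only
  gcongr

/-- The product `R 1 ⋯ R (1 / T) R 0` over the grid. -/
def gridProd (R : ℝ → 𝔸) (T : ℕ) : 𝔸 := dprod (fun k => R (k / T)) 0 (T + 1)

/-- Hybrid products, coarse up to `j / T` and fine beyond, interpolate between the two grids.
Passing from one hybrid to the next refines a single cell, which costs `O(1 / T²)`, uniformly in the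
number `q` of subdivisions. -/
theorem norm_gridProd_sub_le {R : ℝ → 𝔸} {C : ℝ} (hC : 0 ≤ C)
    (hRR : ∀ s ∈ Icc (0 : ℝ) 1, R s * R s = R s) (hb : ∀ s ∈ Icc (0 : ℝ) 1, ‖R s‖ ≤ C)
    (hlip : ∀ s ∈ Icc (0 : ℝ) 1, ∀ t ∈ Icc (0 : ℝ) 1, ‖R s - R t‖ ≤ C * |s - t|) :
    ∃ D, ∀ T q : ℕ, 0 < T → 0 < q →
      ‖gridProd R T - gridProd R (T * q)‖ ≤ D * (1 / T) := by
  set B := max ‖(1 : 𝔸)‖ (C * Real.exp C) with hB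
  have hB0 : 0 ≤ B := le_max_of_le_left (norm_nonneg _)
  have hprod : ∀ N a n : ℕ, a + n ≤ N + 1 → ‖dprod (fun k => R ((k : ℝ) / N)) a n‖ ≤ B := by
    intro N a n han
    rcases n with _ | n
    · exact le_max_left _ _
    · refine (norm_dprod_le hRR hb hlip (monotone_grid N) a n fun k hk =>
        grid_mem (by omega)).trans (le_max_of_le_right ?_)
      have h1 := (grid_mem (T := N) (k := a + n) (by omega)).2
      have h2 := (grid_mem (T := N) (k := a) (by omega)).1
      gcongr
      nlinarith
  refine ⟨B * (C ^ 3 * Real.exp C) * B, fun T q hT hq => ?_⟩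
  have hT' : (0 : ℝ) < T := by exact_mod_cast hT
  have hq' : (0 : ℝ) < q := by exact_mod_cast hq
  set f : ℕ → 𝔸 := fun k => R ((k : ℝ) / (T * q : ℕ)) with hf
  set c : ℕ → 𝔸 := fun k => R ((k : ℝ) / T) with hc
  have hfc : ∀ j, f (j * q) = c j := fun j => by
    simp only [hf, hc]; congr 1; push_cast; field_simp
  -- The fine product starts at `j * q + 1` because the fine point `j * q` is the coarse point `j`,
  -- already the last factor on the right.
  set H : ℕ → 𝔸 := fun j => dprod f (j * q + 1) ((T - j) * q) * dprod c 0 (j + 1) with hH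
  have h0 : H 0 = gridProd R (T * q) := by
    have := hfc 0
    simp only [zero_mul] at this
    simp only [hH, gridProd, Nat.sub_zero, zero_mul, zero_add]
    rw [← hf, dprod_succ' f, this, dprod_succ' c]
    simp only [dprod, zero_add, one_mul]
  have hTT : H T = gridProd R T := by
    simp [hH, gridProd, dprod, hc]
  have hstep : ∀ j < T, ‖H (j + 1) - H j‖ ≤ B * (C ^ 3 * (1 / T) ^ 2 * Real.exp C) * B := by
    intro j hj
    have e1 : (T - j) * q = q + (T - (j + 1)) * q := by
      rw [show T - j = (T - (j + 1)) + 1 by omega]; ring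
    have hcj : c j * dprod c 0 (j + 1) = dprod c 0 (j + 1) := by
      have := mul_dprod_succ (f := c) (a := 0) (n := j)
      simp only [zero_add] at this
      exact this (hRR _ (grid_mem hj.le))
    have hd : dprod f (j * q + 1) q * c j = dprod f (j * q) (q + 1) := by
      rw [dprod_succ', hfc]
    have e2 : H (j + 1) - H j = dprod f ((j + 1) * q + 1) ((T - (j + 1)) * q) *
        -(dprod f (j * q) (q + 1) - f (j * q + q) * f (j * q)) * dprod c 0 (j + 1) := by
      simp only [hH]
      have e3 : dprod c 0 (j + 1 + 1) = c (j + 1) * dprod c 0 (j + 1) := by rw [dprod, zero_add]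
      rw [e1, dprod_add f, show j * q + 1 + q = (j + 1) * q + 1 by ring, e3,
        show j * q + q = (j + 1) * q by ring, hfc, hfc, ← hd]
      conv_lhs => rw [← hcj]
      noncomm_ring
    have hcell := norm_dprod_sub_le hC hRR hb hlip (monotone_grid (T * q)) (j * q) q
      fun k hk => grid_mem (hk.trans (by nlinarith))
    have e3 : ((j * q + q : ℕ) : ℝ) / (T * q : ℕ) - ((j * q : ℕ) : ℝ) / (T * q : ℕ) = 1 / T := by
      push_cast; field_simp; ring
    simp only [e3] at hcell
    rw [e2]
    refine norm_mul₃_le.trans ?_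
    rw [norm_neg]
    gcongr
    · refine hprod _ _ _ ?_
      have : (j + 1) * q + (T - (j + 1)) * q = T * q := by
        rw [← add_mul]; congr 1; omega
      omega
    · refine hcell.trans ?_
      gcongr
      have : (1 : ℝ) ≤ T := by exact_mod_cast hT
      calc C * (1 / T) ≤ C * 1 := by gcongr; exact div_le_one_of_le₀ this hT'.le
        _ = C := mul_one C
    · exact hprod _ _ _ (by omega)
  have : gridProd R T - gridProd R (T * q) = ∑ j ∈ Finset.range T, (H (j + 1) - H j) := by
    rw [Finset.sum_range_sub, h0, hTT]
  rw [this]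
  refine (norm_sum_le_card_mul hstep).trans (le_of_eq ?_)
  field_simp

/-- Any two grids have a common refinement, with the product of their sizes as its size. Comparing
both products with the one on the refinement shows that the sequence is Cauchy. -/
theorem exists_tendsto_gridProd [CompleteSpace 𝔸] {R : ℝ → 𝔸}
    (hRR : ∀ s ∈ Icc (0 : ℝ) 1, R s * R s = R s) (hR : TwiceLip R) :
    ∃ W, Tendsto (gridProd R) atTop (𝓝 W) := by
  obtain ⟨C, hC, hb, hlip, -⟩ := hR.exists_bound
  obtain ⟨D, hD⟩ := norm_gridProd_sub_le hC.le hRR hb hlip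
  apply cauchySeq_tendsto_of_complete
  rw [Metric.cauchySeq_iff']
  intro ε hε
  obtain ⟨N, hN⟩ := exists_nat_gt (2 * D / ε)
  have hbd : ∀ T ≥ N + 1, D * (1 / T) < ε / 2 := by
    intro T hT
    have hT' : (N : ℝ) + 1 ≤ T := by exact_mod_cast hT
    have hN0 : (0 : ℝ) ≤ N := by positivity
    have hT0 : (0 : ℝ) < T := by linarith
    rw [div_lt_iff₀ hε] at hN
    rw [mul_one_div, div_lt_iff₀ hT0]
    nlinarith
  refine ⟨N + 1, fun T hT => ?_⟩
  have h1 := hD T (N + 1) (by omega) (by omega)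
  have h2 := hD (N + 1) T (by omega) (by omega)
  rw [mul_comm (N + 1) T] at h2
  calc dist (gridProd R T) (gridProd R (N + 1))
      ≤ dist (gridProd R T) (gridProd R (T * (N + 1))) +
        dist (gridProd R (T * (N + 1))) (gridProd R (N + 1)) := dist_triangle _ _ _
    _ = ‖gridProd R T - gridProd R (T * (N + 1))‖ +
        ‖gridProd R (N + 1) - gridProd R (T * (N + 1))‖ := by
        rw [dist_eq_norm, dist_comm, dist_eq_norm]
    _ < ε := by
        have := hbd T hT
        have := hbd (N + 1) le_rfl
        linarith

/-- The adiabatic theorem for an isolated eigenvalue: the component of the evolution in the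
eigenspace converges to parallel transport. -/
theorem exists_tendsto_evol [CompleteSpace 𝔸] (h : RedRes M R G) (hM : TwiceLip M) {B : ℝ}
    (hZ : ∀ T k, k ≤ T → ‖evol M T k‖ ≤ B) :
    ∃ W, Tendsto (fun T => R 1 * evol M T T) atTop (𝓝 W) ∧ R 1 * W = W ∧ W * R 0 = W := by
  have h1I : (1 : ℝ) ∈ Icc (0 : ℝ) 1 := by simp
  have h0I : (0 : ℝ) ∈ Icc (0 : ℝ) 1 := by simp
  obtain ⟨W, hW⟩ := exists_tendsto_gridProd h.RR (h.twiceLipR hM)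
  obtain ⟨C, hC, hb, hlip, hsnd⟩ := (h.twiceLipR hM).exists_bound
  obtain ⟨A, hA, hbG, hlipG, -⟩ := (h.twiceLipG hM).exists_bound
  -- `P T k` is the product of the projections from `1` down to `k / T`. The quantities `P T k *
  -- evol M T k` lead from the grid product at `k = 0` to `R 1 * evol M T T` at `k = T`, and their
  -- differences are `P T (k + 1) (1 - R) evol`.
  set P : ℕ → ℕ → 𝔸 := fun T k => dprod (fun k => R ((k : ℝ) / T)) k (T + 1 - k) with hP
  set b := C * Real.exp C with hbdef
  have hb0 : 0 ≤ b := by positivity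
  have hPb : ∀ T k, k ≤ T → ‖P T k‖ ≤ b := by
    intro T k hk
    have e : T + 1 - k = (T - k) + 1 := by omega
    simp only [hP, e]
    refine (norm_dprod_le h.RR hb hlip (monotone_grid T) k (T - k) fun j hj =>
        grid_mem (by omega)).trans ?_
    have h1 := (grid_mem (T := T) (k := k + (T - k)) (by omega)).2
    have h2 := (grid_mem (T := T) (k := k) (by omega)).1
    rw [hbdef]
    gcongr
    nlinarith
  have hPstep : ∀ T k, k < T → P T k = P T (k + 1) * R (k / T) := by
    intro T k hk
    simp only [hP]
    rw [show T + 1 - k = (T + 1 - (k + 1)) + 1 by omega, dprod_succ']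
  have hPR : ∀ T k, k ≤ T → P T k * R (k / T) = P T k := by
    intro T k hk
    simp only [hP]
    rw [show T + 1 - k = (T - k) + 1 by omega, dprod_succ', mul_assoc, h.RR _ (grid_mem hk)]
  have hPM : ∀ T k, k ≤ T → P T k * M (k / T) = P T k := by
    intro T k hk
    rw [← hPR T k hk, mul_assoc, h.RM _ (grid_mem hk)]
  -- `R G = 0` at equal parameters, so only an increment of `R` survives; this makes the weights in
  -- the summation by parts small.
  have hΓ : ∀ T k, k < T → P T (k + 1) * G (k / T) =
      P T (k + 1) * (R ((k + 1 : ℕ) / T) - R (k / T)) * G (k / T) := by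
    intro T k hk
    rw [mul_sub, hPR T (k + 1) hk, sub_mul, mul_assoc _ (R _), h.RG _ (grid_mem hk.le)]
    simp
  obtain ⟨D, hD⟩ := norm_sum_one_sub_le hM hZ
    (b * C * A + (b * C * C * A + b * (C * A + C * A))) (by positivity)
  have hdiff : Tendsto (fun T => R 1 * evol M T T - gridProd R T) atTop (𝓝 0) := by
    refine tendsto_zero_of_norm_le_div (D := D) fun T hT => ?_
    have hT' : (T : ℝ) ≠ 0 := by positivity
    have hstep : ∀ k < T, ‖R ((k + 1 : ℕ) / T) - R (k / T)‖ ≤ C * (1 / T) := fun k hk => by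
      have h1 := hlip _ (grid_mem (T := T) (k := k + 1) (by omega)) _ (grid_mem (T := T) hk.le)
      rwa [grid_step] at h1
    have hstepG : ∀ k < T, ‖G ((k + 1 : ℕ) / T) - G (k / T)‖ ≤ A * (1 / T) := fun k hk => by
      have h1 := hlipG _ (grid_mem (T := T) (k := k + 1) (by omega)) _ (grid_mem (T := T) hk.le)
      rwa [grid_step] at h1
    have := hD T (fun k => P T (k + 1) * G (k / T)) hT ?_ ?_
    · refine le_of_eq_of_le (congrArg _ ?_) this
      have e : R 1 * evol M T T - gridProd R T = P T T * evol M T T - P T 0 * evol M T 0 := by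
        simp [hP, gridProd, evol, dprod, hT']
      rw [e, ← Finset.sum_range_sub (fun k => P T k * evol M T k)]
      refine Finset.sum_congr rfl fun k hk => ?_
      rw [Finset.mem_range] at hk
      have : evol M T (k + 1) = M ((k + 1 : ℕ) / T) * evol M T k := rfl
      rw [this, ← mul_assoc, hPM T (k + 1) hk, hPstep T k hk]
      have := h.GM _ (grid_mem hk.le)
      calc _ = P T (k + 1) * ((1 - R (k / T)) * evol M T k) := by noncomm_ring
        _ = _ := by rw [← this]; noncomm_ring
    · intro k hk
      rw [hΓ T k hk]
      refine norm_mul₃_le.trans ?_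
      calc _ ≤ b * (C * (1 / T)) * A := by
            gcongr
            · exact hPb T _ hk
            · exact hstep k hk
            · exact hbG _ (grid_mem hk.le)
        _ ≤ _ := by
            have : 0 ≤ (b * C * C * A + b * (C * A + C * A)) * (1 / T : ℝ) := by positivity
            linarith [mul_comm (b * C * A) (1 / T : ℝ)]
    · intro k hk
      rw [hΓ T k (by omega), hΓ T (k + 1) hk]
      have hdP : P T (k + 1 + 1) - P T (k + 1) =
          P T (k + 1 + 1) * (R ((k + 2 : ℕ) / T) - R ((k + 1 : ℕ) / T)) := by
        rw [mul_sub, hPR T (k + 2) hk, hPstep T (k + 1) hk]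
      set p2 := P T (k + 1 + 1)
      have e : p2 * (R ((k + 1 + 1 : ℕ) / T) - R ((k + 1 : ℕ) / T)) * G ((k + 1 : ℕ) / T) -
          P T (k + 1) * (R ((k + 1 : ℕ) / T) - R (k / T)) * G (k / T) =
          (p2 - P T (k + 1)) * (R ((k + 1 : ℕ) / T) - R (k / T)) * G (k / T) +
          p2 * (((R ((k + 2 : ℕ) / T) - R ((k + 1 : ℕ) / T)) -
              (R ((k + 1 : ℕ) / T) - R (k / T))) * G (k / T)
            + (R ((k + 2 : ℕ) / T) - R ((k + 1 : ℕ) / T)) *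
              (G ((k + 1 : ℕ) / T) - G (k / T))) := by
        noncomm_ring
      rw [e, hdP]
      have hp2 : ‖p2‖ ≤ b := hPb T (k + 2) (by omega)
      have hG0 := hbG _ (grid_mem (T := T) (k := k) (by omega))
      have hR1 := hstep k (by omega)
      have hR2 := hstep (k + 1) (by omega)
      calc _ ≤ (b * (C * (1 / T))) * (C * (1 / T)) * A +
            b * ((C * (1 / T) ^ 2) * A + (C * (1 / T)) * (A * (1 / T))) := by
            refine (norm_add_le _ _).trans (add_le_add ?_ ?_)
            · refine norm_mul₃_le.trans ?_
              gcongr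
              refine (norm_mul_le _ _).trans ?_
              gcongr
            · refine (norm_mul_le _ _).trans ?_
              gcongr
              refine (norm_add_le _ _).trans (add_le_add ?_ ?_)
              · refine (norm_mul_le _ _).trans ?_
                gcongr
                exact hsnd T k hk
              · refine (norm_mul_le _ _).trans ?_
                gcongr
                exact hstepG k (by omega)
        _ = (b * C * C * A + b * (C * A + C * A)) * (1 / T) ^ 2 := by ring
        _ ≤ _ := by
            have : 0 ≤ (b * C * A) * (1 / T : ℝ) ^ 2 := by positivity
            linarith
  refine ⟨W, by simpa using hdiff.add hW, ?_, ?_⟩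
  · refine tendsto_nhds_unique (hW.const_mul (R 1)) (hW.congr' ?_)
    filter_upwards [eventually_gt_atTop 0] with T hT
    have hT' : (T : ℝ) ≠ 0 := by positivity
    have := mul_dprod_succ (f := fun k => R ((k : ℝ) / T)) (a := 0) (n := T)
    simp only [zero_add, div_self hT'] at this
    exact (this (h.RR _ h1I)).symm
  · refine tendsto_nhds_unique (hW.mul_const (R 0)) (hW.congr fun T => ?_)
    rw [gridProd, dprod_succ', Nat.cast_zero, zero_div, mul_assoc, h.RR _ h0I]

end Adiabatic

end RIS

end

noncomputable section

namespace RIS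

open Filter Asymptotics Set

/-! ### Eigenprojections and reduced resolvents from a spectral gap -/

section Gap

variable {𝔸 : Type*} [NormedRing 𝔸]

theorem mul_sum_pow (x p : 𝔸) (n : ℕ) :
    x * ∑ k ∈ Finset.range n, x ^ k * p = ∑ k ∈ Finset.range n, x ^ k * p - p + x ^ n * p := by
  induction n with
  | zero => simp
  | succ n ih =>
    rw [Finset.sum_range_succ, mul_add, ih, ← mul_assoc, ← pow_succ']
    abel

/-- For fixed `k` the last `k` parameters tend to `1`, and the evolution before them is bounded, so
these steps may be frozen at `M 1`. -/
theorem tendsto_evol_sub {M : ℝ → 𝔸} (hM : TwiceLip M) {B : ℝ}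
    (hZ : ∀ T k, k ≤ T → ‖evol M T k‖ ≤ B) (k : ℕ) :
    Tendsto (fun T => evol M T T - M 1 ^ k * evol M T (T - k)) atTop (𝓝 0) := by
  obtain ⟨A, hA, -, hlip, -⟩ := hM.exists_bound
  induction k with
  | zero => simp
  | succ k ih =>
    have h2 : Tendsto (fun T : ℕ => M 1 ^ k * ((M ((T - k : ℕ) / T) - M 1) *
        evol M T (T - (k + 1)))) atTop (𝓝 0) := by
      have hz : Tendsto (fun T : ℕ => (M ((T - k : ℕ) / T) - M 1) *
        evol M T (T - (k + 1))) atTop (𝓝 0) := by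
        refine squeeze_zero_norm' (a := fun T : ℕ => A * (k / T) * B) ?_ ?_
        · filter_upwards [eventually_gt_atTop k] with T hT
          refine (norm_mul_le _ _).trans ?_
          have h1 := hlip _ (grid_mem (T := T) (k := T - k) (by omega)) 1 (by simp)
          have h2 : |((T - k : ℕ) : ℝ) / T - 1| = k / T := by
            have : (T : ℝ) ≠ 0 := by exact_mod_cast (by omega : T ≠ 0)
            rw [Nat.cast_sub hT.le, abs_sub_comm,
              show (1 : ℝ) - ((T : ℝ) - k) / T = k / T by field_simp; ring, abs_of_nonneg]
            positivity
          rw [h2] at h1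
          gcongr
          exact hZ _ _ (by omega)
        · have := ((tendsto_const_div_atTop_nhds_zero_nat (k : ℝ)).const_mul A).mul_const B
          simpa using this
      simpa using hz.const_mul (M 1 ^ k)
    have := ih.add h2
    rw [add_zero] at this
    refine this.congr' ?_
    filter_upwards [eventually_gt_atTop k] with T hT
    obtain ⟨j, hj⟩ : ∃ j, T - k = j + 1 := ⟨T - k - 1, by omega⟩
    have e : T - (k + 1) = j := by omega
    rw [hj, e, evol, pow_succ]
    noncomm_ring

variable [NormedAlgebra ℂ 𝔸]

/-- The average of `x ^ k * p` over a period `n`. -/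
def periodMean (n : ℕ) (x p : 𝔸) : 𝔸 := (n : ℂ)⁻¹ • ∑ k ∈ Finset.range n, x ^ k * p

/-- On the peripheral part the Neumann series diverges. This weighted finite sum takes its place:
when `x ^ n * p = p` it inverts `1 - x` up to sign and a factor `n`, modulo the mean over a period.
-/
theorem one_sub_mul_sum_nat_pow {x p : 𝔸} (n : ℕ) :
    (1 - x) * ∑ k ∈ Finset.range n, (k : ℂ) • (x ^ k * p) =
      ∑ k ∈ Finset.range n, x ^ k * p - p + x ^ n * p - (n : ℂ) • (x ^ n * p) := by
  induction n with
  | zero => simp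
  | succ n ih =>
    rw [Finset.sum_range_succ, mul_add, ih, Finset.sum_range_succ]
    push_cast
    rw [sub_mul, one_mul, mul_smul_comm, ← mul_assoc x, ← pow_succ']
    module

theorem mul_periodMean {n : ℕ} {x p : 𝔸} (h : x ^ n * p = p) :
    x * periodMean n x p = periodMean n x p := by
  rw [periodMean, mul_smul_comm, mul_sum_pow, h, sub_add_cancel]

theorem commute_periodMean {n : ℕ} {x p y : 𝔸} (hx : Commute y x) (hp : Commute y p) :
    Commute y (periodMean n x p) :=
  .smul_right (.sum_right _ _ _ fun k _ => (hx.pow_right k).mul_right hp) _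

theorem pow_mul_periodMean {n : ℕ} {x p : 𝔸} (h : x ^ n * p = p) (k : ℕ) :
    x ^ k * periodMean n x p = periodMean n x p := by
  induction k with
  | zero => simp
  | succ k ih => rw [pow_succ, mul_assoc, mul_periodMean h, ih]

theorem proj_mul_periodMean {n : ℕ} {x p : 𝔸} (hpp : p * p = p) (hxp : Commute x p) :
    p * periodMean n x p = periodMean n x p := by
  rw [periodMean, mul_smul_comm, Finset.mul_sum]
  congr 1
  refine Finset.sum_congr rfl fun k _ => ?_
  rw [← mul_assoc, (hxp.symm.pow_right k).eq, mul_assoc, hpp]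

theorem periodMean_mul_self {n : ℕ} (hn : 0 < n) {x p : 𝔸} (hpp : p * p = p) (hxp : Commute x p)
    (h : x ^ n * p = p) : periodMean n x p * periodMean n x p = periodMean n x p := by
  conv_lhs => enter [1]; rw [periodMean]
  have : ∀ k ∈ Finset.range n, x ^ k * p * periodMean n x p = periodMean n x p := fun k _ => by
    rw [mul_assoc, proj_mul_periodMean hpp hxp, pow_mul_periodMean h]
  rw [smul_mul_assoc, Finset.sum_mul, Finset.sum_congr rfl this]
  have hn' : (n : ℂ) ≠ 0 := by exact_mod_cast hn.ne'
  simp only [Finset.sum_const, Finset.card_range, ← Nat.cast_smul_eq_nsmul ℂ]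
  rw [smul_smul, inv_mul_cancel₀ hn', one_smul]

theorem norm_periodMean_le {n : ℕ} {x p : 𝔸} {B : ℝ} (hxB : ∀ k, ‖x ^ k * p‖ ≤ B) :
    ‖periodMean n x p‖ ≤ B := by
  have hB : 0 ≤ B := (norm_nonneg _).trans (hxB 0)
  rw [periodMean, norm_smul]
  rcases Nat.eq_zero_or_pos n with rfl | hn
  · simpa using hB
  · calc _ ≤ ‖(n : ℂ)⁻¹‖ * (n * B) := by
          gcongr
          exact norm_sum_le_card_mul fun k _ => hxB k
      _ = B := by
          have : (n : ℝ) ≠ 0 := by exact_mod_cast hn.ne'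
          simp only [norm_inv, Complex.norm_natCast]
          field_simp

/-- The Neumann series `S` satisfies `(1 - x) S = 1 - p`, and the weighted mean `N` over a period
satisfies `(1 - x) N = R - p`, where `R` is the period mean. Hence `(1 - x)(S - N) = 1 - R`; the
factor `1 - R` in the witness only enforces `R g = g R = 0`. -/
theorem exists_reducedResolvent [CompleteSpace 𝔸] {n : ℕ} (hn : 0 < n) {x p : 𝔸}
    (hpp : p * p = p) (hxp : Commute x p) (h : x ^ n * p = p) {C ℓ B : ℝ} (hℓ : 0 ≤ ℓ)
    (hℓ' : ℓ < 1) (hC : ∀ k, ‖x ^ k * (1 - p)‖ ≤ C * ℓ ^ k) (hxB : ∀ k, ‖x ^ k * p‖ ≤ B) :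
    ∃ g, periodMean n x p * g = 0 ∧ g * periodMean n x p = 0 ∧
      (1 - x) * g = 1 - periodMean n x p ∧ g * (1 - x) = 1 - periodMean n x p ∧
      ‖g‖ ≤ (C * (1 - ℓ)⁻¹ + n * B) * (‖(1 : 𝔸)‖ + B) := by
  have hB : 0 ≤ B := (norm_nonneg _).trans (hxB 0)
  have hgeo : HasSum (fun k => C * ℓ ^ k) (C * (1 - ℓ)⁻¹) :=
    (hasSum_geometric_of_lt_one hℓ hℓ').mul_left C
  have hsum : Summable fun k => x ^ k * (1 - p) := .of_norm_bounded hgeo.summable hC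
  set S := ∑' k, x ^ k * (1 - p) with hS
  have hSn : ‖S‖ ≤ C * (1 - ℓ)⁻¹ := tsum_of_norm_bounded hgeo hC
  have hxS : (1 - x) * S = 1 - p := by
    have h1 : S = (1 - p) + x * S := by
      conv_lhs => rw [hS, hsum.tsum_eq_zero_add]
      rw [hS, ← hsum.tsum_mul_left]
      simp [pow_succ', mul_assoc]
    rw [sub_mul, one_mul, sub_eq_iff_eq_add]; exact h1
  have hcS : Commute x S := by
    have : Commute x (1 - p) := (Commute.one_right x).sub_right hxp
    rw [Commute, SemiconjBy, hS, ← hsum.tsum_mul_left, ← hsum.tsum_mul_right]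
    congr 1; ext k
    exact (((Commute.refl x).pow_right k).mul_right this)
  set N := (n : ℂ)⁻¹ • ∑ k ∈ Finset.range n, (k : ℂ) • (x ^ k * p) with hN
  have hn' : (n : ℂ) ≠ 0 := by exact_mod_cast hn.ne'
  have hNn : ‖N‖ ≤ n * B := by
    rw [hN, norm_smul]
    calc _ ≤ ‖(n : ℂ)⁻¹‖ * (n * (n * B)) := by
          gcongr
          refine norm_sum_le_card_mul fun k hk => ?_
          rw [norm_smul, Complex.norm_natCast]
          gcongr
          exact hxB k
      _ = _ := by
          have : (n : ℝ) ≠ 0 := by exact_mod_cast hn.ne'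
          simp only [norm_inv, Complex.norm_natCast]
          field_simp
  have hxN : (1 - x) * N = periodMean n x p - p := by
    rw [hN, mul_smul_comm, one_sub_mul_sum_nat_pow, h, sub_add_cancel, smul_sub, smul_smul,
      inv_mul_cancel₀ hn', one_smul, periodMean]
  have hcN : Commute x N :=
    .smul_right (.sum_right _ _ _ fun k _ =>
      (((Commute.refl x).pow_right k).mul_right hxp).smul_right _) _
  have hcR : Commute x (periodMean n x p) := commute_periodMean (Commute.refl x) hxp
  have hRx := mul_periodMean h
  have hRR := periodMean_mul_self hn hpp hxp h
  have hcpS : ∀ y, Commute y x → Commute y p → Commute y S := by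
    intro y hyx hyp
    have : Commute y (1 - p) := (Commute.one_right y).sub_right hyp
    rw [Commute, SemiconjBy, hS, ← hsum.tsum_mul_left, ← hsum.tsum_mul_right]
    congr 1; ext k
    exact ((hyx.pow_right k).mul_right this)
  have hcRS : Commute (periodMean n x p) (S - N) := by
    have hRp : Commute (periodMean n x p) p :=
      (commute_periodMean (n := n) hxp.symm (Commute.refl p)).symm
    refine (hcpS _ hcR.symm hRp).sub_right ?_
    exact .smul_right (.sum_right _ _ _ fun k _ =>
      ((hcR.symm.pow_right k).mul_right hRp).smul_right _) _
  have hG0 : (1 - x) * (S - N) = 1 - periodMean n x p := by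
    rw [mul_sub, hxS, hxN]; abel
  have hcG : Commute x (S - N) := hcS.sub_right hcN
  set R := periodMean n x p with hR
  have e1 : (1 - R) * (1 - R) = 1 - R := by
    have : (1 - R) * (1 - R) = 1 - R - R + R * R := by noncomm_ring
    rw [this, hRR]; abel
  refine ⟨(S - N) * (1 - R), ?_, ?_, ?_, ?_, ?_⟩
  · rw [← mul_assoc, hcRS.eq, mul_assoc, mul_sub, mul_one, hRR, sub_self, mul_zero]
  · rw [mul_assoc, sub_mul 1 R, one_mul, hRR, sub_self, mul_zero]
  · rw [← mul_assoc, hG0, e1]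
  · have hc1 : Commute (1 - R) (1 - x) :=
      (Commute.one_right _).sub_right ((Commute.one_right x).sub_right hcR).symm
    have hc2 : Commute (S - N) (1 - x) := ((Commute.one_left _).sub_left hcG).symm
    rw [mul_assoc, hc1.eq, ← mul_assoc, hc2.eq, hG0, e1]
  · refine (norm_mul_le _ _).trans ?_
    have hRn : ‖R‖ ≤ B := norm_periodMean_le hxB
    gcongr
    · exact le_trans (norm_nonneg _) ((norm_sub_le S N).trans (add_le_add hSn hNn))
    · exact (norm_sub_le _ _).trans (add_le_add hSn hNn)
    · exact (norm_sub_le _ _).trans (by gcongr)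

/-- The peripheral projection is the sum of the eigenprojections for the `n`-th roots of unity. -/
theorem sum_periodMean {n : ℕ} (hn : 0 < n) {ζ : ℂ} (hζ : IsPrimitiveRoot ζ n) (x p : 𝔸) :
    ∑ j ∈ Finset.range n, periodMean n ((ζ ^ j)⁻¹ • x) p = p := by
  have hn' : (n : ℂ) ≠ 0 := by exact_mod_cast hn.ne'
  have hζ0 : ζ ≠ 0 := hζ.ne_zero hn.ne'
  simp only [periodMean, smul_pow, smul_mul_assoc, ← Finset.smul_sum]
  rw [Finset.sum_comm]
  -- Orthogonality of characters: the geometric sum over `j` vanishes unless `k = 0`.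
  have : ∀ k ∈ Finset.range n, ∑ j ∈ Finset.range n, ((ζ ^ j)⁻¹ ^ k) • (x ^ k * p) =
      if k = 0 then (n : ℂ) • p else 0 := by
    intro k hk
    rw [← Finset.sum_smul]
    split_ifs with h0
    · subst h0; simp
    · have hk' := Finset.mem_range.1 hk
      have e : ∀ j, (ζ ^ j)⁻¹ ^ k = ((ζ ^ k)⁻¹) ^ j := fun j => by
        rw [inv_pow, inv_pow, ← pow_mul, ← pow_mul, mul_comm]
      simp only [e]
      have hne : (ζ ^ k)⁻¹ ≠ 1 := by
        rw [ne_eq, inv_eq_one]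
        exact hζ.pow_ne_one_of_pos_of_lt h0 hk'
      rw [geom_sum_eq hne, inv_pow, ← pow_mul, mul_comm k n, pow_mul, hζ.pow_eq_one]
      simp
  rw [Finset.sum_congr rfl this, Finset.sum_ite_eq' , if_pos (Finset.mem_range.2 hn), smul_smul,
    inv_mul_cancel₀ hn', one_smul]

/-- A spectral gap, uniform in `s`, gives a family of reduced resolvents at every peripheral
eigenvalue. -/
theorem exists_redRes [CompleteSpace 𝔸] {n : ℕ} (hn : 0 < n) {M P : ℝ → 𝔸}
    (hPP : ∀ s ∈ Icc (0 : ℝ) 1, P s * P s = P s) (hMP : ∀ s ∈ Icc (0 : ℝ) 1, Commute (M s) (P s))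
    (h : ∀ s ∈ Icc (0 : ℝ) 1, M s ^ n * P s = P s) {C ℓ B : ℝ} (hℓ : 0 ≤ ℓ) (hℓ' : ℓ < 1)
    (hC : ∀ s ∈ Icc (0 : ℝ) 1, ∀ k, ‖M s ^ k * (1 - P s)‖ ≤ C * ℓ ^ k)
    (hB : ∀ s ∈ Icc (0 : ℝ) 1, ∀ k, ‖M s ^ k * P s‖ ≤ B) {θ : ℂ} (hθ : θ ^ n = 1) :
    ∃ G, RedRes (fun s => θ⁻¹ • M s) (fun s => periodMean n (θ⁻¹ • M s) (P s)) G := by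
  have hθ1 : ‖θ⁻¹‖ = 1 := by
    rw [norm_inv, inv_eq_one]; exact Complex.norm_eq_one_of_pow_eq_one hθ hn.ne'
  have key : ∀ s ∈ Icc (0 : ℝ) 1, _ := fun s hs =>
    exists_reducedResolvent (x := θ⁻¹ • M s) (p := P s) hn (hPP s hs) ((hMP s hs).smul_left _)
      (by rw [smul_pow, inv_pow, hθ, inv_one, one_smul, h s hs]) hℓ hℓ'
      (fun k => by rw [smul_pow, smul_mul_assoc, norm_smul, norm_pow, hθ1, one_pow, one_mul]
                   exact hC s hs k)
      (fun k => by rw [smul_pow, smul_mul_assoc, norm_smul, norm_pow, hθ1, one_pow, one_mul]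
                   exact hB s hs k)
  choose! g h1 h2 h3 h4 h5 using key
  have hp : ∀ s ∈ Icc (0 : ℝ) 1, (θ⁻¹ • M s) ^ n * P s = P s := fun s hs => by
    rw [smul_pow, inv_pow, hθ, inv_one, one_smul, h s hs]
  refine ⟨g, ⟨fun s hs => ?_, fun s hs => mul_periodMean (hp s hs),
    fun s hs => periodMean_mul_self hn (hPP s hs) ((hMP s hs).smul_left _) (hp s hs),
    h1, h2, h3, h4, ?_, ?_⟩⟩
  · have : Commute (θ⁻¹ • M s) (periodMean n (θ⁻¹ • M s) (P s)) :=
      commute_periodMean (Commute.refl _) ((hMP s hs).smul_left _)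
    exact this.eq.symm.trans (mul_periodMean (hp s hs))
  · refine IsBigO.of_bound B (eventually_principal.2 fun s hs => ?_)
    simp only [norm_one, mul_one]
    refine norm_periodMean_le fun k => ?_
    rw [smul_pow, smul_mul_assoc, norm_smul, norm_pow, hθ1, one_pow, one_mul]
    exact hB s hs k
  · refine IsBigO.of_bound ((C * (1 - ℓ)⁻¹ + n * B) * (‖(1 : 𝔸)‖ + B))
      (eventually_principal.2 fun s hs => ?_)
    simp only [norm_one, mul_one]
    exact h5 s hs

theorem evol_smul (M : ℝ → 𝔸) (c : ℂ) (T k : ℕ) :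
    evol (fun s => c • M s) T k = c ^ k • evol M T k := by
  induction k with
  | zero => simp [evol]
  | succ k ih => rw [evol, ih, evol, smul_mul_smul_comm, pow_succ']

theorem TwiceLip.smul {M : ℝ → 𝔸} (hM : TwiceLip M) (c : ℂ) : TwiceLip fun s => c • M s := by
  have := (TwiceLip.const (c • (1 : 𝔸))).mul hM
  simpa using this

/-- The adiabatic theorem: the evolution approaches a periodic one, which starts from the
parallel transport of the peripheral part of the initial condition. -/
theorem exists_adiabatic_limit [CompleteSpace 𝔸] {n : ℕ} (hn : 0 < n) {M P : ℝ → 𝔸}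
    (hM : TwiceLip M)
    (hPP : ∀ s ∈ Icc (0 : ℝ) 1, P s * P s = P s) (hMP : ∀ s ∈ Icc (0 : ℝ) 1, Commute (M s) (P s))
    (h : ∀ s ∈ Icc (0 : ℝ) 1, M s ^ n * P s = P s) {C ℓ B B' : ℝ} (hℓ : 0 ≤ ℓ) (hℓ' : ℓ < 1)
    (hC : ∀ s ∈ Icc (0 : ℝ) 1, ∀ k, ‖M s ^ k * (1 - P s)‖ ≤ C * ℓ ^ k)
    (hB : ∀ s ∈ Icc (0 : ℝ) 1, ∀ k, ‖M s ^ k * P s‖ ≤ B)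
    (hZ : ∀ T k, k ≤ T → ‖evol M T k‖ ≤ B') :
    ∃ W, M 1 ^ n * W = W ∧ Tendsto (fun T => evol M T T - M 1 ^ T * W) atTop (𝓝 0) ∧
      ∀ a, M 0 * a = a → M 1 * (W * a) = W * a := by
  have h1I : (1 : ℝ) ∈ Icc (0 : ℝ) 1 := by simp
  have h0I : (0 : ℝ) ∈ Icc (0 : ℝ) 1 := by simp
  set ζ : ℂ := Complex.exp (2 * Real.pi * Complex.I / n) with hζdef
  have hζ : IsPrimitiveRoot ζ n := Complex.isPrimitiveRoot_exp n hn.ne'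
  have hζ0 : ζ ≠ 0 := hζ.ne_zero hn.ne'
  have hθ : ∀ j : ℕ, (ζ ^ j) ^ n = 1 := fun j => by
    rw [← pow_mul, mul_comm, pow_mul, hζ.pow_eq_one, one_pow]
  have hn1 : ∀ j : ℕ, ‖(ζ ^ j)⁻¹‖ = 1 := fun j => by
    rw [norm_inv, inv_eq_one]; exact Complex.norm_eq_one_of_pow_eq_one (hθ j) hn.ne'
  -- Rescaling by `(ζ ^ j)⁻¹` moves the eigenvalue `ζ ^ j` to `1`, where the theorem for a single
  -- eigenvalue applies. The resulting `W j` may well be zero if `ζ ^ j` is not in the spectrum.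
  have key : ∀ j : ℕ, ∃ W, Tendsto (fun T => periodMean n ((ζ ^ j)⁻¹ • M 1) (P 1) *
      ((ζ ^ j)⁻¹ ^ T • evol M T T)) atTop (𝓝 W) ∧ M 1 * W = ζ ^ j • W ∧
      W * periodMean n ((ζ ^ j)⁻¹ • M 0) (P 0) = W := by
    intro j
    obtain ⟨G, hG⟩ := exists_redRes hn hPP hMP h hℓ hℓ' hC hB (hθ j)
    obtain ⟨W, hW, h1, h2⟩ := exists_tendsto_evol hG (hM.smul _) (B := B') fun T k hk => by
      rw [evol_smul, norm_smul, norm_pow, hn1, one_pow, one_mul]; exact hZ T k hk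
    simp only [evol_smul] at hW
    refine ⟨W, hW, ?_, h2⟩
    have := hG.MR 1 h1I
    have h3 : ((ζ ^ j)⁻¹ • M 1) * W = W := by rw [← h1, ← mul_assoc, this]
    rw [smul_mul_assoc] at h3
    rw [← h3, smul_smul, mul_inv_cancel₀ (pow_ne_zero j hζ0), one_smul, h3]
  choose W hW hMW hWR using key
  have hpow : ∀ j k : ℕ, M 1 ^ k * W j = (ζ ^ j) ^ k • W j := by
    intro j k
    induction k with
    | zero => simp
    | succ k ih => rw [pow_succ', mul_assoc, ih, mul_smul_comm, hMW, smul_smul, pow_succ]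
  refine ⟨∑ j ∈ Finset.range n, W j, ?_, ?_, ?_⟩
  · rw [Finset.mul_sum]
    exact Finset.sum_congr rfl fun j _ => by rw [hpow, hθ, one_smul]
  -- The last `k` steps, frozen at `M 1`, contract the non-peripheral part by `ℓ ^ k`. Here `k` is
  -- fixed according to `ε` before `T` tends to infinity.
  · have h1 : Tendsto (fun T => (1 - P 1) * evol M T T) atTop (𝓝 0) := by
      rw [Metric.tendsto_nhds]
      intro ε hε
      have hk : Tendsto (fun k : ℕ => C * ℓ ^ k * B') atTop (𝓝 0) := by
        simpa using ((tendsto_pow_atTop_nhds_zero_of_lt_one hℓ hℓ').const_mul C).mul_const B'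
      obtain ⟨k, hk⟩ := ((tendsto_order.1 hk).2 (ε / 2) (by positivity)).exists
      have h2 := (tendsto_evol_sub hM hZ k).const_mul (1 - P 1)
      rw [mul_zero] at h2
      filter_upwards [(Metric.tendsto_nhds.1 h2) (ε / 2) (by positivity)] with T hT
      rw [dist_zero_right] at hT ⊢
      have hc : Commute (1 - P 1) (M 1 ^ k) :=
        (((Commute.one_right (M 1)).sub_right (hMP 1 h1I)).pow_left k).symm
      have e : (1 - P 1) * evol M T T = (1 - P 1) * (evol M T T - M 1 ^ k * evol M T (T - k)) +
          (M 1 ^ k * (1 - P 1)) * evol M T (T - k) := by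
        rw [← hc.eq]; noncomm_ring
      rw [e]
      have hb : ‖(M 1 ^ k * (1 - P 1)) * evol M T (T - k)‖ ≤ C * ℓ ^ k * B' := by
        have hCk := hC 1 h1I k
        exact (norm_mul_le _ _).trans (mul_le_mul hCk (hZ _ _ (by omega)) (norm_nonneg _)
          ((norm_nonneg _).trans hCk))
      linarith [norm_add_le ((1 - P 1) * (evol M T T - M 1 ^ k * evol M T (T - k)))
        ((M 1 ^ k * (1 - P 1)) * evol M T (T - k))]
    have h2 : ∀ j ∈ Finset.range n, Tendsto (fun T => (ζ ^ j) ^ T •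
        (periodMean n ((ζ ^ j)⁻¹ • M 1) (P 1) * ((ζ ^ j)⁻¹ ^ T • evol M T T) - W j))
        atTop (𝓝 0) := by
      intro j _
      have h3 := tendsto_zero_iff_norm_tendsto_zero.1 (tendsto_sub_nhds_zero_iff.2 (hW j))
      refine tendsto_zero_iff_norm_tendsto_zero.2 (h3.congr fun T => ?_)
      have : ‖ζ ^ j‖ = 1 := Complex.norm_eq_one_of_pow_eq_one (hθ j) hn.ne'
      rw [norm_smul, norm_pow, this, one_pow, one_mul]
    have h4 := (tendsto_finsetSum _ h2).add h1
    simp only [Finset.sum_const_zero, add_zero] at h4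
    refine h4.congr fun T => ?_
    have e : ∀ j, (ζ ^ j) ^ T •
        (periodMean n ((ζ ^ j)⁻¹ • M 1) (P 1) * ((ζ ^ j)⁻¹ ^ T • evol M T T) - W j) =
        periodMean n ((ζ ^ j)⁻¹ • M 1) (P 1) * evol M T T - M 1 ^ T * W j := by
      intro j
      rw [smul_sub, ← hpow, mul_smul_comm, smul_smul, inv_pow,
        mul_inv_cancel₀ (pow_ne_zero _ (pow_ne_zero j hζ0)), one_smul]
    simp only [e, Finset.sum_sub_distrib, ← Finset.sum_mul, ← Finset.mul_sum]
    rw [sum_periodMean hn hζ]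
    noncomm_ring
  · intro a ha
    have hpa : ∀ k, M 0 ^ k * a = a := fun k => by
      induction k with
      | zero => simp
      | succ k ih => rw [pow_succ, mul_assoc, ha, ih]
    -- The non-peripheral part of `a` is fixed by `M 0` and at the same time decays under its
    -- powers, so it is zero.
    have hPa : P 0 * a = a := by
      have hc : ∀ k, M 0 ^ k * (1 - P 0) * a = (1 - P 0) * a := fun k => by
        have hc : Commute (1 - P 0) (M 0 ^ k) :=
          (((Commute.one_right (M 0)).sub_right (hMP 0 h0I)).pow_left k).symm
        rw [← hc.eq, mul_assoc, hpa]
      have hz : Tendsto (fun k : ℕ => C * ℓ ^ k * ‖a‖) atTop (𝓝 0) := by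
        simpa using ((tendsto_pow_atTop_nhds_zero_of_lt_one hℓ hℓ').const_mul C).mul_const ‖a‖
      have : ‖(1 - P 0) * a‖ ≤ 0 := ge_of_tendsto' hz fun k => by
        rw [← hc k]
        exact (norm_mul_le _ _).trans (by gcongr; exact hC 0 h0I k)
      rw [norm_le_zero_iff, sub_mul, one_mul, sub_eq_zero] at this
      exact this.symm
    -- The eigenprojection at `ζ ^ j` acts on the fixed `a` as a full geometric sum of a nontrivial
    -- root of unity. Only `j = 0`, the eigenvalue `1`, survives.
    have hWa : ∀ j ∈ Finset.range n, j ≠ 0 → W j * a = 0 := by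
      intro j hj hj0
      have : periodMean n ((ζ ^ j)⁻¹ • M 0) (P 0) * a = 0 := by
        have e : ∀ k ∈ Finset.range n, (((ζ ^ j)⁻¹ • M 0) ^ k * P 0) * a = ((ζ ^ j)⁻¹) ^ k • a :=
          fun k _ => by rw [smul_pow, smul_mul_assoc, smul_mul_assoc, mul_assoc, hPa, hpa]
        rw [periodMean, smul_mul_assoc, Finset.sum_mul, Finset.sum_congr rfl e, ← Finset.sum_smul,
          geom_sum_eq, inv_pow, hθ]
        · simp
        · rw [ne_eq, inv_eq_one]
          exact hζ.pow_ne_one_of_pos_of_lt hj0 (Finset.mem_range.1 hj)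
      rw [← hWR, mul_assoc, this, mul_zero]
    have : (∑ j ∈ Finset.range n, W j) * a = W 0 * a := by
      rw [Finset.sum_mul]
      exact Finset.sum_eq_single 0 hWa fun h => absurd (Finset.mem_range.2 hn) h
    rw [this, ← mul_assoc, hMW]
    simp

end Gap

end RIS

end

noncomputable section

namespace RIS

open Filter Set Matrix

/-! ### Functional calculus of Hermitian matrices -/

section Cfc

variable {ι κ : Type*} [Fintype ι] [DecidableEq ι] [Fintype κ] [DecidableEq κ]

/-- Interpolation on the spectrum. The extra nodes `t` allow evaluation at the entries of an
explicit diagonalization without identifying them with spectral values. -/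
theorem exists_polynomial_cfc {A : Matrix ι ι ℂ} (hA : A.IsHermitian) (f : ℝ → ℝ) (t : Finset ℝ) :
    ∃ p : Polynomial ℝ, (∀ x ∈ t, p.eval x = f x) ∧ cfc f A = Polynomial.aeval A p := by
  set u := t ∪ A.finite_real_spectrum.toFinset with hu
  refine ⟨Lagrange.interpolate u id f, fun x hx => ?_, ?_⟩
  · exact Lagrange.eval_interpolate_at_node f (v := id) (Set.injOn_id _)
      (Finset.mem_union_left _ hx)
  · rw [← cfc_polynomial _ A hA.isSelfAdjoint]
    refine cfc_congr fun x hx => ?_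
    exact (Lagrange.eval_interpolate_at_node f (v := id) (Set.injOn_id _)
      (Finset.mem_union_right _ (by simpa using hx))).symm

/-- The algebra homomorphism `a ↦ W diag(a) W*` for a unitary `W`. -/
def conjDiag (W : Matrix ι ι ℂ) (h1 : W * Wᴴ = 1) (h2 : Wᴴ * W = 1) :
    (ι → ℝ) →ₐ[ℝ] Matrix ι ι ℂ where
  toFun a := W * diagonal (fun i => (a i : ℂ)) * Wᴴ
  map_one' := by simp [h1]
  map_mul' a b := by
    have : W * diagonal (fun i => (a i : ℂ)) * Wᴴ * (W * diagonal (fun i => (b i : ℂ)) * Wᴴ) =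
      W * (diagonal (fun i => (a i : ℂ)) * (Wᴴ * W) * diagonal (fun i => (b i : ℂ))) * Wᴴ := by
      simp only [Matrix.mul_assoc]
    rw [this, h2, Matrix.mul_one, diagonal_mul_diagonal]
    simp
  map_zero' := by simp
  map_add' a b := by
    have : diagonal (fun i => (((a + b) i : ℝ) : ℂ)) =
      diagonal (fun i => (a i : ℂ)) + diagonal (fun i => (b i : ℂ)) := by
      rw [diagonal_add]; simp
    rw [this, Matrix.mul_add, Matrix.add_mul]
  commutes' r := by
    have : diagonal (fun i : ι => (((algebraMap ℝ (ι → ℝ) r) i : ℝ) : ℂ)) =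
        (r : ℂ) • (1 : Matrix ι ι ℂ) := by
      rw [smul_one_eq_diagonal]; rfl
    rw [this, Matrix.mul_smul, Matrix.mul_one, Matrix.smul_mul, h1]
    rw [Algebra.algebraMap_eq_smul_one]
    rfl

theorem isHermitian_conj_diagonal (W : Matrix ι ι ℂ) (a : ι → ℝ) :
    (W * diagonal (fun i => (a i : ℂ)) * Wᴴ).IsHermitian := by
  rw [IsHermitian, conjTranspose_mul, conjTranspose_mul, conjTranspose_conjTranspose,
    diagonal_conjTranspose, Matrix.mul_assoc]
  congr 3
  ext i; simp

theorem cfc_conj_diagonal {W : Matrix ι ι ℂ} (h1 : W * Wᴴ = 1) (h2 : Wᴴ * W = 1) (a : ι → ℝ)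
    (f : ℝ → ℝ) : cfc f (W * diagonal (fun i => (a i : ℂ)) * Wᴴ) =
      W * diagonal (fun i => (f (a i) : ℂ)) * Wᴴ := by
  obtain ⟨p, hp, h⟩ := exists_polynomial_cfc (isHermitian_conj_diagonal W a) f
    (Finset.univ.image a)
  rw [h]
  have e := Polynomial.aeval_algHom_apply (conjDiag W h1 h2) a p
  have e2 : Polynomial.aeval a p = fun i => f (a i) := by
    ext i
    rw [← hp (a i) (by simp)]
    simp
  rw [e2] at e
  exact e

/-- A diagonalization of a Hermitian matrix, with its functional calculus. -/
theorem exists_diag {A : Matrix ι ι ℂ} (hA : A.IsHermitian) :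
    ∃ (W : Matrix ι ι ℂ) (a : ι → ℝ), W * Wᴴ = 1 ∧ Wᴴ * W = 1 ∧
      A = W * diagonal (fun i => (a i : ℂ)) * Wᴴ ∧
      (∀ f : ℝ → ℝ, cfc f A = W * diagonal (fun i => (f (a i) : ℂ)) * Wᴴ) ∧
      (A.PosSemidef → ∀ i, 0 ≤ a i) ∧ (A.PosDef → ∀ i, 0 < a i) ∧ A.trace = ∑ i, (a i : ℂ) := by
  have v1 : (hA.eigenvectorUnitary : Matrix ι ι ℂ) * (hA.eigenvectorUnitary : Matrix ι ι ℂ)ᴴ = 1 :=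
    Unitary.coe_mul_star_self hA.eigenvectorUnitary
  have v2 : (hA.eigenvectorUnitary : Matrix ι ι ℂ)ᴴ * (hA.eigenvectorUnitary : Matrix ι ι ℂ) = 1 :=
    Unitary.coe_star_mul_self hA.eigenvectorUnitary
  have hs : A = (hA.eigenvectorUnitary : Matrix ι ι ℂ) *
      diagonal (fun i => (hA.eigenvalues i : ℂ)) * (hA.eigenvectorUnitary : Matrix ι ι ℂ)ᴴ :=
    hA.spectral_theorem
  refine ⟨hA.eigenvectorUnitary, hA.eigenvalues, v1, v2, hs, fun f => ?_,
    fun h i => h.eigenvalues_nonneg i, fun h i => h.eigenvalues_pos i,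
    hA.trace_eq_sum_eigenvalues⟩
  conv_lhs => rw [hs, cfc_conj_diagonal v1 v2]

theorem cfc_unitary_conj {W A : Matrix ι ι ℂ} (h1 : W * Wᴴ = 1) (h2 : Wᴴ * W = 1)
    (hA : A.IsHermitian) (f : ℝ → ℝ) : cfc f (W * A * Wᴴ) = W * cfc f A * Wᴴ := by
  obtain ⟨V, a, v1, v2, hA', hf, -⟩ := exists_diag hA
  have w1 : (W * V) * (W * V)ᴴ = 1 := by
    rw [conjTranspose_mul, Matrix.mul_assoc, ← Matrix.mul_assoc V, v1, Matrix.one_mul, h1]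
  have w2 : (W * V)ᴴ * (W * V) = 1 := by
    rw [conjTranspose_mul, Matrix.mul_assoc, ← Matrix.mul_assoc Wᴴ, h2, Matrix.one_mul, v2]
  have e : W * A * Wᴴ = (W * V) * diagonal (fun i => (a i : ℂ)) * (W * V)ᴴ := by
    conv_lhs => rw [hA']
    simp only [conjTranspose_mul, Matrix.mul_assoc]
  rw [e, cfc_conj_diagonal w1 w2, hf]
  simp only [conjTranspose_mul, Matrix.mul_assoc]

theorem isHermitian_cfc {A : Matrix ι ι ℂ} (hA : A.IsHermitian) (f : ℝ → ℝ) :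
    (cfc f A).IsHermitian := by
  obtain ⟨W, a, h1, h2, -, hf, -⟩ := exists_diag hA
  rw [hf]; exact isHermitian_conj_diagonal _ _

theorem trace_conj_diag_mul (W V : Matrix ι ι ℂ) (x y : ι → ℝ) :
    (W * diagonal (fun i => (x i : ℂ)) * Wᴴ * (V * diagonal (fun i => (y i : ℂ)) * Vᴴ)).trace =
      ((∑ i, ∑ j, Complex.normSq ((Wᴴ * V) i j) * x i * y j : ℝ) : ℂ) := by
  have e : (W * diagonal (fun i => (x i : ℂ)) * Wᴴ * (V * diagonal (fun i => (y i : ℂ)) * Vᴴ)).trace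
      = (diagonal (fun i => (x i : ℂ)) * (Wᴴ * V) * (diagonal (fun i => (y i : ℂ)) *
        (Wᴴ * V)ᴴ)).trace := by
    rw [Matrix.mul_assoc, Matrix.mul_assoc, trace_mul_comm]
    simp only [conjTranspose_mul, conjTranspose_conjTranspose, Matrix.mul_assoc]
  rw [e, trace]
  push_cast
  refine Finset.sum_congr rfl fun i _ => ?_
  rw [diag_apply, mul_apply]
  refine Finset.sum_congr rfl fun j _ => ?_
  rw [diagonal_mul, diagonal_mul, conjTranspose_apply, Complex.normSq_eq_conj_mul_self]
  simp only [RCLike.star_def]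
  ring

/-- Joint spectral expansion of traces of functions of two Hermitian matrices. -/
theorem exists_weights {A B : Matrix ι ι ℂ} (hA : A.IsHermitian) (hB : B.IsHermitian) :
    ∃ (a b : ι → ℝ) (c : ι → ι → ℝ), (∀ i j, 0 ≤ c i j) ∧
      (∀ f g : ℝ → ℝ, (cfc f A * cfc g B).trace = ((∑ i, ∑ j, c i j * f (a i) * g (b j) : ℝ) : ℂ))
      ∧ (A.PosSemidef → ∀ i, 0 ≤ a i) ∧ (B.PosSemidef → ∀ i, 0 ≤ b i) ∧
      A.trace = ∑ i, (a i : ℂ) ∧ B.trace = ∑ i, (b i : ℂ) := by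
  obtain ⟨W, a, -, -, -, hf, ha, -, hta⟩ := exists_diag hA
  obtain ⟨V, b, -, -, -, hg, hb, -, htb⟩ := exists_diag hB
  refine ⟨a, b, fun i j => Complex.normSq ((Wᴴ * V) i j), fun i j => Complex.normSq_nonneg _,
    fun f g => ?_, ha, hb, hta, htb⟩
  rw [hf, hg, trace_conj_diag_mul]

theorem diag_kronecker (W : Matrix ι ι ℂ) (V : Matrix κ κ ℂ) (a : ι → ℝ) (b : κ → ℝ) :
    (W * diagonal (fun i => (a i : ℂ)) * Wᴴ) ⊗ₖ (V * diagonal (fun i => (b i : ℂ)) * Vᴴ) =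
      (W ⊗ₖ V) * diagonal (fun i : ι × κ => ((a i.1 * b i.2 : ℝ) : ℂ)) * (W ⊗ₖ V)ᴴ := by
  rw [mul_kronecker_mul, mul_kronecker_mul, conjTranspose_kronecker,
    diagonal_kronecker_diagonal]
  simp

/-- Functional calculus of a tensor product. -/
theorem cfc_kronecker {A : Matrix ι ι ℂ} {B : Matrix κ κ ℂ} (hA : A.PosSemidef) (hB : B.PosDef)
    {f f₁ f₂ g₁ g₂ : ℝ → ℝ}
    (h : ∀ x y : ℝ, 0 ≤ x → 0 < y → f (x * y) = f₁ x * f₂ y + g₁ x * g₂ y) :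
    cfc f (A ⊗ₖ B) = cfc f₁ A ⊗ₖ cfc f₂ B + cfc g₁ A ⊗ₖ cfc g₂ B := by
  obtain ⟨W, a, w1, w2, eA, hf, ha, -, -⟩ := exists_diag hA.1
  obtain ⟨V, b, v1, v2, eB, hg, -, hb, -⟩ := exists_diag hB.1
  have u1 : (W ⊗ₖ V) * (W ⊗ₖ V)ᴴ = 1 := by
    rw [conjTranspose_kronecker, ← mul_kronecker_mul, w1, v1, one_kronecker_one]
  have u2 : (W ⊗ₖ V)ᴴ * (W ⊗ₖ V) = 1 := by
    rw [conjTranspose_kronecker, ← mul_kronecker_mul, w2, v2, one_kronecker_one]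
  rw [hf, hg, hf, hg, diag_kronecker, diag_kronecker]
  conv_lhs => rw [eA, eB, diag_kronecker, cfc_conj_diagonal u1 u2]
  rw [← Matrix.add_mul, ← Matrix.mul_add, diagonal_add]
  congr 3
  ext i
  rw [h _ _ (ha hA _) (hb hB _)]
  push_cast; rfl

/-- The indicator function of `{0}`; its functional calculus is the projection on the kernel. -/
def indZero (x : ℝ) : ℝ := if x = 0 then 1 else 0

/-- `log (x y) = log x + log y` fails at `x = 0` under the convention `log 0 = 0`. The kernel of `A`
therefore has to be cut off in front of `log B`. -/
theorem log_kronecker {A : Matrix ι ι ℂ} {B : Matrix κ κ ℂ} (hA : A.PosSemidef) (hB : B.PosDef) :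
    cfc Real.log (A ⊗ₖ B) =
      cfc Real.log A ⊗ₖ 1 + (1 - cfc indZero A) ⊗ₖ cfc Real.log B := by
  have e : (1 : Matrix ι ι ℂ) - cfc indZero A = cfc (fun x => 1 - indZero x) A := by
    obtain ⟨W, a, w1, -, -, hf, -⟩ := exists_diag hA.1
    rw [hf, hf]
    conv_lhs => rw [← w1]
    have : diagonal (fun i => ((1 - indZero (a i) : ℝ) : ℂ)) =
      1 - diagonal (fun i => (indZero (a i) : ℂ)) := by
      rw [← diagonal_one, diagonal_sub]; simp
    rw [this, Matrix.mul_sub, Matrix.mul_one, Matrix.sub_mul]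
  have e1 : (1 : Matrix κ κ ℂ) = cfc (fun _ => (1 : ℝ)) B := by
    rw [cfc_const_one ℝ B hB.1.isSelfAdjoint]
  rw [e, e1]
  refine cfc_kronecker hA hB fun x y hx hy => ?_
  rcases hx.eq_or_lt with rfl | hx
  · simp [indZero]
  · rw [Real.log_mul hx.ne' hy.ne', indZero, if_neg hx.ne']; ring

theorem indZero_kronecker {A : Matrix ι ι ℂ} {B : Matrix κ κ ℂ} (hA : A.PosSemidef)
    (hB : B.PosDef) : cfc indZero (A ⊗ₖ B) = cfc indZero A ⊗ₖ 1 := by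
  have e1 : (1 : Matrix κ κ ℂ) = cfc (fun _ => (1 : ℝ)) B := by
    rw [cfc_const_one ℝ B hB.1.isSelfAdjoint]
  have := cfc_kronecker (f := indZero) (f₁ := indZero) (f₂ := fun _ => 1) (g₁ := fun _ => 0)
    (g₂ := fun _ => 0) hA hB fun x y hx hy => by simp [indZero, hy.ne']
  rw [this, e1]
  simp

theorem mul_indZero {A : Matrix ι ι ℂ} (hA : A.IsHermitian) : A * cfc indZero A = 0 := by
  obtain ⟨W, a, w1, w2, eA, hf, -⟩ := exists_diag hA
  have := (conjDiag W w1 w2).map_mul a (fun i => indZero (a i))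
  simp only [conjDiag, RingHom.coe_mk, MonoidHom.coe_mk, OneHom.coe_mk] at this
  rw [hf]
  conv_lhs => enter [1]; rw [eA]
  rw [← this]
  have : (fun i => (((a * fun i => indZero (a i)) i : ℝ) : ℂ)) = fun _ => (0 : ℂ) := by
    ext i
    by_cases h : a i = 0 <;> simp [indZero, h]
  rw [this]
  simp

theorem posSemidef_cfc {A : Matrix ι ι ℂ} (hA : A.IsHermitian) {f : ℝ → ℝ} (hf : ∀ x, 0 ≤ f x) :
    (cfc f A).PosSemidef := by
  obtain ⟨W, a, -, -, -, h, -⟩ := exists_diag hA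
  rw [h]
  refine PosSemidef.mul_mul_conjTranspose_same (.diagonal fun i => ?_) W
  simpa using hf (a i)

theorem indZero_of_posDef {A : Matrix ι ι ℂ} (hA : A.PosDef) : cfc indZero A = 0 := by
  obtain ⟨W, a, -, -, -, h, -, ha, -⟩ := exists_diag hA.1
  rw [h]
  have : (fun i => (indZero (a i) : ℂ)) = fun _ => 0 := by
    ext i; simp [indZero, (ha hA i).ne']
  simp [this]

open scoped MatrixOrder in
theorem exists_conjTranspose_mul_self {A : Matrix ι ι ℂ} (hA : A.PosSemidef) :
    ∃ X : Matrix ι ι ℂ, A = Xᴴ * X :=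
  CStarAlgebra.nonneg_iff_eq_star_mul_self.mp hA.nonneg

theorem trace_mul_eq_trace_sq (X Y : Matrix ι ι ℂ) :
    (Xᴴ * X * (Yᴴ * Y)).trace = ((X * Yᴴ)ᴴ * (X * Yᴴ)).trace := by
  rw [conjTranspose_mul, conjTranspose_conjTranspose, trace_mul_comm, Matrix.mul_assoc,
    ← trace_mul_comm]
  simp only [Matrix.mul_assoc]

/-- With `A = X* X` and `B = Y* Y`, the trace is the squared Hilbert-Schmidt norm of `X Y*`. -/
theorem mul_eq_zero_of_trace {A B : Matrix ι ι ℂ} (hA : A.PosSemidef) (hB : B.PosSemidef)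
    (h : (A * B).trace = 0) : A * B = 0 := by
  obtain ⟨X, rfl⟩ := exists_conjTranspose_mul_self hA
  obtain ⟨Y, rfl⟩ := exists_conjTranspose_mul_self hB
  rw [trace_mul_eq_trace_sq, trace_conjTranspose_mul_self_eq_zero_iff] at h
  rw [Matrix.mul_assoc, ← Matrix.mul_assoc X, h]
  simp

/-! ### Relative entropy -/

/-- With `t = b / a` the claim is `log t ≤ (t - 1) - a (t - 1)² / 2`. For `t ≤ 1` two terms of the
logarithmic series and `a ≤ 1` suffice. For `t ≥ 1` it follows from `log t ≤ sinh (log t) = (t -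
t⁻¹) / 2` and `a ≤ t⁻¹`, which is `b ≤ 1`. -/
theorem half_sq_le_klein {a b : ℝ} (ha : 0 ≤ a) (ha1 : a ≤ 1) (hb : 0 < b) (hb1 : b ≤ 1) :
    (a - b) ^ 2 / 2 ≤ a * Real.log a - a * Real.log b - a + b := by
  rcases ha.eq_or_lt with rfl | ha
  · simp; nlinarith
  set t := b / a with ht
  have ht0 : 0 < t := by positivity
  have hbt : b = a * t := by rw [ht]; field_simp
  have hlog : Real.log b = Real.log a + Real.log t := by
    rw [hbt, Real.log_mul ha.ne' ht0.ne']
  have key : Real.log t ≤ (t - 1) - a * (t - 1) ^ 2 / 2 := by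
    rcases le_total t 1 with h | h
    · have h1 : Real.log t ≤ (t - 1) - (t - 1) ^ 2 / 2 := by
        have hs := Real.hasSum_pow_div_log_of_abs_lt_one (x := 1 - t)
          (by rw [abs_of_nonneg (by linarith)]; linarith)
        have := sum_le_hasSum (Finset.range 2) (fun i _ => by
          have : 0 ≤ 1 - t := by linarith
          positivity) hs
        simp [Finset.sum_range_succ] at this
        nlinarith
      nlinarith [mul_nonneg (sub_nonneg.2 ha1) (sq_nonneg (t - 1))]
    · have h1 : Real.log t ≤ (t - t⁻¹) / 2 := by
        have h2 : 0 ≤ Real.log t := Real.log_nonneg h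
        have := Real.self_le_sinh_iff.2 h2
        rwa [Real.sinh_log ht0] at this
      have h3 : (t - t⁻¹) / 2 = (t - 1) - t⁻¹ * (t - 1) ^ 2 / 2 := by field_simp; ring
      have h4 : a ≤ t⁻¹ := by
        rw [ht, inv_div, le_div_iff₀ hb]; nlinarith
      nlinarith [mul_nonneg (sub_nonneg.2 h4) (sq_nonneg (t - 1))]
  rw [hlog, hbt]
  nlinarith [mul_le_mul_of_nonneg_left key ha.le]

theorem le_one_of_sum_eq_one {α : Type*} [Fintype α] {a : α → ℝ} (h0 : ∀ i, 0 ≤ a i) (h1 : ∑ i, (a i : ℂ) = 1)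
    (i : α) : a i ≤ 1 := by
  have h : ∑ i, a i = 1 := by exact_mod_cast h1
  rw [← h]
  exact Finset.single_le_sum (fun i _ => h0 i) (Finset.mem_univ i)

/-- A quadratic lower bound for the relative entropy. -/
theorem half_sq_le_relEntropy {η ν : Matrix ι ι ℂ} (hη : IsState η) (hν : IsState ν)
    (hker : η * cfc indZero ν = 0) :
    ((η - ν) * (η - ν)).trace.re / 2 ≤ relEntropy η ν := by
  obtain ⟨a, b, c, hc, htr, ha, hb, hta, htb⟩ := exists_weights hη.1.1 hν.1.1
  have ha := ha hη.1
  have hb := hb hν.1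
  have ha1 := le_one_of_sum_eq_one ha (hta.symm.trans hη.2)
  have hb1 := le_one_of_sum_eq_one hb (htb.symm.trans hν.2)
  have sη := hη.1.1.isSelfAdjoint
  have sν := hν.1.1.isSelfAdjoint
  have i1 : cfc (fun x : ℝ => x) η = η := cfc_id' ℝ η sη
  have i2 : cfc (fun x : ℝ => x) ν = ν := cfc_id' ℝ ν sν
  have i3 : cfc (fun _ : ℝ => (1 : ℝ)) η = 1 := cfc_const_one ℝ η sη
  have i4 : cfc (fun _ : ℝ => (1 : ℝ)) ν = 1 := cfc_const_one ℝ ν sν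
  -- The trace of `η` against the kernel projection of `ν` is a sum of nonnegative terms, so each of
  -- them vanishes. This disposes of the indices at which the scalar inequality is unavailable.
  have hzero : ∀ i j, b j = 0 → c i j * a i = 0 := by
    have h := htr (fun x => x) indZero
    rw [i1, hker, trace_zero] at h
    have h' : ∑ i, ∑ j, c i j * a i * indZero (b j) = 0 := by exact_mod_cast h.symm
    have hnn : ∀ i j, 0 ≤ c i j * a i * indZero (b j) := fun i j => by
      have := hc i j
      have := ha i
      unfold indZero
      split_ifs <;> positivity
    intro i j hj
    rw [Finset.sum_eq_zero_iff_of_nonneg fun i _ => Finset.sum_nonneg fun j _ => hnn i j] at h'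
    have h2 := h' i (Finset.mem_univ i)
    rw [Finset.sum_eq_zero_iff_of_nonneg fun j _ => hnn i j] at h2
    simpa [indZero, hj] using h2 j (Finset.mem_univ j)
  have e1 : (η * cfc Real.log η).trace = ((∑ i, ∑ j, c i j * (a i * Real.log (a i)) * 1 : ℝ) : ℂ) := by
    rw [← htr (fun x => x * Real.log x) (fun _ => 1), i4, Matrix.mul_one]
    congr 1
    obtain ⟨W, x, w1, w2, eA, hf, -⟩ := exists_diag hη.1.1
    have := (conjDiag W w1 w2).map_mul x (fun i => Real.log (x i))
    simp only [conjDiag, RingHom.coe_mk, MonoidHom.coe_mk, OneHom.coe_mk] at this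
    rw [hf, hf]
    conv_lhs => enter [1]; rw [eA]
    exact this.symm
  have e2 := htr (fun x => x) Real.log
  have e3 := htr (fun x => x) (fun _ => 1)
  have e4 := htr (fun _ => 1) (fun x => x)
  have e5 := htr (fun x => x) (fun x => x)
  have e6 : (η * η).trace = ((∑ i, ∑ j, c i j * (a i ^ 2) * 1 : ℝ) : ℂ) := by
    rw [← htr (fun x => x ^ 2) (fun _ => 1), i4, Matrix.mul_one, cfc_pow_id (R := ℝ) η 2 sη, sq]
  have e7 : (ν * ν).trace = ((∑ i, ∑ j, c i j * 1 * (b j ^ 2) : ℝ) : ℂ) := by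
    rw [← htr (fun _ => 1) (fun x => x ^ 2), i3, Matrix.one_mul, cfc_pow_id (R := ℝ) ν 2 sν, sq]
  rw [i1] at e2 e3 e5
  rw [i2] at e4 e5
  rw [i4, Matrix.mul_one, hη.2] at e3
  rw [i3, Matrix.one_mul, hν.2] at e4
  have r3 : (1 : ℝ) = ∑ i, ∑ j, c i j * a i * 1 := by exact_mod_cast e3
  have r4 : (1 : ℝ) = ∑ i, ∑ j, c i j * 1 * b j := by exact_mod_cast e4
  have lhs : ((η - ν) * (η - ν)).trace.re =
      ∑ i, ∑ j, (c i j * (a i ^ 2) * 1 - 2 * (c i j * a i * b j) + c i j * 1 * (b j ^ 2)) := by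
    have : ((η - ν) * (η - ν)).trace = (η * η).trace - 2 * (η * ν).trace + (ν * ν).trace := by
      rw [Matrix.sub_mul, Matrix.mul_sub, Matrix.mul_sub, trace_sub, trace_sub, trace_sub,
        trace_mul_comm ν η]
      ring
    rw [this, e5, e6, e7]
    simp only [Finset.sum_add_distrib, Finset.sum_sub_distrib, ← Finset.mul_sum]
    norm_cast
  -- The linear terms `-a + b` of the scalar inequality may be inserted because both traces are one.
  have rhs : relEntropy η ν = ∑ i, ∑ j, (c i j * (a i * Real.log (a i)) * 1 -
      c i j * a i * Real.log (b j) - c i j * a i * 1 + c i j * 1 * b j) := by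
    rw [relEntropy, Matrix.mul_sub, trace_sub, e1, e2]
    simp only [Finset.sum_add_distrib, Finset.sum_sub_distrib]
    rw [← r3, ← r4]
    norm_cast
    ring
  rw [lhs, rhs, Finset.sum_div]
  refine Finset.sum_le_sum fun i _ => ?_
  rw [Finset.sum_div]
  refine Finset.sum_le_sum fun j _ => ?_
  rcases (hb j).eq_or_lt with h | h
  · have hz := hzero i j h.symm
    rw [← h]
    have : c i j * a i ^ 2 = 0 := by rw [sq, ← mul_assoc, hz, zero_mul]
    have h2 : c i j * (a i * Real.log (a i)) = 0 := by rw [← mul_assoc, hz, zero_mul]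
    rw [this, h2, hz]
    simp
  · have := mul_le_mul_of_nonneg_left (half_sq_le_klein (ha i) (ha1 i) h (hb1 j)) (hc i j)
    nlinarith

end Cfc

end RIS

end

noncomputable section

namespace RIS

open Filter Set Matrix

/-! ### Quantum channels and Perron-Frobenius theory -/

section Channel

variable {S E : Type*} [Fintype S] [DecidableEq S] [Fintype E] [DecidableEq E]

theorem trace_partialTrace (M : Matrix (S × E) (S × E) ℂ) : (partialTrace M).trace = M.trace := by
  simp [partialTrace, trace, Fintype.sum_prod_type]

theorem partialTrace_mul (M : Matrix (S × E) (S × E) ℂ) (x : Matrix S S ℂ) :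
    partialTrace (M * (x ⊗ₖ (1 : Matrix E E ℂ))) = partialTrace M * x := by
  ext i j
  simp only [partialTrace, LinearMap.coe_mk, AddHom.coe_mk, of_apply, mul_apply, kronecker_apply,
    Fintype.sum_prod_type, one_apply, mul_ite, mul_one, mul_zero, Finset.sum_ite_eq',
    Finset.mem_univ, if_true, Finset.sum_mul]
  rw [Finset.sum_comm]

theorem mul_partialTrace (M : Matrix (S × E) (S × E) ℂ) (x : Matrix S S ℂ) :
    partialTrace ((x ⊗ₖ (1 : Matrix E E ℂ)) * M) = x * partialTrace M := by
  ext i j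
  simp only [partialTrace, LinearMap.coe_mk, AddHom.coe_mk, of_apply, mul_apply, kronecker_apply,
    Fintype.sum_prod_type, one_apply, ite_mul, mul_ite, mul_one, mul_zero, zero_mul,
    Finset.sum_ite_eq, Finset.mem_univ, if_true, Finset.mul_sum]
  rw [Finset.sum_comm]

theorem partialTrace_kronecker (x : Matrix S S ℂ) (y : Matrix E E ℂ) :
    partialTrace (x ⊗ₖ y) = y.trace • x := by
  ext i j
  simp [partialTrace, trace, ← Finset.mul_sum, mul_comm]

theorem conjTranspose_partialTrace (M : Matrix (S × E) (S × E) ℂ) :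
    (partialTrace M)ᴴ = partialTrace Mᴴ := by
  ext i j; simp [partialTrace]

theorem posSemidef_partialTrace {M : Matrix (S × E) (S × E) ℂ} (hM : M.PosSemidef) :
    (partialTrace M).PosSemidef := by
  have : partialTrace M = ∑ e, M.submatrix (fun i => (i, e)) (fun i => (i, e)) := by
    ext i j; simp [partialTrace, Matrix.sum_apply]
  rw [this]
  exact posSemidef_sum _ fun e _ => hM.submatrix _

/-- A unitary and a faithful probe state. -/
structure IsDilation (U : Matrix (S × E) (S × E) ℂ) (ξ : Matrix E E ℂ) : Prop where
  mul_conj : U * Uᴴ = 1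
  conj_mul : Uᴴ * U = 1
  posDef : ξ.PosDef
  trace_one : ξ.trace = 1

variable {U : Matrix (S × E) (S × E) ℂ} {ξ : Matrix E E ℂ}

theorem channel_apply (U : Matrix (S × E) (S × E) ℂ) (ξ : Matrix E E ℂ) (A : Matrix S S ℂ) :
    channel U ξ A = partialTrace (U * (A ⊗ₖ ξ) * Uᴴ) := rfl

theorem IsDilation.trace_channel (h : IsDilation U ξ) (A : Matrix S S ℂ) :
    (channel U ξ A).trace = A.trace := by
  rw [channel_apply, trace_partialTrace, trace_mul_comm, ← Matrix.mul_assoc, h.conj_mul,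
    Matrix.one_mul, trace_kronecker, h.trace_one, mul_one]

theorem IsDilation.posSemidef_dilate (h : IsDilation U ξ) {A : Matrix S S ℂ} (hA : A.PosSemidef) :
    (U * (A ⊗ₖ ξ) * Uᴴ).PosSemidef :=
  (hA.kronecker h.posDef.posSemidef).mul_mul_conjTranspose_same U

theorem IsDilation.isState_dilate (h : IsDilation U ξ) {A : Matrix S S ℂ} (hA : IsState A) :
    IsState (U * (A ⊗ₖ ξ) * Uᴴ) := by
  refine ⟨h.posSemidef_dilate hA.1, ?_⟩
  rw [trace_mul_comm, ← Matrix.mul_assoc, h.conj_mul,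
    Matrix.one_mul, trace_kronecker, h.trace_one, mul_one, hA.2]

theorem IsDilation.posSemidef_channel (h : IsDilation U ξ) {A : Matrix S S ℂ}
    (hA : A.PosSemidef) : (channel U ξ A).PosSemidef :=
  posSemidef_partialTrace (h.posSemidef_dilate hA)

theorem IsDilation.isState_channel (h : IsDilation U ξ) {A : Matrix S S ℂ}
    (hA : IsState A) : IsState (channel U ξ A) :=
  ⟨h.posSemidef_channel hA.1, by rw [h.trace_channel, hA.2]⟩

theorem IsDilation.conjTranspose_channel (h : IsDilation U ξ) (A : Matrix S S ℂ) :
    (channel U ξ A)ᴴ = channel U ξ Aᴴ := by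
  rw [channel_apply, conjTranspose_partialTrace, channel_apply, conjTranspose_mul,
    conjTranspose_mul, conjTranspose_conjTranspose, conjTranspose_kronecker, h.posDef.1.eq,
    Matrix.mul_assoc]

theorem trace_channel_mul (U : Matrix (S × E) (S × E) ℂ) (ξ : Matrix E E ℂ) (A x : Matrix S S ℂ) :
    (channel U ξ A * x).trace = ((A ⊗ₖ ξ) * (Uᴴ * (x ⊗ₖ (1 : Matrix E E ℂ)) * U)).trace := by
  rw [channel_apply, ← partialTrace_mul, trace_partialTrace, Matrix.mul_assoc, Matrix.mul_assoc,
    trace_mul_comm]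
  simp only [Matrix.mul_assoc]

/-- The probe state is faithful, so it can be cancelled: multiply by `q ⊗ ξ⁻¹` from the left. -/
theorem IsDilation.kronecker_mul_eq_zero (h : IsDilation U ξ) {p : Matrix S S ℂ}
    {Y : Matrix (S × E) (S × E) ℂ} (hp : (p ⊗ₖ ξ) * Y = 0) (q : Matrix S S ℂ) :
    ((q * p) ⊗ₖ (1 : Matrix E E ℂ)) * Y = 0 := by
  have hξ : ξ⁻¹ * ξ = 1 := nonsing_inv_mul _ ((isUnit_iff_isUnit_det _).1 h.posDef.isUnit)
  rw [← hξ, mul_kronecker_mul, Matrix.mul_assoc, hp, Matrix.mul_zero]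

/-- Invariant nonnegative operators of an irreducible channel are faithful. -/
theorem IsDilation.posDef_of_invariant (h : IsDilation U ξ) (hirr : IsIrreducible (channel U ξ))
    {ρ : Matrix S S ℂ} (hρ : ρ.PosSemidef) (hρ0 : ρ ≠ 0) (hinv : channel U ξ ρ = ρ) :
    ρ.PosDef := by
  obtain ⟨W, a, w1, w2, eA, hf, -⟩ := exists_diag hρ.1
  set q := cfc indZero ρ with hq
  set r := cfc (fun x : ℝ => x⁻¹) ρ with hr
  have hmulf : ∀ f g k : ℝ → ℝ, (∀ x, f x * g x = k x) → cfc f ρ * cfc g ρ = cfc k ρ := by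
    intro f g k hfg
    have := (conjDiag W w1 w2).map_mul (fun i => f (a i)) (fun i => g (a i))
    simp only [conjDiag, RingHom.coe_mk, MonoidHom.coe_mk, OneHom.coe_mk] at this
    rw [hf, hf, hf, ← this]
    simp only [Pi.mul_apply, hfg]
  have hid : cfc (fun x : ℝ => x) ρ = ρ := cfc_id' ℝ ρ hρ.1.isSelfAdjoint
  have hone : cfc (fun _ : ℝ => (1 : ℝ)) ρ = 1 := cfc_const_one ℝ ρ hρ.1.isSelfAdjoint
  have hrρ : r * ρ = 1 - q := by
    have h1 := hmulf (fun x => x⁻¹) (fun x => x) (fun x => 1 - indZero x) fun x => by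
      by_cases hx : x = 0 <;> simp [indZero, hx]
    rw [hid] at h1
    rw [hr, h1, hq, ← hone]
    rw [hf, hf, hf, ← Matrix.sub_mul, ← Matrix.mul_sub, diagonal_sub]
    simp
  have hqq : q * q = q := hmulf _ _ _ fun x => by by_cases hx : x = 0 <;> simp [indZero, hx]
  have hqH : qᴴ = q := (isHermitian_cfc hρ.1 indZero).eq
  have hqP : q.PosSemidef := posSemidef_cfc hρ.1 fun x => by
    unfold indZero; split_ifs <;> norm_num
  have hρq : ρ * q = 0 := mul_indZero hρ.1
  set p := 1 - q with hp
  have hpp : p * p = p := by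
    simp [hp, Matrix.sub_mul, Matrix.mul_sub, hqq]
  have hpH : pᴴ = p := by rw [hp, conjTranspose_sub, hqH, conjTranspose_one]
  have hY : (Uᴴ * (q ⊗ₖ (1 : Matrix E E ℂ)) * U).PosSemidef :=
    (hqP.kronecker PosSemidef.one).conjTranspose_mul_mul_same U
  -- By invariance, the expectation in `ρ ⊗ ξ` of the evolved kernel projection `q` is `Tr (ρ q) =
  -- 0`. Cancelling `ρ ⊗ ξ` on its support shows that `U` maps the range of `p ⊗ 1` into itself, so
  -- `p` reduces the channel.
  have hz : (ρ ⊗ₖ ξ) * (Uᴴ * (q ⊗ₖ (1 : Matrix E E ℂ)) * U) = 0 := by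
    refine mul_eq_zero_of_trace (hρ.kronecker h.posDef.posSemidef) hY ?_
    rw [← trace_channel_mul, hinv, hρq, trace_zero]
  have hz2 := h.kronecker_mul_eq_zero hz r
  rw [hrρ] at hz2
  have hz3 : (p ⊗ₖ (1 : Matrix E E ℂ)) * Uᴴ * (q ⊗ₖ (1 : Matrix E E ℂ)) = 0 := by
    have := congrArg (fun X => X * Uᴴ) hz2
    simp only [Matrix.zero_mul] at this
    rw [← this]
    simp only [Matrix.mul_assoc, h.mul_conj, Matrix.mul_one]
  have hz4 : (q ⊗ₖ (1 : Matrix E E ℂ)) * U * (p ⊗ₖ (1 : Matrix E E ℂ)) = 0 := by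
    have := congrArg conjTranspose hz3
    simpa [conjTranspose_mul, conjTranspose_kronecker, hqH, hpH, Matrix.mul_assoc] using this
  have h1p : (p ⊗ₖ (1 : Matrix E E ℂ)) = 1 - q ⊗ₖ (1 : Matrix E E ℂ) := by
    rw [eq_sub_iff_add_eq, ← add_kronecker, hp, sub_add_cancel, one_kronecker_one]
  have hUp : (p ⊗ₖ (1 : Matrix E E ℂ)) * (U * (p ⊗ₖ (1 : Matrix E E ℂ))) =
      U * (p ⊗ₖ (1 : Matrix E E ℂ)) := by
    conv_lhs => enter [1]; rw [h1p]
    rw [Matrix.sub_mul, Matrix.one_mul, ← Matrix.mul_assoc, hz4, sub_zero]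
  have hUp' : (p ⊗ₖ (1 : Matrix E E ℂ)) * Uᴴ * (p ⊗ₖ (1 : Matrix E E ℂ)) =
      (p ⊗ₖ (1 : Matrix E E ℂ)) * Uᴴ := by
    conv_lhs => enter [2]; rw [h1p]
    rw [Matrix.mul_sub, Matrix.mul_one, hz3, sub_zero]
  have hproj : IsStarProjection p := ⟨hpp, hpH⟩
  have hstab : ∀ A, ∃ B, channel U ξ (p * A * p) = p * B * p := by
    refine fun A => ⟨channel U ξ (p * A * p), ?_⟩
    have e : (p * A * p) ⊗ₖ ξ =
        (p ⊗ₖ (1 : Matrix E E ℂ)) * (A ⊗ₖ ξ) * (p ⊗ₖ (1 : Matrix E E ℂ)) := by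
      rw [← mul_kronecker_mul, ← mul_kronecker_mul]; simp
    rw [channel_apply, e, ← mul_partialTrace, ← partialTrace_mul]
    congr 1
    calc _ = (U * (p ⊗ₖ (1 : Matrix E E ℂ))) * (A ⊗ₖ ξ) * ((p ⊗ₖ (1 : Matrix E E ℂ)) * Uᴴ) := by
          simp only [Matrix.mul_assoc]
      _ = _ := by
          rw [← hUp, ← hUp']
          simp only [Matrix.mul_assoc]
  rcases hirr p hproj hstab with h0 | h1
  · exfalso
    apply hρ0
    have : ρ * p = ρ := by rw [hp, Matrix.mul_sub, hρq]; simp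
    rw [← this, h0, Matrix.mul_zero]
  · rw [hρ.posDef_iff_isUnit]
    rw [h1] at hrρ
    exact IsUnit.of_mul_eq_one_right r hrρ

/-- Simultaneous diagonalization of a positive definite and a Hermitian matrix. -/
theorem exists_simul_diag {ρ B : Matrix S S ℂ} (hρ : ρ.PosDef) (hB : B.IsHermitian) :
    ∃ (T : Matrix S S ℂ) (c : S → ℝ), IsUnit T ∧ Tᴴ * ρ * T = 1 ∧
      Tᴴ * B * T = diagonal (fun i => (c i : ℂ)) := by
  obtain ⟨Y, hY⟩ := exists_conjTranspose_mul_self hρ.posSemidef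
  have hYu : IsUnit Y := by
    have := hρ.isUnit
    rw [hY] at this
    rw [isUnit_iff_isUnit_det] at this ⊢
    rw [det_mul] at this
    exact isUnit_of_mul_isUnit_right this
  have hYdet := (isUnit_iff_isUnit_det _).1 hYu
  set Z := Y⁻¹ with hZ
  have hYZ : Y * Z = 1 := mul_nonsing_inv _ hYdet
  have hZY : Z * Y = 1 := nonsing_inv_mul _ hYdet
  have hC : (Zᴴ * B * Z).IsHermitian := by
    rw [IsHermitian, conjTranspose_mul, conjTranspose_mul, conjTranspose_conjTranspose, hB.eq,
      Matrix.mul_assoc]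
  obtain ⟨W, c, w1, w2, eC, -⟩ := exists_diag hC
  refine ⟨Z * W, c, ?_, ?_, ?_⟩
  · exact (IsUnit.of_mul_eq_one Y hZY).mul (IsUnit.of_mul_eq_one Wᴴ w1)
  · rw [hY, conjTranspose_mul]
    calc _ = Wᴴ * ((Y * Z)ᴴ * (Y * Z)) * W := by
          simp only [conjTranspose_mul, Matrix.mul_assoc]
      _ = _ := by rw [hYZ]; simp [w2]
  · calc (Z * W)ᴴ * B * (Z * W) = Wᴴ * (Zᴴ * B * Z) * W := by
          simp only [conjTranspose_mul, Matrix.mul_assoc]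
      _ = (Wᴴ * W) * diagonal (fun i => (c i : ℂ)) * (Wᴴ * W) := by
          rw [eC]; simp only [Matrix.mul_assoc]
      _ = _ := by rw [w2]; simp

/-- If `B` has a negative eigenvalue relative to `ρ`, moving from `ρ` along a multiple of `B`
reaches the boundary of the positive cone at an invariant state that is not faithful, which
irreducibility forbids. Otherwise `B` is nonnegative with trace zero. -/
theorem IsDilation.hermitian_fixed (h : IsDilation U ξ) (hirr : IsIrreducible (channel U ξ))
    {ρ : Matrix S S ℂ} (hρ : IsInvariantState (channel U ξ) ρ) (hρd : ρ.PosDef)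
    {B : Matrix S S ℂ} (hB : B.IsHermitian) (hBt : B.trace = 0) (hBi : channel U ξ B = B) :
    B = 0 := by
  obtain ⟨T, c, hT, h1, h2⟩ := exists_simul_diag hρd hB
  by_cases hc : ∀ i, 0 ≤ c i
  · have : B.PosSemidef := by
      rw [← Matrix.IsUnit.posSemidef_star_left_conjugate_iff hT, star_eq_conjTranspose, h2]
      exact .diagonal fun i => by simpa using hc i
    exact this.trace_eq_zero_iff.1 hBt
  · push Not at hc
    obtain ⟨i₀, hi₀⟩ := hc
    obtain ⟨i, -, hi⟩ := Finset.exists_min_image Finset.univ c ⟨i₀, Finset.mem_univ _⟩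
    have hci : c i < 0 := (hi i₀ (Finset.mem_univ _)).trans_lt hi₀
    exfalso
    -- With `c i` the most negative relative eigenvalue, those of `X` are `1 - c j / c i`: all
    -- nonnegative, and zero at `j = i`.
    set X : Matrix S S ℂ := ρ - ((c i)⁻¹ : ℂ) • B with hX
    have e : Tᴴ * X * T = diagonal (fun j => ((1 - (c i)⁻¹ * c j : ℝ) : ℂ)) := by
      rw [hX, Matrix.mul_sub, Matrix.sub_mul, h1, Matrix.mul_smul, Matrix.smul_mul, h2,
        ← diagonal_one, ← diagonal_smul, diagonal_sub]
      simp
    have hXp : X.PosSemidef := by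
      rw [← Matrix.IsUnit.posSemidef_star_left_conjugate_iff hT, star_eq_conjTranspose, e]
      refine .diagonal fun j => ?_
      have h3 : (c i)⁻¹ * c j ≤ 1 := by
        have h4 := hi j (Finset.mem_univ _)
        rw [inv_mul_eq_div, div_le_one_of_neg hci]
        exact h4
      simp only [Pi.zero_apply]
      exact_mod_cast sub_nonneg.2 h3
    have hXt : X.trace = 1 := by rw [hX, trace_sub, trace_smul, hBt, hρ.1.2]; simp
    have hXi : channel U ξ X = X := by rw [hX, map_sub, map_smul, hBi, hρ.2]
    have hXd := h.posDef_of_invariant hirr hXp (fun h0 => by simp [h0] at hXt) hXi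
    rw [← Matrix.IsUnit.posDef_star_left_conjugate_iff hT, star_eq_conjTranspose, e,
      posDef_diagonal_iff] at hXd
    have := hXd i
    rw [inv_mul_cancel₀ hci.ne] at this
    simp at this

/-- The fixed points of an irreducible channel are the multiples of the invariant state. -/
theorem IsDilation.eq_smul_of_fixed (h : IsDilation U ξ) (hirr : IsIrreducible (channel U ξ))
    {ρ : Matrix S S ℂ} (hρ : IsInvariantState (channel U ξ) ρ)
    {A : Matrix S S ℂ} (hA : channel U ξ A = A) : A = A.trace • ρ := by
  have hρd := h.posDef_of_invariant hirr hρ.1.1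
    (fun h0 => by have := hρ.1.2; simp [h0] at this) hρ.2
  set B := A - A.trace • ρ with hB
  have hBi : channel U ξ B = B := by rw [hB, map_sub, map_smul, hA, hρ.2]
  have hBt : B.trace = 0 := by rw [hB, trace_sub, trace_smul, hρ.1.2]; simp
  have hBi' : channel U ξ Bᴴ = Bᴴ := by rw [← h.conjTranspose_channel, hBi]
  have hBt' : Bᴴ.trace = 0 := by rw [trace_conjTranspose, hBt, star_zero]
  have h1 : B + Bᴴ = 0 := h.hermitian_fixed hirr hρ hρd
    (by rw [IsHermitian, conjTranspose_add, conjTranspose_conjTranspose, add_comm])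
    (by rw [trace_add, hBt, hBt', add_zero]) (by rw [map_add, hBi, hBi'])
  have h2 : Complex.I • (B - Bᴴ) = 0 := h.hermitian_fixed hirr hρ hρd
    (by rw [IsHermitian, conjTranspose_smul, conjTranspose_sub, conjTranspose_conjTranspose,
          ← neg_sub B, smul_neg, ← neg_smul]
        simp)
    (by rw [trace_smul, trace_sub, hBt, hBt']; simp) (by rw [map_smul, map_sub, hBi, hBi'])
  have h3 : B - Bᴴ = 0 := by simpa using h2
  have h4 : B = 0 := by
    have : (2 : ℂ) • B = 0 := by
      rw [two_smul]
      calc B + B = (B + Bᴴ) + (B - Bᴴ) := by abel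
        _ = 0 := by rw [h1, h3, add_zero]
    simpa using this
  rw [← sub_eq_zero]; exact h4

/-- Peripheral eigenvalues of an irreducible channel are roots of unity of bounded order. -/
theorem IsDilation.pow_factorial_eq_one (h : IsDilation U ξ) (hirr : IsIrreducible (channel U ξ))
    {ρ : Matrix S S ℂ} (hρ : IsInvariantState (channel U ξ) ρ) {θ : ℂ}
    (hθ : (channel U ξ).HasEigenvalue θ) (hθ1 : ‖θ‖ = 1) :
    θ ^ (Module.finrank ℂ (Matrix S S ℂ)).factorial = 1 := by
  have hρd := h.posDef_of_invariant hirr hρ.1.1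
    (fun h0 => by have := hρ.1.2; simp [h0] at this) hρ.2
  set Φ := channel U ξ with hΦ
  -- An eigenvector of the dual map: `Φ - θ` is not surjective, so a nonzero functional vanishes on
  -- its range, and it is represented by a trace.
  obtain ⟨u, hu0, hu⟩ : ∃ u : Matrix S S ℂ, u ≠ 0 ∧
      ∀ A, (Φ A * u).trace = θ * (A * u).trace := by
    have hns : LinearMap.range (Φ - algebraMap ℂ _ θ) ≠ ⊤ := by
      intro htop
      have hker := LinearMap.ker_eq_bot_iff_range_eq_top.2 htop
      exact (Module.End.hasEigenvalue_iff.1 hθ) (by rw [Module.End.eigenspace_def]; exact hker)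
    obtain ⟨f, hf0, hf⟩ := Submodule.exists_le_ker_of_lt_top _ (lt_top_iff_ne_top.2 hns)
    set u : Matrix S S ℂ := of fun j i => f (single i j 1) with hu
    have hfu : ∀ A, f A = (A * u).trace := by
      intro A
      conv_lhs => rw [matrix_eq_sum_single A, map_sum]
      rw [trace]
      refine Finset.sum_congr rfl fun i _ => ?_
      rw [map_sum, diag_apply, mul_apply]
      refine Finset.sum_congr rfl fun j _ => ?_
      have : single i j (A i j) = A i j • single i j (1 : ℂ) := by simp [smul_single]
      rw [this, map_smul, hu, of_apply, smul_eq_mul]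
    refine ⟨u, fun h0 => hf0 ?_, fun A => ?_⟩
    · ext1; simp [hfu, h0]
    · have := hf (LinearMap.mem_range_self (Φ - algebraMap ℂ _ θ) A)
      rw [LinearMap.mem_ker, LinearMap.sub_apply, map_sub, sub_eq_zero, hfu, hfu] at this
      rw [this]
      simp [Module.algebraMap_end_apply]
  have hθθ : star θ * θ = 1 := by
    have := Complex.normSq_eq_conj_mul_self (z := θ)
    rw [Complex.normSq_eq_norm_sq, hθ1] at this
    simpa using this.symm
  set u1 := u ⊗ₖ (1 : Matrix E E ℂ) with hu1
  have hu1H : u1ᴴ = uᴴ ⊗ₖ (1 : Matrix E E ℂ) := by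
    rw [hu1, conjTranspose_kronecker, conjTranspose_one]
  set V := Uᴴ * u1 * U with hV
  have hVH : Vᴴ = Uᴴ * u1ᴴ * U := by
    rw [hV]; simp only [conjTranspose_mul, conjTranspose_conjTranspose, Matrix.mul_assoc]
  have hVV : Vᴴ * V = Uᴴ * ((uᴴ * u) ⊗ₖ (1 : Matrix E E ℂ)) * U := by
    rw [hVH, hV]
    calc _ = Uᴴ * u1ᴴ * (U * Uᴴ) * u1 * U := by simp only [Matrix.mul_assoc]
      _ = Uᴴ * (u1ᴴ * u1) * U := by rw [h.mul_conj]; simp only [Matrix.mul_assoc, Matrix.mul_one]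
      _ = _ := by rw [hu1H, hu1, ← mul_kronecker_mul, Matrix.mul_one]
  set τ := (ρ * (uᴴ * u)).trace with hτ
  -- Equality case of a Schwarz inequality. In the state `ρ ⊗ ξ`, the evolved `V` and `u ⊗ 1` have
  -- the same second moment `τ`, and their overlap is `θ τ`. So `V - θ (u ⊗ 1)` has zero second
  -- moment in a faithful state and vanishes.
  have t1 : ((ρ ⊗ₖ ξ) * (Vᴴ * V)).trace = τ := by
    rw [hVV, ← trace_channel_mul, ← hΦ, hρ.2]
  have t2 : ((ρ ⊗ₖ ξ) * (u1ᴴ * u1)).trace = τ := by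
    rw [hu1H, hu1, ← mul_kronecker_mul, ← mul_kronecker_mul, trace_kronecker, Matrix.mul_one,
      Matrix.mul_one, h.trace_one, mul_one]
  have t4 : ((ρ ⊗ₖ ξ) * (u1ᴴ * V)).trace = θ * τ := by
    have := hu (ρ * uᴴ)
    rw [hΦ, trace_channel_mul, Matrix.mul_assoc ρ] at this
    rw [← this, hu1H, ← Matrix.mul_assoc, ← mul_kronecker_mul, Matrix.mul_one]
  have hτr : star τ = τ := by
    rw [hτ, ← trace_conjTranspose, conjTranspose_mul, conjTranspose_mul,
      conjTranspose_conjTranspose, hρd.1.eq, trace_mul_comm]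
  have hρξ := hρd.kronecker h.posDef
  have t3 : ((ρ ⊗ₖ ξ) * (Vᴴ * u1)).trace = star θ * τ := by
    have := congrArg star t4
    rw [← trace_conjTranspose, conjTranspose_mul, conjTranspose_mul, conjTranspose_conjTranspose,
      hρξ.1.eq, trace_mul_comm, star_mul', hτr] at this
    exact this
  have hW : V = θ • u1 := by
    rw [← sub_eq_zero]
    set W := V - θ • u1 with hWdef
    have e : Wᴴ * W = Vᴴ * V - θ • (Vᴴ * u1) - star θ • (u1ᴴ * V) + (star θ * θ) • (u1ᴴ * u1) := by
      rw [hWdef, conjTranspose_sub, conjTranspose_smul, Matrix.sub_mul, Matrix.mul_sub,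
        Matrix.mul_sub]
      simp only [Matrix.smul_mul, Matrix.mul_smul, smul_smul]
      rw [mul_comm θ (star θ)]
      abel
    have e2 : ((ρ ⊗ₖ ξ) * (Wᴴ * W)).trace = 0 := by
      rw [e, hθθ, one_smul, Matrix.mul_add, Matrix.mul_sub, Matrix.mul_sub, trace_add, trace_sub,
        trace_sub, Matrix.mul_smul, Matrix.mul_smul, trace_smul, trace_smul, t1, t2, t3, t4,
        smul_eq_mul, smul_eq_mul, ← mul_assoc, ← mul_assoc, hθθ, mul_comm θ, hθθ]
      ring
    have e3 := mul_eq_zero_of_trace hρξ.posSemidef (posSemidef_conjTranspose_mul_self W) e2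
    have e4 : Wᴴ * W = 0 := by
      have hi := nonsing_inv_mul (ρ ⊗ₖ ξ) ((isUnit_iff_isUnit_det _).1 hρξ.isUnit)
      rw [← Matrix.one_mul (Wᴴ * W), ← hi, Matrix.mul_assoc, e3, Matrix.mul_zero]
    exact conjTranspose_mul_self_eq_zero.1 e4
  have hUu : U * u1 = star θ • (u1 * U) := by
    have : u1 * U = θ • (U * u1) := by
      have := congrArg (fun X => U * X) hW
      simp only [hV, ← Matrix.mul_assoc, h.mul_conj, Matrix.one_mul, Matrix.mul_smul] at this
      exact this
    rw [this, smul_smul, hθθ, one_smul]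
  have hUu' : U * u1ᴴ = θ • (u1ᴴ * U) := by
    have hW' : Vᴴ = star θ • u1ᴴ := by rw [hW, conjTranspose_smul]
    rw [hVH] at hW'
    have : u1ᴴ * U = star θ • (U * u1ᴴ) := by
      have := congrArg (fun X => U * X) hW'
      simp only [← Matrix.mul_assoc, h.mul_conj, Matrix.one_mul, Matrix.mul_smul] at this
      exact this
    rw [this, smul_smul, mul_comm, hθθ, one_smul]
  have hΦu : ∀ A, Φ (u * A) = star θ • (u * Φ A) := by
    intro A
    have : (u * A) ⊗ₖ ξ = u1 * (A ⊗ₖ ξ) := by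
      rw [hu1, ← mul_kronecker_mul, Matrix.one_mul]
    rw [hΦ, channel_apply, this, ← Matrix.mul_assoc, hUu, channel_apply, ← mul_partialTrace,
      Matrix.smul_mul, Matrix.smul_mul, map_smul]
    simp only [Matrix.mul_assoc, hu1]
  have hΦu' : ∀ A, Φ (uᴴ * A) = θ • (uᴴ * Φ A) := by
    intro A
    have : (uᴴ * A) ⊗ₖ ξ = u1ᴴ * (A ⊗ₖ ξ) := by
      rw [hu1H, ← mul_kronecker_mul, Matrix.one_mul]
    rw [hΦ, channel_apply, this, ← Matrix.mul_assoc, hUu', channel_apply, ← mul_partialTrace,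
      Matrix.smul_mul, Matrix.smul_mul, map_smul]
    simp only [Matrix.mul_assoc, hu1H]
  have hρdet := (isUnit_iff_isUnit_det _).1 hρd.isUnit
  -- Multiplication by `u` and by `uᴴ` shifts the dynamics by opposite phases, so `uᴴ u ρ` is a
  -- fixed point and hence a multiple of `ρ`. In particular `u` is invertible.
  have hscalar : uᴴ * u = (uᴴ * u * ρ).trace • (1 : Matrix S S ℂ) := by
    have hfix : Φ (uᴴ * u * ρ) = uᴴ * u * ρ := by
      rw [Matrix.mul_assoc, hΦu', hΦu, hρ.2, Matrix.mul_smul, smul_smul, mul_comm θ, hθθ, one_smul]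
    have := h.eq_smul_of_fixed hirr hρ hfix
    have h2 := congrArg (fun X => X * ρ⁻¹) this
    simp only [Matrix.smul_mul] at h2
    rwa [Matrix.mul_assoc (uᴴ * u) ρ, mul_nonsing_inv _ hρdet, Matrix.mul_one] at h2
  have huu : IsUnit u := by
    set c := (uᴴ * u * ρ).trace with hc
    have hc0 : c ≠ 0 := by
      intro h0
      rw [h0, zero_smul] at hscalar
      exact hu0 (conjTranspose_mul_self_eq_zero.1 hscalar)
    refine IsUnit.of_mul_eq_one_right (c⁻¹ • uᴴ) ?_
    rw [Matrix.smul_mul, hscalar, smul_smul, inv_mul_cancel₀ hc0, one_smul]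
  have hev : ∀ k : ℕ, Φ (u ^ k * ρ) = (star θ) ^ k • (u ^ k * ρ) := by
    intro k
    induction k with
    | zero => simp [hρ.2]
    | succ k ih => rw [pow_succ', Matrix.mul_assoc, hΦu, ih, Matrix.mul_smul, smul_smul, pow_succ']
  have hne : ∀ k : ℕ, u ^ k * ρ ≠ 0 := by
    intro k h0
    have hun : IsUnit (u ^ k * ρ) := (huu.pow k).mul hρd.isUnit
    have : Nonempty S := by
      by_contra hS
      rw [not_nonempty_iff] at hS
      exact hu0 (Matrix.ext fun i => (hS.false i).elim)
    rw [h0] at hun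
    exact not_isUnit_zero hun
  set N := Module.finrank ℂ (Matrix S S ℂ) with hN
  -- Each power of `star θ` is an eigenvalue, with eigenvector `u ^ k ρ`. Among the exponents `0, …,
  -- N` two must agree, since there are at most `N` distinct eigenvalues; the difference is between
  -- `1` and `N` and divides `N!`.
  obtain ⟨i, j, hij, hij'⟩ : ∃ i j : ℕ, i < j ∧ j ≤ N ∧ (star θ) ^ i = (star θ) ^ j := by
    by_contra hcon
    push Not at hcon
    have hinj : Function.Injective fun k : Fin (N + 1) => (star θ) ^ (k : ℕ) := by
      intro a b hab
      rcases lt_trichotomy a b with hlt | heq | hlt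
      · exact absurd hab (hcon a b hlt (by omega))
      · exact heq
      · exact absurd hab.symm (hcon b a hlt (by omega))
    have hli := Module.End.eigenvectors_linearIndependent' Φ _ hinj
      (fun k : Fin (N + 1) => u ^ (k : ℕ) * ρ) fun k =>
        ⟨Module.End.mem_eigenspace_iff.2 (hev k), hne k⟩
    have := hli.fintype_card_le_finrank
    rw [Fintype.card_fin] at this
    omega
  have hs0 : star θ ≠ 0 := by
    intro h0; rw [h0, zero_mul] at hθθ; exact zero_ne_one hθθ
  have h1 : (star θ) ^ (j - i) = 1 := by
    have : (star θ) ^ i * (star θ) ^ (j - i) = (star θ) ^ i * 1 := by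
      rw [← pow_add, Nat.add_sub_cancel' hij.le, mul_one]; exact hij'.2.symm
    exact mul_left_cancel₀ (pow_ne_zero _ hs0) this
  have h2 : θ ^ (j - i) = 1 := by
    have := congrArg star h1
    simpa using this
  obtain ⟨d, hd⟩ := Nat.dvd_factorial (show 0 < j - i by omega) (show j - i ≤ N by omega)
  rw [hd, pow_mul, h2, one_pow]

end Channel

end RIS

end

noncomputable section

namespace RIS

open Filter Set Matrix
open scoped Matrix.Norms.L2Operator

/-! ### Gibbs states, compactness of the set of states, invariant states -/

section States

variable {ι : Type*} [Fintype ι] [DecidableEq ι]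

theorem exp_smul_conj_diagonal {W : Matrix ι ι ℂ} (h1 : W * Wᴴ = 1) (c : ℂ) (a : ι → ℝ) :
    NormedSpace.exp (c • (W * diagonal (fun i => (a i : ℂ)) * Wᴴ)) =
      W * diagonal (fun i => Complex.exp (c * a i)) * Wᴴ := by
  have hW : Wᴴ = W⁻¹ := (inv_eq_right_inv h1).symm
  have hu : IsUnit W := IsUnit.of_mul_eq_one Wᴴ h1
  have e : c • (W * diagonal (fun i => (a i : ℂ)) * Wᴴ) =
      W * diagonal (fun i => c * a i) * W⁻¹ := by
    rw [← hW, ← Matrix.smul_mul, ← Matrix.mul_smul, ← diagonal_smul]; rfl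
  rw [e, exp_conj _ _ hu, exp_diagonal, ← hW]
  congr 3
  ext i
  rw [Pi.coe_exp, Complex.exp_eq_exp_ℂ]

theorem gibbs_spec [Nonempty ι] {h : Matrix ι ι ℂ} (hh : h.IsHermitian) (β : ℝ) :
    (gibbs β h).PosDef ∧ (gibbs β h).trace = 1 ∧
      ∃ c : ℝ, cfc Real.log (gibbs β h) = -(β : ℂ) • h - (c : ℂ) • 1 := by
  obtain ⟨W, a, h1, h2, eA, -⟩ := exists_diag hh
  set Z : ℝ := ∑ i, Real.exp (-β * a i) with hZ
  have hZ0 : 0 < Z := Finset.sum_pos (fun i _ => Real.exp_pos _) Finset.univ_nonempty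
  have hexp : NormedSpace.exp (-(β : ℂ) • h) =
      W * diagonal (fun i => ((Real.exp (-β * a i) : ℝ) : ℂ)) * Wᴴ := by
    rw [eA, exp_smul_conj_diagonal h1]
    congr 3; ext i; push_cast; rfl
  have htr : (NormedSpace.exp (-(β : ℂ) • h)).trace = (Z : ℂ) := by
    rw [hexp, trace_mul_comm, ← Matrix.mul_assoc, h2, Matrix.one_mul, trace_diagonal, hZ]
    push_cast; rfl
  have hg : gibbs β h = W * diagonal (fun i => ((Z⁻¹ * Real.exp (-β * a i) : ℝ) : ℂ)) * Wᴴ := by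
    rw [gibbs, htr, hexp, ← Matrix.smul_mul, ← Matrix.mul_smul, ← diagonal_smul]
    congr 3; ext i; simp
  refine ⟨?_, ?_, Real.log Z, ?_⟩
  · rw [hg]
    have : (diagonal (fun i => ((Z⁻¹ * Real.exp (-β * a i) : ℝ) : ℂ))).PosDef := by
      rw [posDef_diagonal_iff]
      intro i
      have : 0 < Z⁻¹ * Real.exp (-β * a i) := by positivity
      exact_mod_cast this
    have hu : IsUnit Wᴴ := IsUnit.of_mul_eq_one W h2
    have := (Matrix.IsUnit.posDef_star_left_conjugate_iff (x := diagonal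
      (fun i => ((Z⁻¹ * Real.exp (-β * a i) : ℝ) : ℂ))) hu).2 this
    simpa [star_eq_conjTranspose] using this
  · rw [gibbs, trace_smul, smul_eq_mul, inv_mul_cancel₀]
    rw [htr]; exact_mod_cast hZ0.ne'
  · rw [hg, cfc_conj_diagonal h1 h2, eA]
    have e1 : (1 : Matrix ι ι ℂ) = W * 1 * Wᴴ := by rw [Matrix.mul_one, h1]
    conv_rhs => rw [e1]
    rw [← Matrix.smul_mul, ← Matrix.mul_smul, ← Matrix.smul_mul, ← Matrix.mul_smul,
      ← Matrix.sub_mul, ← Matrix.mul_sub]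
    congr 2
    rw [← diagonal_smul, smul_one_eq_diagonal, diagonal_sub]
    congr 1
    ext i
    rw [Real.log_mul (inv_ne_zero hZ0.ne') (Real.exp_pos _).ne', Real.log_inv, Real.log_exp]
    simp only [Pi.smul_apply, smul_eq_mul]
    push_cast; ring

theorem isClosed_isState : IsClosed {ρ : Matrix ι ι ℂ | IsState ρ} := by
  have : {ρ : Matrix ι ι ℂ | IsState ρ} =
      {ρ | ρᴴ = ρ} ∩ (⋂ x : ι → ℂ, {ρ | 0 ≤ star x ⬝ᵥ ρ *ᵥ x}) ∩ {ρ | ρ.trace = 1} := by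
    ext ρ
    simp only [IsState, posSemidef_iff_dotProduct_mulVec, mem_inter_iff, mem_iInter,
      mem_ofPred_eq, IsHermitian]
  rw [this]
  refine IsClosed.inter (IsClosed.inter ?_ ?_) ?_
  · exact isClosed_eq (by fun_prop) continuous_id
  · refine isClosed_iInter fun x => ?_
    have hc : Continuous fun ρ : Matrix ι ι ℂ => star x ⬝ᵥ ρ *ᵥ x := by
      refine Continuous.dotProduct continuous_const ?_
      exact Continuous.matrix_mulVec continuous_id continuous_const
    exact isClosed_le continuous_const hc
  · exact isClosed_eq (Continuous.matrix_trace continuous_id) continuous_const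

/-- The square of the Hilbert-Schmidt norm. -/
def hsq (A : Matrix ι ι ℂ) : ℝ := ∑ i, ∑ j, ‖A i j‖ ^ 2

theorem hsq_nonneg (A : Matrix ι ι ℂ) : 0 ≤ hsq A := by unfold hsq; positivity

theorem trace_conjTranspose_mul_self_eq_hsq (A : Matrix ι ι ℂ) :
    (Aᴴ * A).trace = (hsq A : ℂ) := by
  rw [hsq, trace]
  simp only [diag_apply, mul_apply, conjTranspose_apply]
  rw [Finset.sum_comm]
  push_cast
  refine Finset.sum_congr rfl fun i _ => Finset.sum_congr rfl fun j _ => ?_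
  have := Complex.conj_mul' (A i j)
  simpa using this

theorem norm_entry_sq_le_hsq (A : Matrix ι ι ℂ) (i j : ι) : ‖A i j‖ ^ 2 ≤ hsq A := by
  have h1 : ‖A i j‖ ^ 2 ≤ ∑ j, ‖A i j‖ ^ 2 :=
    Finset.single_le_sum (f := fun j => ‖A i j‖ ^ 2) (fun j _ => by positivity) (Finset.mem_univ j)
  exact h1.trans (Finset.single_le_sum (f := fun i => ∑ j, ‖A i j‖ ^ 2)
    (fun j _ => by positivity) (Finset.mem_univ i))

theorem hsq_le_one_of_isState {ρ : Matrix ι ι ℂ} (hρ : IsState ρ) : hsq ρ ≤ 1 := by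
  obtain ⟨W, a, h1, h2, eA, -, ha, -, ht⟩ := exists_diag hρ.1.1
  have ha := ha hρ.1
  have ha1 := le_one_of_sum_eq_one ha (ht.symm.trans hρ.2)
  have hs : ∑ i, a i = 1 := by
    have := ht.symm.trans hρ.2
    exact_mod_cast this
  have e : ρᴴ * ρ = W * diagonal (fun i => ((a i * a i : ℝ) : ℂ)) * Wᴴ := by
    have := (conjDiag W h1 h2).map_mul a a
    simp only [conjDiag, RingHom.coe_mk, MonoidHom.coe_mk, OneHom.coe_mk,
      Pi.mul_apply] at this
    rw [hρ.1.1.eq, this, ← eA]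
  have h3 := trace_conjTranspose_mul_self_eq_hsq ρ
  rw [e, trace_mul_comm, ← Matrix.mul_assoc, h2, Matrix.one_mul, trace_diagonal] at h3
  have h4 : ∑ i, a i * a i = hsq ρ := by exact_mod_cast h3
  rw [← h4, ← hs]
  exact Finset.sum_le_sum fun i _ => mul_le_of_le_one_left (ha i) (ha1 i)

theorem isCompact_isState : IsCompact {ρ : Matrix ι ι ℂ | IsState ρ} := by
  have hK : IsCompact {A : ι → ι → ℂ | ∀ i ∈ (univ : Set ι),
      A i ∈ {B : ι → ℂ | ∀ j ∈ (univ : Set ι), B j ∈ Metric.closedBall (0 : ℂ) 1}} :=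
    isCompact_univ_pi fun _ => isCompact_univ_pi fun _ => isCompact_closedBall _ _
  refine IsCompact.of_isClosed_subset (s := {A : Matrix ι ι ℂ | ∀ i ∈ (univ : Set ι),
      A i ∈ {B : ι → ℂ | ∀ j ∈ (univ : Set ι), B j ∈ Metric.closedBall (0 : ℂ) 1}}) hK
    isClosed_isState fun ρ hρ i _ j _ => ?_
  rw [mem_closedBall_zero_iff]
  have h1 := (norm_entry_sq_le_hsq ρ i j).trans (hsq_le_one_of_isState hρ)
  nlinarith [norm_nonneg (ρ i j)]

theorem exists_norm_equiv_hsq : ∃ C : ℝ, 0 < C ∧ ∀ A : Matrix ι ι ℂ,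
    ‖A‖ ^ 2 ≤ C * hsq A ∧ hsq A ≤ C * ‖A‖ ^ 2 := by
  let e₀ : Matrix ι ι ℂ ≃ₗ[ℂ] EuclideanSpace ℂ (ι × ι) :=
    { toFun := fun A => WithLp.toLp 2 fun p => A p.1 p.2
      map_add' := fun A B => rfl
      map_smul' := fun c A => rfl
      invFun := fun x => of fun i j => x (i, j)
      left_inv := fun A => rfl
      right_inv := fun x => rfl }
  let e := e₀.toContinuousLinearEquiv
  have he : ∀ A, ‖e A‖ ^ 2 = hsq A := by
    intro A
    rw [EuclideanSpace.norm_sq_eq, hsq, Fintype.sum_prod_type]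
    rfl
  set C := ‖(e : Matrix ι ι ℂ →L[ℂ] EuclideanSpace ℂ (ι × ι))‖ ^ 2 +
    ‖(e.symm : EuclideanSpace ℂ (ι × ι) →L[ℂ] Matrix ι ι ℂ)‖ ^ 2 + 1 with hC
  refine ⟨C, by positivity, fun A => ⟨?_, ?_⟩⟩
  · have h1 : ‖A‖ ≤ ‖(e.symm : EuclideanSpace ℂ (ι × ι) →L[ℂ] Matrix ι ι ℂ)‖ * ‖e A‖ := by
      simpa using (e.symm : EuclideanSpace ℂ (ι × ι) →L[ℂ] Matrix ι ι ℂ).le_opNorm (e A)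
    have h2 := pow_le_pow_left₀ (norm_nonneg _) h1 2
    rw [mul_pow, he] at h2
    refine h2.trans (mul_le_mul_of_nonneg_right ?_ (hsq_nonneg A))
    rw [hC]; nlinarith [sq_nonneg ‖(e : Matrix ι ι ℂ →L[ℂ] EuclideanSpace ℂ (ι × ι))‖]
  · have h1 : ‖e A‖ ≤ ‖(e : Matrix ι ι ℂ →L[ℂ] EuclideanSpace ℂ (ι × ι))‖ * ‖A‖ :=
      (e : Matrix ι ι ℂ →L[ℂ] EuclideanSpace ℂ (ι × ι)).le_opNorm A
    have h2 := pow_le_pow_left₀ (norm_nonneg _) h1 2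
    rw [mul_pow, he] at h2
    refine h2.trans (mul_le_mul_of_nonneg_right ?_ (sq_nonneg _))
    rw [hC]; nlinarith [sq_nonneg ‖(e.symm : EuclideanSpace ℂ (ι × ι) →L[ℂ] Matrix ι ι ℂ)‖]

theorem exists_norm_isState_le : ∃ C : ℝ, ∀ ρ : Matrix ι ι ℂ, IsState ρ → ‖ρ‖ ≤ C :=
  isCompact_isState.isBounded.exists_norm_le

theorem exists_posSemidef_sub {H : Matrix ι ι ℂ} (hH : H.IsHermitian) :
    ∃ A B : Matrix ι ι ℂ, A.PosSemidef ∧ B.PosSemidef ∧ H = A - B := by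
  refine ⟨cfc (fun x : ℝ => max x 0) H, cfc (fun x : ℝ => max (-x) 0) H,
    posSemidef_cfc hH fun x => le_max_right _ _, posSemidef_cfc hH fun x => le_max_right _ _, ?_⟩
  obtain ⟨W, a, h1, h2, eA, hf, -⟩ := exists_diag hH
  rw [hf, hf, ← Matrix.sub_mul, ← Matrix.mul_sub, diagonal_sub]
  conv_lhs => rw [eA]
  congr 3
  ext i
  rw [← Complex.ofReal_sub]
  congr 1
  rcases le_total (a i) 0 with h | h
  · rw [max_eq_right h, max_eq_left (by linarith)]; ring
  · rw [max_eq_left h, max_eq_right (by linarith)]; ring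

theorem span_posSemidef : Submodule.span ℂ {A : Matrix ι ι ℂ | A.PosSemidef} = ⊤ := by
  rw [eq_top_iff]
  have hherm : ∀ H : Matrix ι ι ℂ, H.IsHermitian →
      H ∈ Submodule.span ℂ {A : Matrix ι ι ℂ | A.PosSemidef} := by
    intro H hH
    obtain ⟨A, B, hA, hB, rfl⟩ := exists_posSemidef_sub hH
    exact Submodule.sub_mem _ (Submodule.subset_span hA) (Submodule.subset_span hB)
  intro A _
  have h1 := hherm (A + Aᴴ) (by rw [IsHermitian, conjTranspose_add, conjTranspose_conjTranspose,
    add_comm])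
  have h2 := hherm (Complex.I • (A - Aᴴ)) (by
    rw [IsHermitian, conjTranspose_smul, conjTranspose_sub, conjTranspose_conjTranspose,
      ← neg_sub A, smul_neg, ← neg_smul]
    simp)
  have e : A = (2 : ℂ)⁻¹ • (A + Aᴴ) + (-(2 : ℂ)⁻¹ * Complex.I) • (Complex.I • (A - Aᴴ)) := by
    rw [smul_smul, mul_assoc, Complex.I_mul_I]
    ext i j
    simp only [Matrix.add_apply, Matrix.smul_apply, Matrix.sub_apply, smul_eq_mul]
    ring
  rw [e]
  exact Submodule.add_mem _ (Submodule.smul_mem _ _ h1) (Submodule.smul_mem _ _ h2)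

/-- Maps that preserve the set of states are uniformly bounded. -/
theorem exists_norm_le_of_states : ∃ B : ℝ, ∀ Φ : Matrix ι ι ℂ →L[ℂ] Matrix ι ι ℂ,
    (∀ ρ, IsState ρ → IsState (Φ ρ)) → ‖Φ‖ ≤ B := by
  obtain ⟨C₀, hC₀⟩ := exists_norm_isState_le (ι := ι)
  have key : ∃ B, ∀ Φ : {Φ : Matrix ι ι ℂ →L[ℂ] Matrix ι ι ℂ // ∀ ρ, IsState ρ → IsState (Φ ρ)},
      ‖(Φ : Matrix ι ι ℂ →L[ℂ] Matrix ι ι ℂ)‖ ≤ B := by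
    -- Pointwise bounds suffice: they hold on states by compactness, hence on nonnegative operators
    -- by scaling, hence on their span, which is everything.
    refine banach_steinhaus fun A => ?_
    have hA : A ∈ Submodule.span ℂ {A : Matrix ι ι ℂ | A.PosSemidef} := by
      rw [span_posSemidef]; trivial
    induction hA using Submodule.span_induction with
    | mem A hA =>
      by_cases h0 : A.trace = 0
      · refine ⟨0, fun Φ => ?_⟩
        rw [(PosSemidef.trace_eq_zero_iff hA).1 h0]; simp
      · have hst : IsState (A.trace⁻¹ • A) :=
          ⟨hA.smul (by simpa using hA.trace_nonneg), by
            rw [trace_smul, smul_eq_mul, inv_mul_cancel₀ h0]⟩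
        refine ⟨‖A.trace‖ * C₀, fun Φ => ?_⟩
        have e : A = A.trace • (A.trace⁻¹ • A) := by rw [smul_smul, mul_inv_cancel₀ h0, one_smul]
        conv_lhs => rw [e, map_smul, norm_smul]
        exact mul_le_mul_of_nonneg_left (hC₀ _ (Φ.2 _ hst)) (norm_nonneg _)
    | zero => exact ⟨0, fun Φ => by simp⟩
    | add x y _ _ hx hy =>
      obtain ⟨C, hC⟩ := hx
      obtain ⟨C', hC'⟩ := hy
      exact ⟨C + C', fun Φ => by
        rw [map_add]; exact (norm_add_le _ _).trans (add_le_add (hC Φ) (hC' Φ))⟩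
    | smul c x _ hx =>
      obtain ⟨C, hC⟩ := hx
      exact ⟨‖c‖ * C, fun Φ => by
        rw [map_smul, norm_smul]; exact mul_le_mul_of_nonneg_left (hC Φ) (norm_nonneg _)⟩
  obtain ⟨B, hB⟩ := key
  exact ⟨B, fun Φ hΦ => hB ⟨Φ, hΦ⟩⟩

theorem isState_average {n : ℕ} (hn : 0 < n) {ρ : ℕ → Matrix ι ι ℂ}
    (hρ : ∀ k < n, IsState (ρ k)) : IsState ((n : ℂ)⁻¹ • ∑ k ∈ Finset.range n, ρ k) := by
  refine ⟨(posSemidef_sum _ fun k hk => (hρ k (Finset.mem_range.1 hk)).1).smul ?_, ?_⟩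
  · have : (0 : ℂ) ≤ ((n : ℝ)⁻¹ : ℝ) := Complex.zero_le_real.2 (by positivity)
    simpa using this
  · rw [trace_smul, trace_sum, Finset.sum_congr rfl fun k hk => (hρ k (Finset.mem_range.1 hk)).2]
    simp [hn.ne']

theorem exists_isState [Nonempty ι] : ∃ ρ : Matrix ι ι ℂ, IsState ρ := by
  refine ⟨(Fintype.card ι : ℂ)⁻¹ • 1, PosSemidef.one.smul ?_, ?_⟩
  · have : (0 : ℂ) ≤ ((Fintype.card ι : ℝ)⁻¹ : ℝ) := Complex.zero_le_real.2 (by positivity)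
    simpa using this
  · simp

/-- Markov-Kakutani argument: `Φ` moves the Cesàro means of an orbit by `O(1 / n)`, so every limit
point of the means is fixed; one exists by compactness. -/
theorem exists_invariantState [Nonempty ι] {Φ : Module.End ℂ (Matrix ι ι ℂ)}
    (hΦ : ∀ ρ, IsState ρ → IsState (Φ ρ)) : ∃ ρ, IsInvariantState Φ ρ := by
  obtain ⟨ρ₀, hρ₀⟩ := exists_isState (ι := ι)
  obtain ⟨C, hC⟩ := exists_norm_isState_le (ι := ι)
  have hit : ∀ k : ℕ, IsState ((Φ ^ k) ρ₀) := by
    intro k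
    induction k with
    | zero => simpa using hρ₀
    | succ k ih => rw [pow_succ']; exact hΦ _ ih
  set A : ℕ → Matrix ι ι ℂ := fun n => ((n + 1 : ℕ) : ℂ)⁻¹ • ∑ k ∈ Finset.range (n + 1), (Φ ^ k) ρ₀
    with hA
  have hAs : ∀ n, IsState (A n) := fun n => isState_average n.succ_pos fun k _ => hit k
  obtain ⟨ρ, hρ, φ, hφ, hlim⟩ := isCompact_isState.tendsto_subseq hAs
  refine ⟨ρ, hρ, ?_⟩
  have hcont : Continuous Φ := LinearMap.continuous_of_finiteDimensional Φ
  have h1 : Tendsto (fun n => Φ (A (φ n)) - A (φ n)) atTop (𝓝 (Φ ρ - ρ)) :=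
    ((hcont.tendsto ρ).comp hlim).sub hlim
  have h2 : ∀ n, Φ (A n) - A n = ((n + 1 : ℕ) : ℂ)⁻¹ • ((Φ ^ (n + 1)) ρ₀ - ρ₀) := by
    intro n
    rw [hA]
    simp only [map_smul, map_sum, ← smul_sub]
    rw [← Finset.sum_sub_distrib]
    have := Finset.sum_range_sub (fun k => (Φ ^ k) ρ₀) (n + 1)
    simp only [pow_zero, Module.End.one_apply] at this
    rw [← this]
    refine congrArg _ (Finset.sum_congr rfl fun k _ => ?_)
    rw [pow_succ']; rfl
  have h3 : Tendsto (fun n => Φ (A n) - A n) atTop (𝓝 0) := by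
    have h4 : Tendsto (fun n : ℕ => (((n + 1 : ℕ) : ℝ))⁻¹ * (C + C)) atTop (𝓝 0) := by
      have := (tendsto_inv_atTop_zero.comp
        (tendsto_natCast_atTop_atTop.comp (tendsto_add_atTop_nat 1))).mul_const (C + C)
      simpa using this
    refine squeeze_zero_norm (fun n => ?_) h4
    rw [h2, norm_smul, norm_inv, Complex.norm_natCast]
    refine mul_le_mul_of_nonneg_left ?_ (by positivity)
    exact (norm_sub_le _ _).trans (add_le_add (hC _ (hit _)) (hC _ hρ₀))
  have h5 := tendsto_nhds_unique h1 (h3.comp hφ.tendsto_atTop)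
  exact sub_eq_zero.1 h5

end States

/-! ### The unitary and the probe state of a repeated interaction system -/

section Dilation

variable {S E : Type*} [Fintype S] [DecidableEq S] [Fintype E] [DecidableEq E]

theorem exp_skew_unitary {H : Matrix S S ℂ} (hH : H.IsHermitian) (t : ℝ) :
    let U := NormedSpace.exp ((-(Complex.I * (t : ℂ))) • H)
    U * Uᴴ = 1 ∧ Uᴴ * U = 1 := by
  intro U
  have hU : Uᴴ = U⁻¹ := by
    rw [← exp_conjTranspose, ← exp_neg, conjTranspose_smul, hH.eq, ← neg_smul]
    congr 2
    simp
  have hu : IsUnit U := isUnit_exp _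
  have hd := (isUnit_iff_isUnit_det _).1 hu
  rw [hU]
  exact ⟨mul_nonsing_inv _ hd, nonsing_inv_mul _ hd⟩

theorem ADRIS.isDilation [Nonempty E] (R : ADRIS S E) {s : ℝ} (hs : s ∈ Icc (0 : ℝ) 1) :
    IsDilation (R.U s) (R.ξ s) := by
  have hH : (R.hS ⊗ₖ (1 : Matrix E E ℂ) + (1 : Matrix S S ℂ) ⊗ₖ R.hE s +
      (R.coupling : ℂ) • R.v s).IsHermitian := by
    rw [IsHermitian, conjTranspose_add, conjTranspose_add, conjTranspose_kronecker,
      conjTranspose_kronecker, conjTranspose_smul, R.hS_herm.eq, (R.hE_herm s hs).eq,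
      (R.v_herm s hs).eq]
    simp
  obtain ⟨h1, h2⟩ := exp_skew_unitary hH R.τ
  obtain ⟨h3, h4, -⟩ := gibbs_spec (R.hE_herm s hs) (R.β s)
  exact ⟨h1, h2, h3, h4⟩

theorem IsDilation.existsUnique_invariantState [Nonempty S] {U : Matrix (S × E) (S × E) ℂ}
    {ξ : Matrix E E ℂ} (h : IsDilation U ξ) (hirr : IsIrreducible (channel U ξ)) :
    ∃! ρ, IsInvariantState (channel U ξ) ρ := by
  obtain ⟨ρ, hρ⟩ := exists_invariantState (Φ := channel U ξ) fun _ => h.isState_channel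
  refine ⟨ρ, hρ, fun ρ' hρ' => ?_⟩
  rw [h.eq_smul_of_fixed hirr hρ hρ'.2, hρ'.1.2, one_smul]

end Dilation

end RIS

end

noncomputable section

namespace RIS

open Filter Set Matrix
open scoped Matrix.Norms.L2Operator

/-! ### Entropy balance of one interaction -/

section Entropy

variable {ι : Type*} [Fintype ι] [DecidableEq ι]

/-- The opposite `Tr ρ log ρ` of the von Neumann entropy. -/
def negEntropy (ρ : Matrix ι ι ℂ) : ℝ := (ρ * cfc Real.log ρ).trace.re

theorem mul_cfc {ρ : Matrix ι ι ℂ} (hρ : ρ.IsHermitian) (f : ℝ → ℝ) :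
    ρ * cfc f ρ = cfc (fun x => x * f x) ρ := by
  obtain ⟨W, a, h1, h2, eA, hf, -⟩ := exists_diag hρ
  have := (conjDiag W h1 h2).map_mul a fun i => f (a i)
  simp only [conjDiag, RingHom.coe_mk, MonoidHom.coe_mk, OneHom.coe_mk,
    Pi.mul_apply] at this
  rw [← eA, ← hf] at this
  rw [← this, hf]

/-- The logarithm is discontinuous at `0`, so the product has to be read as the functional calculus
of the continuous function `x log x`. -/
theorem continuousOn_negEntropy : ContinuousOn negEntropy {ρ : Matrix ι ι ℂ | IsState ρ} := by
  obtain ⟨C, hC⟩ := exists_norm_isState_le (ι := ι)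
  have h1 : ContinuousOn (cfc (fun x : ℝ => x * Real.log x)) {ρ : Matrix ι ι ℂ | IsState ρ} := by
    refine (continuousOn_cfc (Matrix ι ι ℂ)
      (isCompact_closedBall (0 : ℝ) (C * ‖(1 : Matrix ι ι ℂ)‖))
      (fun x : ℝ => x * Real.log x) Real.continuous_mul_log.continuousOn).mono ?_
    intro ρ hρ
    refine ⟨hρ.1.1.isSelfAdjoint, (spectrum.subset_closedBall_norm_mul ρ).trans ?_⟩
    exact Metric.closedBall_subset_closedBall
      (mul_le_mul_of_nonneg_right (hC _ hρ) (norm_nonneg _))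
  refine ContinuousOn.congr (f := fun ρ => (cfc (fun x : ℝ => x * Real.log x) ρ).trace.re) ?_ ?_
  · refine Complex.continuous_re.comp_continuousOn ?_
    exact (Continuous.matrix_trace continuous_id).comp_continuousOn h1
  · intro ρ hρ
    rw [negEntropy, mul_cfc hρ.1.1]

/-- Continuous functions on the compact set of states do not separate asymptotically equal
sequences. -/
theorem tendsto_sub_of_continuousOn_isState {f : Matrix ι ι ℂ → ℝ}
    (hf : ContinuousOn f {ρ | IsState ρ}) {x y : ℕ → Matrix ι ι ℂ} (hx : ∀ n, IsState (x n))
    (hy : ∀ n, IsState (y n)) (hxy : Tendsto (fun n => x n - y n) atTop (𝓝 0)) :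
    Tendsto (fun n => f (x n) - f (y n)) atTop (𝓝 0) := by
  have hu := isCompact_isState.uniformContinuousOn_of_continuous hf
  rw [Metric.uniformContinuousOn_iff] at hu
  rw [Metric.tendsto_atTop] at hxy ⊢
  intro ε hε
  obtain ⟨δ, hδ, h⟩ := hu ε hε
  obtain ⟨N, hN⟩ := hxy δ hδ
  refine ⟨N, fun n hn => ?_⟩
  have := h (x n) (hx n) (y n) (hy n) (by
    have := hN n hn
    rwa [dist_zero_right, ← dist_eq_norm] at this)
  rwa [dist_zero_right, ← dist_eq_norm]

variable {S E : Type*} [Fintype S] [DecidableEq S] [Fintype E] [DecidableEq E]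
variable {U : Matrix (S × E) (S × E) ℂ} {ξ : Matrix E E ℂ}

/-- A state lives on the support of its marginal: the trace of this product of nonnegative operators
is the trace of the marginal against its own kernel projection. -/
theorem IsDilation.mul_indZero_channel (h : IsDilation U ξ) {ρ : Matrix S S ℂ}
    (hρ : ρ.PosSemidef) :
    U * (ρ ⊗ₖ ξ) * Uᴴ * (cfc indZero (channel U ξ ρ) ⊗ₖ (1 : Matrix E E ℂ)) = 0 := by
  have hc := h.posSemidef_channel hρ
  refine mul_eq_zero_of_trace (h.posSemidef_dilate hρ) (PosSemidef.kronecker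
    (posSemidef_cfc hc.1 fun x => by unfold indZero; split_ifs <;> norm_num) PosSemidef.one) ?_
  rw [← trace_partialTrace, partialTrace_mul, ← channel_apply, mul_indZero hc.1, trace_zero]

theorem IsDilation.isState_kronecker (h : IsDilation U ξ) {ρ : Matrix S S ℂ}
    (hρ : IsState ρ) : IsState (ρ ⊗ₖ ξ) :=
  ⟨hρ.1.kronecker h.posDef.posSemidef, by rw [trace_kronecker, hρ.2, h.trace_one, one_mul]⟩

theorem trace_sq_of_isHermitian {A : Matrix ι ι ℂ} (hA : A.IsHermitian) :
    (A * A).trace.re = hsq A := by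
  have := trace_conjTranspose_mul_self_eq_hsq A
  rw [hA.eq] at this
  rw [this, Complex.ofReal_re]

theorem IsDilation.hsq_le_relEntropy (h : IsDilation U ξ) {ρ : Matrix S S ℂ} (hρ : IsState ρ) :
    hsq (U * (ρ ⊗ₖ ξ) * Uᴴ - channel U ξ ρ ⊗ₖ ξ) / 2 ≤
      relEntropy (U * (ρ ⊗ₖ ξ) * Uᴴ) (channel U ξ ρ ⊗ₖ ξ) := by
  have h1 := h.isState_dilate hρ
  have h2 := h.isState_kronecker (h.isState_channel hρ)
  rw [← trace_sq_of_isHermitian (h1.1.1.sub h2.1.1)]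
  refine half_sq_le_relEntropy h1 h2 ?_
  rw [indZero_kronecker (h.posSemidef_channel hρ.1) h.posDef, h.mul_indZero_channel hρ.1]

/-- Conjugation by `U` preserves `Tr η log η`, and both logarithms of products split. The kernel
corrections disappear, one because `ρ` annihilates its kernel projection, the other because the
dilated state is supported on the support of its marginal. -/
theorem IsDilation.relEntropy_eq (h : IsDilation U ξ) {ρ : Matrix S S ℂ} (hρ : IsState ρ) :
    relEntropy (U * (ρ ⊗ₖ ξ) * Uᴴ) (channel U ξ ρ ⊗ₖ ξ) =
      negEntropy ρ - negEntropy (channel U ξ ρ) -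
        ((U * (ρ ⊗ₖ ξ) * Uᴴ - ρ ⊗ₖ ξ) * ((1 : Matrix S S ℂ) ⊗ₖ cfc Real.log ξ)).trace.re := by
  have hc := h.posSemidef_channel hρ.1
  set η := U * (ρ ⊗ₖ ξ) * Uᴴ with hη
  set ρ' := channel U ξ ρ with hρ'
  have h1 : (η * cfc Real.log η).trace =
      (ρ * cfc Real.log ρ).trace + ((ρ ⊗ₖ ξ) * ((1 : Matrix S S ℂ) ⊗ₖ cfc Real.log ξ)).trace := by
    rw [hη, cfc_unitary_conj h.mul_conj h.conj_mul (hρ.1.kronecker h.posDef.posSemidef).1]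
    have : U * (ρ ⊗ₖ ξ) * Uᴴ * (U * cfc Real.log (ρ ⊗ₖ ξ) * Uᴴ) =
        U * ((ρ ⊗ₖ ξ) * cfc Real.log (ρ ⊗ₖ ξ)) * Uᴴ := by
      calc _ = U * (ρ ⊗ₖ ξ) * (Uᴴ * U) * cfc Real.log (ρ ⊗ₖ ξ) * Uᴴ := by
            simp only [Matrix.mul_assoc]
        _ = _ := by rw [h.conj_mul]; simp only [Matrix.mul_assoc, Matrix.one_mul]
    rw [this, trace_mul_comm, ← Matrix.mul_assoc, h.conj_mul, Matrix.one_mul,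
      log_kronecker hρ.1 h.posDef, Matrix.mul_add, ← mul_kronecker_mul, ← mul_kronecker_mul,
      Matrix.mul_sub, mul_indZero hρ.1.1, sub_zero, trace_add, Matrix.mul_one, Matrix.mul_one,
      trace_kronecker, h.trace_one, mul_one, ← mul_kronecker_mul, Matrix.mul_one]
  have h2 : (η * cfc Real.log (ρ' ⊗ₖ ξ)).trace =
      (ρ' * cfc Real.log ρ').trace + (η * ((1 : Matrix S S ℂ) ⊗ₖ cfc Real.log ξ)).trace := by
    have e : (1 - cfc indZero ρ') ⊗ₖ cfc Real.log ξ = (1 : Matrix S S ℂ) ⊗ₖ cfc Real.log ξ -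
        (cfc indZero ρ' ⊗ₖ (1 : Matrix E E ℂ)) * ((1 : Matrix S S ℂ) ⊗ₖ cfc Real.log ξ) := by
      rw [← mul_kronecker_mul, Matrix.mul_one, Matrix.one_mul, eq_sub_iff_add_eq, ← add_kronecker,
        sub_add_cancel]
    rw [log_kronecker hc h.posDef, e, Matrix.mul_add, Matrix.mul_sub, ← Matrix.mul_assoc η,
      h.mul_indZero_channel hρ.1, Matrix.zero_mul, sub_zero, trace_add,
      ← trace_partialTrace (η * (cfc Real.log ρ' ⊗ₖ 1)), partialTrace_mul]
    rfl
  rw [relEntropy, Matrix.mul_sub, trace_sub, h1, h2, negEntropy, negEntropy, Matrix.sub_mul,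
    trace_sub]
  simp only [Complex.add_re, Complex.sub_re]
  ring

/-- Energy times inverse temperature that an interaction transfers into the probe. -/
def ADRIS.flux (R : ADRIS S E) (s : ℝ) : Matrix S S ℂ →ₗ[ℂ] ℂ where
  toFun A := (R.β s : ℂ) * ((R.U s * (A ⊗ₖ R.ξ s) * (R.U s)ᴴ - A ⊗ₖ R.ξ s) *
    ((1 : Matrix S S ℂ) ⊗ₖ R.hE s)).trace
  map_add' A B := by
    simp only [add_kronecker, Matrix.mul_add, Matrix.add_mul, Matrix.sub_mul, trace_add, trace_sub]
    ring
  map_smul' c A := by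
    simp only [smul_kronecker, Matrix.mul_smul, Matrix.smul_mul, Matrix.sub_mul, trace_smul,
      trace_sub, smul_eq_mul, RingHom.id_apply]
    ring

/-- The logarithm of a Gibbs state is `-β h` minus a constant, and the constant is paired with a
traceless operator. -/
theorem ADRIS.flux_eq [Nonempty E] (R : ADRIS S E) {s : ℝ} (hs : s ∈ Icc (0 : ℝ) 1)
    (A : Matrix S S ℂ) : R.flux s A = -((R.U s * (A ⊗ₖ R.ξ s) * (R.U s)ᴴ - A ⊗ₖ R.ξ s) *
        ((1 : Matrix S S ℂ) ⊗ₖ cfc Real.log (R.ξ s))).trace := by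
  obtain ⟨-, -, c, hc⟩ := gibbs_spec (R.hE_herm s hs) (R.β s)
  have h := R.isDilation hs
  have e : (1 : Matrix S S ℂ) ⊗ₖ cfc Real.log (R.ξ s) =
      -(R.β s : ℂ) • ((1 : Matrix S S ℂ) ⊗ₖ R.hE s) - (c : ℂ) • 1 := by
    rw [show R.ξ s = gibbs (R.β s) (R.hE s) from rfl, hc, eq_sub_iff_add_eq, ← kronecker_smul,
      ← one_kronecker_one (α := ℂ) (m := S) (n := E), ← kronecker_smul, ← kronecker_add,
      sub_add_cancel]
  have ht : (R.U s * (A ⊗ₖ R.ξ s) * (R.U s)ᴴ - A ⊗ₖ R.ξ s).trace = 0 := by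
    rw [trace_sub, trace_mul_comm, ← Matrix.mul_assoc, h.conj_mul, Matrix.one_mul, sub_self]
  rw [e, Matrix.mul_sub, trace_sub, Matrix.mul_smul, Matrix.mul_smul, Matrix.mul_one, trace_smul,
    trace_smul, ht]
  simp [ADRIS.flux]

/-- Entropy balance of one interaction. -/
theorem ADRIS.relEntropy_eq_flux [Nonempty E] (R : ADRIS S E) {s : ℝ} (hs : s ∈ Icc (0 : ℝ) 1)
    {ρ : Matrix S S ℂ} (hρ : IsState ρ) :
    relEntropy (R.U s * (ρ ⊗ₖ R.ξ s) * (R.U s)ᴴ) (R.L s ρ ⊗ₖ R.ξ s) =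
      negEntropy ρ - negEntropy (R.L s ρ) + (R.flux s ρ).re := by
  rw [R.flux_eq hs, Complex.neg_re, ← sub_eq_add_neg]
  exact (R.isDilation hs).relEntropy_eq hρ

/-- When the invariant state does not correlate with the probe, the flux is a difference. -/
theorem ADRIS.flux_eq_of_commute [Nonempty E] (R : ADRIS S E) {s : ℝ} (hs : s ∈ Icc (0 : ℝ) 1)
    {ρ : Matrix S S ℂ} (hρ : ρ.PosDef)
    (hX : R.U s * (ρ ⊗ₖ R.ξ s) * (R.U s)ᴴ = ρ ⊗ₖ R.ξ s) (A : Matrix S S ℂ) :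
    R.flux s A = (R.L s A * cfc Real.log ρ).trace - (A * cfc Real.log ρ).trace := by
  have h := R.isDilation hs
  set U := R.U s
  set ξ := R.ξ s
  set Λ := cfc Real.log (ρ ⊗ₖ ξ) with hΛ
  have hΛe : Λ = cfc Real.log ρ ⊗ₖ (1 : Matrix E E ℂ) + (1 : Matrix S S ℂ) ⊗ₖ cfc Real.log ξ := by
    rw [hΛ, log_kronecker hρ.posSemidef h.posDef, indZero_of_posDef hρ, sub_zero]
  -- Since `U` fixes `ρ ⊗ ξ`, it fixes its logarithm: `log ρ ⊗ 1 + 1 ⊗ log ξ` is conserved, and what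
  -- the probe gains the system loses.
  have hcomm : U * Λ * Uᴴ = Λ := by
    rw [hΛ, ← cfc_unitary_conj h.mul_conj h.conj_mul (hρ.posSemidef.kronecker
      h.posDef.posSemidef).1, hX]
  have h1 : (U * (A ⊗ₖ ξ) * Uᴴ * Λ).trace = ((A ⊗ₖ ξ) * Λ).trace := by
    have h2 : Uᴴ * Λ * U = Λ := by
      calc Uᴴ * Λ * U = Uᴴ * (U * Λ * Uᴴ) * U := by rw [hcomm]
        _ = (Uᴴ * U) * Λ * (Uᴴ * U) := by simp only [Matrix.mul_assoc]
        _ = Λ := by rw [h.conj_mul]; simp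
    rw [Matrix.mul_assoc, Matrix.mul_assoc, trace_mul_comm]
    conv_rhs => rw [← h2]
    simp only [Matrix.mul_assoc]
  have h3 : (U * (A ⊗ₖ ξ) * Uᴴ * (cfc Real.log ρ ⊗ₖ (1 : Matrix E E ℂ))).trace =
      (R.L s A * cfc Real.log ρ).trace := by
    rw [← trace_partialTrace, partialTrace_mul]; rfl
  have h4 : ((A ⊗ₖ ξ) * (cfc Real.log ρ ⊗ₖ (1 : Matrix E E ℂ))).trace =
      (A * cfc Real.log ρ).trace := by
    rw [← mul_kronecker_mul, trace_kronecker, Matrix.mul_one, h.trace_one, mul_one]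
  rw [hΛe, Matrix.mul_add, Matrix.mul_add, trace_add, trace_add, h3, h4] at h1
  rw [R.flux_eq hs, Matrix.sub_mul, trace_sub]
  linear_combination -h1

end Entropy

end RIS

end

noncomputable section

namespace RIS

open Filter Set Matrix
open scoped Matrix.Norms.L2Operator

/-! ### Regularity of the reduced dynamics -/

section Regularity

variable {F : Type*} [NormedAddCommGroup F] [NormedSpace ℝ F]

theorem exists_lip_of_contDiffOn_one {f : ℝ → F} (hf : ContDiffOn ℝ 1 f (Icc 0 1)) :
    ∃ C : ℝ, ∀ x ∈ Icc (0 : ℝ) 1, ∀ y ∈ Icc (0 : ℝ) 1, ‖f x - f y‖ ≤ C * |x - y| := by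
  have hu := uniqueDiffOn_Icc (zero_lt_one (α := ℝ))
  obtain ⟨hd, hc⟩ := (contDiffOn_one_iff_derivWithin hu).1 hf
  obtain ⟨C, hC⟩ := isCompact_Icc.exists_bound_of_continuousOn hc
  exact ⟨C, fun x hx y hy =>
    Convex.norm_image_sub_le_of_norm_derivWithin_le hd hC (convex_Icc 0 1) hy hx⟩

/-- The second difference is the increment over `t ∈ [0,1]` of `f (x + (1 + t) h) - f (x + t h)`,
whose derivative in `t` is `h` times an increment of `f'` over the distance `h`. -/
theorem twiceLip_of_contDiffOn {f : ℝ → F} (hf : ContDiffOn ℝ 2 f (Icc 0 1)) : TwiceLip f := by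
  have hu := uniqueDiffOn_Icc (zero_lt_one (α := ℝ))
  have h2 : ContDiffOn ℝ (1 + 1) f (Icc 0 1) := by simpa [one_add_one_eq_two] using hf
  obtain ⟨hd, -, hd'⟩ := (contDiffOn_succ_iff_derivWithin hu).1 h2
  obtain ⟨C₁, hC₁⟩ := exists_lip_of_contDiffOn_one (hf.of_le one_le_two)
  obtain ⟨C₂, hC₂⟩ := exists_lip_of_contDiffOn_one hd'
  obtain ⟨C₀, hC₀⟩ := isCompact_Icc.exists_bound_of_continuousOn hf.continuousOn
  refine ⟨?_, ?_, ?_⟩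
  · exact Asymptotics.IsBigO.of_bound C₀ (eventually_principal.2 fun x hx => by simpa using hC₀ x hx)
  · exact Asymptotics.IsBigO.of_bound C₁ (eventually_principal.2 fun p hp => by
      simpa using hC₁ p.1 hp.1 p.2 hp.2)
  · refine Asymptotics.IsBigO.of_bound C₂ (eventually_principal.2 fun p hp => ?_)
    obtain ⟨x, h⟩ := p
    obtain ⟨⟨hx0, hx1⟩, ⟨hy0, hy1⟩⟩ := hp
    simp only at hx0 hx1 hy0 hy1 ⊢
    have hm0 : ∀ t ∈ Icc (0 : ℝ) 1, x + t * h ∈ Icc (0 : ℝ) 1 := by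
      rintro t ⟨ht0, ht1⟩
      constructor <;> nlinarith
    have hm1 : ∀ t ∈ Icc (0 : ℝ) 1, x + (1 + t) * h ∈ Icc (0 : ℝ) 1 := by
      rintro t ⟨ht0, ht1⟩
      constructor <;> nlinarith
    have hder : ∀ t ∈ Icc (0 : ℝ) 1, HasDerivWithinAt
        (fun t => f (x + (1 + t) * h) - f (x + t * h))
        (h • derivWithin f (Icc 0 1) (x + (1 + t) * h) - h • derivWithin f (Icc 0 1) (x + t * h))
        (Icc 0 1) t := by
      intro t ht
      have e1 : HasDerivWithinAt (fun t : ℝ => x + (1 + t) * h) h (Icc 0 1) t := by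
        simpa using (((hasDerivWithinAt_id t (Icc (0 : ℝ) 1)).const_add 1).mul_const h).const_add x
      have e0 : HasDerivWithinAt (fun t : ℝ => x + t * h) h (Icc 0 1) t := by
        simpa using ((hasDerivWithinAt_id t (Icc (0 : ℝ) 1)).mul_const h).const_add x
      exact ((hd _ (hm1 t ht)).hasDerivWithinAt.scomp t e1 hm1).sub
        ((hd _ (hm0 t ht)).hasDerivWithinAt.scomp t e0 hm0)
    have := norm_image_sub_le_of_norm_deriv_le_segment_01' (C := C₂ * ‖h ^ 2‖) hder (by
      intro t ht
      have ht' : t ∈ Icc (0 : ℝ) 1 := ⟨ht.1, ht.2.le⟩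
      rw [← smul_sub, norm_smul]
      have e := hC₂ _ (hm1 t ht') _ (hm0 t ht')
      rw [show x + (1 + t) * h - (x + t * h) = h by ring] at e
      calc ‖h‖ * _ ≤ ‖h‖ * (C₂ * |h|) := mul_le_mul_of_nonneg_left e (norm_nonneg _)
        _ = C₂ * ‖h ^ 2‖ := by rw [norm_pow, Real.norm_eq_abs]; ring)
    convert this using 2
    rw [show x + (1 + 1) * h = x + 2 * h by ring]
    simp

variable {V W : Type*} [NormedAddCommGroup V] [NormedSpace ℂ V] [FiniteDimensional ℂ V]
  [NormedAddCommGroup W] [NormedSpace ℂ W]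

theorem contDiffOn_linearMap_comp (f : V →ₗ[ℂ] W) {g : ℝ → V} {t : Set ℝ} {n : WithTop ℕ∞}
    (hg : ContDiffOn ℝ n g t) : ContDiffOn ℝ n (fun s => f (g s)) t :=
  ((LinearMap.toContinuousLinearMap f).restrictScalars ℝ).contDiff.comp_contDiffOn hg

variable {S E : Type*} [Fintype S] [DecidableEq S] [Fintype E] [DecidableEq E]

theorem contDiffOn_matrix {A : ℝ → Matrix S S ℂ} {t : Set ℝ} {n : WithTop ℕ∞}
    (hA : ∀ i j, ContDiffOn ℝ n (fun s => A s i j) t) : ContDiffOn ℝ n A t := by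
  have e : A = fun s => ∑ i, ∑ j, A s i j • single i j (1 : ℂ) := by
    ext1 s
    conv_lhs => rw [matrix_eq_sum_single (A s)]
    simp
  rw [e]
  exact ContDiffOn.sum fun i _ => ContDiffOn.sum fun j _ =>
    contDiffOn_linearMap_comp (LinearMap.toSpanSingleton ℂ _ (single i j (1 : ℂ))) (hA i j)

/-- The operator is recovered by a fixed linear map from its finitely many values on matrix units.
-/
theorem twiceLip_of_apply {Φ : ℝ → Matrix S S ℂ →L[ℂ] W}
    (h : ∀ A, TwiceLip fun s => Φ s A) : TwiceLip Φ := by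
  let entry : S → S → Matrix S S ℂ →L[ℂ] ℂ := fun i j =>
    LinearMap.toContinuousLinearMap (entryLinearMap ℂ ℂ i j)
  have e : ∀ s, ∑ i, ∑ j, ((ContinuousLinearMap.smulRightL ℂ (Matrix S S ℂ) W
      (entry i j)).restrictScalars ℝ) (Φ s (single i j 1)) = Φ s := by
    intro s
    ext1 A
    conv_rhs => rw [matrix_eq_sum_single A]
    simp only [ContinuousLinearMap.coe_restrictScalars', _root_.sum_apply, map_sum]
    refine Finset.sum_congr rfl fun i _ => Finset.sum_congr rfl fun j _ => ?_
    have : single i j (A i j) = A i j • single i j (1 : ℂ) := by simp [smul_single]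
    rw [this, map_smul]
    rfl
  have := TwiceLip.sum Finset.univ fun i _ => TwiceLip.sum Finset.univ fun j _ =>
    (h (single i j 1)).clm ((ContinuousLinearMap.smulRightL ℂ (Matrix S S ℂ) W
      (entry i j)).restrictScalars ℝ)
  exact this.congr fun s _ => e s

theorem contDiff_exp {n : WithTop ℕ∞} :
    ContDiff ℝ n (NormedSpace.exp : Matrix S S ℂ → Matrix S S ℂ) :=
  AnalyticOnNhd.contDiff fun x _ => NormedSpace.exp_analytic x

theorem contDiffOn_conjTranspose {A : ℝ → Matrix S S ℂ} {t : Set ℝ} {n : WithTop ℕ∞}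
    (hA : ContDiffOn ℝ n A t) : ContDiffOn ℝ n (fun s => (A s)ᴴ) t :=
  (starL' ℝ : Matrix S S ℂ ≃L[ℝ] Matrix S S ℂ).contDiff.comp_contDiffOn hA

theorem contDiffOn_kronecker_right (A : Matrix S S ℂ) {B : ℝ → Matrix E E ℂ} {t : Set ℝ}
    {n : WithTop ℕ∞} (hB : ContDiffOn ℝ n B t) : ContDiffOn ℝ n (fun s => A ⊗ₖ B s) t :=
  contDiffOn_linearMap_comp
    ({ toFun := fun C => A ⊗ₖ C
       map_add' := kronecker_add A
       map_smul' := fun c C => kronecker_smul c A C } : Matrix E E ℂ →ₗ[ℂ] _) hB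

namespace ADRIS

theorem contDiffOn_hE (R : ADRIS S E) : ContDiffOn ℝ 2 R.hE (Icc 0 1) :=
  contDiffOn_matrix R.hE_C2

theorem contDiffOn_U (R : ADRIS S E) : ContDiffOn ℝ 2 R.U (Icc 0 1) := by
  refine contDiff_exp.comp_contDiffOn (ContDiffOn.const_smul _ ?_)
  exact (contDiffOn_const.add (contDiffOn_kronecker_right _ R.contDiffOn_hE)).add
    ((contDiffOn_matrix R.v_C2).const_smul _)

theorem contDiffOn_ofReal_β (R : ADRIS S E) : ContDiffOn ℝ 2 (fun s => (R.β s : ℂ)) (Icc 0 1) :=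
  Complex.ofRealCLM.contDiff.comp_contDiffOn R.β_C2

theorem contDiffOn_ξ [Nonempty E] (R : ADRIS S E) : ContDiffOn ℝ 2 R.ξ (Icc 0 1) := by
  have h1 : ContDiffOn ℝ 2 (fun s => NormedSpace.exp (-(R.β s : ℂ) • R.hE s)) (Icc 0 1) :=
    contDiff_exp.comp_contDiffOn (R.contDiffOn_ofReal_β.neg.smul R.contDiffOn_hE)
  have h2 : ContDiffOn ℝ 2 (fun s => (NormedSpace.exp (-(R.β s : ℂ) • R.hE s)).trace) (Icc 0 1) :=
    contDiffOn_linearMap_comp (traceLinearMap E ℂ ℂ) h1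
  refine (h2.inv fun s hs h0 => ?_).smul h1
  have := (gibbs_spec (R.hE_herm s hs) (R.β s)).2.1
  rw [gibbs, h0] at this
  simp at this

theorem contDiffOn_dilate [Nonempty E] (R : ADRIS S E) (A : Matrix S S ℂ) :
    ContDiffOn ℝ 2 (fun s => R.U s * (A ⊗ₖ R.ξ s) * (R.U s)ᴴ) (Icc 0 1) :=
  (R.contDiffOn_U.mul (contDiffOn_kronecker_right _ R.contDiffOn_ξ)).mul
    (contDiffOn_conjTranspose R.contDiffOn_U)

theorem contDiffOn_L [Nonempty E] (R : ADRIS S E) (A : Matrix S S ℂ) :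
    ContDiffOn ℝ 2 (fun s => R.L s A) (Icc 0 1) :=
  contDiffOn_linearMap_comp partialTrace (R.contDiffOn_dilate A)

theorem contDiffOn_flux [Nonempty E] (R : ADRIS S E) (A : Matrix S S ℂ) :
    ContDiffOn ℝ 2 (fun s => R.flux s A) (Icc 0 1) :=
  R.contDiffOn_ofReal_β.mul (contDiffOn_linearMap_comp (traceLinearMap (S × E) ℂ ℂ)
    (((R.contDiffOn_dilate A).sub (contDiffOn_kronecker_right _ R.contDiffOn_ξ)).mul
      (contDiffOn_kronecker_right _ R.contDiffOn_hE)))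

/-- The reduced dynamics as a continuous linear map. -/
def Lc (R : ADRIS S E) (s : ℝ) : Matrix S S ℂ →L[ℂ] Matrix S S ℂ :=
  LinearMap.toContinuousLinearMap (R.L s)

theorem Lc_pow_apply (R : ADRIS S E) (s : ℝ) (k : ℕ) (A : Matrix S S ℂ) :
    (R.Lc s ^ k) A = (R.L s ^ k) A := by
  induction k with
  | zero => rfl
  | succ k ih => rw [pow_succ', pow_succ']; exact congrArg (R.L s) ih

theorem twiceLip_Lc [Nonempty E] (R : ADRIS S E) : TwiceLip R.Lc :=
  twiceLip_of_apply fun A => twiceLip_of_contDiffOn (R.contDiffOn_L A)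

/-- The flux as an operator with values in the multiples of the identity. -/
def fluxOp (R : ADRIS S E) (s : ℝ) : Matrix S S ℂ →L[ℂ] Matrix S S ℂ :=
  (LinearMap.toContinuousLinearMap (R.flux s)).smulRight 1

theorem fluxOp_apply (R : ADRIS S E) (s : ℝ) (A : Matrix S S ℂ) :
    R.fluxOp s A = R.flux s A • (1 : Matrix S S ℂ) := rfl

theorem twiceLip_fluxOp [Nonempty E] (R : ADRIS S E) : TwiceLip R.fluxOp :=
  twiceLip_of_apply fun A => twiceLip_of_contDiffOn
    (contDiffOn_linearMap_comp (LinearMap.toSpanSingleton ℂ _ (1 : Matrix S S ℂ))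
      (R.contDiffOn_flux A))

end ADRIS

end Regularity

end RIS

end

noncomputable section

namespace RIS

open Filter Set Matrix
open scoped Matrix.Norms.L2Operator

/-! ### Peripheral spectral projectors -/

section Peripheral

variable {V : Type*} [NormedAddCommGroup V] [NormedSpace ℂ V]

/-- A Jordan block on the unit circle contributes `k θ ^ (k - 1) z` to the `k`-th power, which is
unbounded unless `z = 0`. -/
theorem apply_eq_of_sub_sq_apply_eq_zero {Φ : Module.End ℂ V} {θ : ℂ} (hθ : ‖θ‖ = 1)
    (hb : ∀ x, ∃ C, ∀ k : ℕ, ‖(Φ ^ k) x‖ ≤ C) {y : V}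
    (hy : (Φ - θ • 1) ((Φ - θ • 1) y) = 0) : (Φ - θ • 1) y = 0 := by
  set z := (Φ - θ • 1) y with hz
  have hΦz : Φ z = θ • z := by
    have : Φ z - θ • z = 0 := hy
    exact sub_eq_zero.1 this
  have hΦy : Φ y = θ • y + z := by
    rw [hz]; simp
  have hk : ∀ k : ℕ, (Φ ^ (k + 1)) y = θ ^ (k + 1) • y + ((k + 1 : ℕ) * θ ^ k) • z := by
    intro k
    induction k with
    | zero => simp [hΦy]
    | succ k ih =>
      rw [pow_succ', Module.End.mul_apply, ih, map_add, map_smul, map_smul, hΦy, hΦz, smul_add,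
        smul_smul, smul_smul, add_assoc, ← add_smul]
      congr 2
      push_cast; ring
  obtain ⟨C, hC⟩ := hb y
  by_contra hz0
  have hzpos : 0 < ‖z‖ := norm_pos_iff.2 hz0
  obtain ⟨k, hk'⟩ := exists_nat_gt ((C + ‖y‖) / ‖z‖)
  have h1 := hC (k + 1)
  rw [hk] at h1
  have h2 : ‖((k + 1 : ℕ) * θ ^ k) • z‖ = (k + 1) * ‖z‖ := by
    rw [norm_smul, norm_mul, norm_pow, hθ, one_pow, mul_one, Complex.norm_natCast]
    push_cast; rfl
  have h3 : ‖θ ^ (k + 1) • y‖ = ‖y‖ := by rw [norm_smul, norm_pow, hθ, one_pow, one_mul]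
  have h4 := norm_sub_norm_le (((k + 1 : ℕ) * θ ^ k) • z) (-(θ ^ (k + 1) • y))
  rw [norm_neg, h2, h3, sub_neg_eq_add, add_comm (_ • z)] at h4
  rw [div_lt_iff₀ hzpos] at hk'
  nlinarith

theorem apply_eq_smul_of_mem_maxGenEigenspace {Φ : Module.End ℂ V} {θ : ℂ} (hθ : ‖θ‖ = 1)
    (hb : ∀ x, ∃ C, ∀ k : ℕ, ‖(Φ ^ k) x‖ ≤ C) {x : V} (hx : x ∈ Φ.maxGenEigenspace θ) :
    Φ x = θ • x := by
  rw [Module.End.mem_maxGenEigenspace] at hx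
  obtain ⟨k, hk⟩ := hx
  have key : ∀ k : ℕ, ((Φ - θ • 1) ^ (k + 1)) x = 0 → (Φ - θ • 1) x = 0 := by
    intro k
    induction k with
    | zero => intro h; simpa using h
    | succ k ih =>
      intro h
      refine ih ?_
      rw [pow_succ', pow_succ'] at h
      rw [pow_succ']
      exact apply_eq_of_sub_sq_apply_eq_zero hθ hb h
  have h0 : (Φ - θ • 1) x = 0 := by
    refine key k ?_
    rw [pow_succ', Module.End.mul_apply, hk, map_zero]
  have : Φ x - θ • x = 0 := h0
  exact sub_eq_zero.1 this

variable [FiniteDimensional ℂ V]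

theorem pow_mul_peripheralProj {Φ : Module.End ℂ V} {n : ℕ}
    (hb : ∀ x, ∃ C, ∀ k : ℕ, ‖(Φ ^ k) x‖ ≤ C)
    (hn : ∀ θ : ℂ, ‖θ‖ = 1 → Φ.HasEigenvalue θ → θ ^ n = 1) :
    Φ ^ n * peripheralProj Φ = peripheralProj Φ := by
  ext1 x
  have hle : spectralSubspace Φ (Metric.sphere 0 1) ≤ LinearMap.ker (Φ ^ n - 1) := by
    refine iSup₂_le fun θ hθ y hy => ?_
    have hθ1 : ‖θ‖ = 1 := by simpa using hθ
    have hy' := apply_eq_smul_of_mem_maxGenEigenspace hθ1 hb hy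
    rw [LinearMap.mem_ker, LinearMap.sub_apply, sub_eq_zero, Module.End.one_apply]
    by_cases hy0 : y = 0
    · simp [hy0]
    · have hpow : ∀ k : ℕ, (Φ ^ k) y = θ ^ k • y := by
        intro k
        induction k with
        | zero => simp
        | succ k ih => rw [pow_succ', Module.End.mul_apply, ih, map_smul, hy', smul_smul, pow_succ]
      rw [hpow, hn θ hθ1 (Module.End.hasEigenvalue_of_hasEigenvector
        ⟨Module.End.mem_eigenspace_iff.2 hy', hy0⟩), one_smul]
  have := hle (Submodule.projection_apply_mem (isCompl_spectralSubspace Φ _) x)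
  rw [LinearMap.mem_ker, LinearMap.sub_apply, sub_eq_zero] at this
  exact this

end Peripheral

section PeripheralAlg

variable {V : Type*} [AddCommGroup V] [Module ℂ V] [FiniteDimensional ℂ V]

theorem peripheralProj_mul_self (Φ : Module.End ℂ V) :
    peripheralProj Φ * peripheralProj Φ = peripheralProj Φ :=
  Submodule.isIdempotentElem_projection _

theorem apply_mem_spectralSubspace (Φ : Module.End ℂ V) (Ω : Set ℂ) {x : V}
    (hx : x ∈ spectralSubspace Φ Ω) : Φ x ∈ spectralSubspace Φ Ω := by
  have : spectralSubspace Φ Ω ≤ (spectralSubspace Φ Ω).comap Φ := by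
    refine iSup₂_le fun θ hθ y hy => ?_
    exact (le_biSup (fun μ => Φ.maxGenEigenspace μ) hθ)
      (Module.End.mapsTo_maxGenEigenspace_of_comm (Commute.refl Φ) θ hy)
  exact this hx

theorem commute_peripheralProj (Φ : Module.End ℂ V) : Commute Φ (peripheralProj Φ) := by
  ext1 x
  have hc := isCompl_spectralSubspace Φ (Metric.sphere 0 1)
  set P := peripheralProj Φ with hP
  change Φ (P x) = P (Φ x)
  have h1 : P (Φ (P x)) = Φ (P x) := Submodule.projection_apply_of_mem_left hc
    (apply_mem_spectralSubspace Φ _ (Submodule.projection_apply_mem hc x))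
  have h2 : P (Φ (x - P x)) = 0 := (Submodule.projection_apply_eq_zero_iff hc).2
    (apply_mem_spectralSubspace Φ _ (Submodule.sub_projection_mem hc x))
  rw [map_sub, map_sub, h1, sub_eq_zero] at h2
  exact h2.symm

end PeripheralAlg

/-! ### Trace norm -/

section TraceNorm

variable {ι : Type*} [Fintype ι] [DecidableEq ι]

theorem exists_singularValues (A : Matrix ι ι ℂ) : ∃ a : ι → ℝ, (∀ i, 0 ≤ a i) ∧
    traceNorm A = ∑ i, a i ∧ hsq A = ∑ i, a i ^ 2 := by
  have hp := posSemidef_conjTranspose_mul_self A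
  obtain ⟨W, a, h1, h2, -, hf, ha, -, ht⟩ := exists_diag hp.1
  have ha := ha hp
  refine ⟨fun i => √(a i), fun i => Real.sqrt_nonneg _, ?_, ?_⟩
  · rw [traceNorm, hf, trace_mul_comm, ← Matrix.mul_assoc, h2, Matrix.one_mul, trace_diagonal]
    simp
  · have := trace_conjTranspose_mul_self_eq_hsq A
    rw [ht] at this
    have h3 : ∑ i, a i = hsq A := by exact_mod_cast this
    rw [← h3]
    exact Finset.sum_congr rfl fun i _ => (Real.sq_sqrt (ha i)).symm

theorem traceNorm_nonneg (A : Matrix ι ι ℂ) : 0 ≤ traceNorm A := by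
  obtain ⟨a, ha, h, -⟩ := exists_singularValues A
  rw [h]; exact Finset.sum_nonneg fun i _ => ha i

theorem hsq_le_traceNorm_sq (A : Matrix ι ι ℂ) : hsq A ≤ traceNorm A ^ 2 := by
  obtain ⟨a, ha, h, h'⟩ := exists_singularValues A
  rw [h, h']
  exact Finset.sum_sq_le_sq_sum_of_nonneg fun i _ => ha i

theorem traceNorm_sq_le (A : Matrix ι ι ℂ) : traceNorm A ^ 2 ≤ Fintype.card ι * hsq A := by
  obtain ⟨a, ha, h, h'⟩ := exists_singularValues A
  rw [h, h']
  exact sq_sum_le_card_mul_sum_sq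

theorem traceNorm_pow_apply_le {Φ : Module.End ℂ (Matrix ι ι ℂ)} {ℓ : ℝ} (hℓ : 0 ≤ ℓ)
    (h : ∀ A, traceNorm (Φ A) ≤ ℓ * traceNorm A) (k : ℕ) (A : Matrix ι ι ℂ) :
    traceNorm ((Φ ^ k) A) ≤ ℓ ^ k * traceNorm A := by
  induction k with
  | zero => simp
  | succ k ih =>
    rw [pow_succ', Module.End.mul_apply, pow_succ', mul_assoc]
    exact (h _).trans (mul_le_mul_of_nonneg_left ih hℓ)

/-- Contractions of the trace norm have powers that decay in operator norm. -/
theorem exists_pow_norm_le : ∃ C : ℝ, ∀ (Φ : Module.End ℂ (Matrix ι ι ℂ)) (ℓ : ℝ), 0 ≤ ℓ →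
    (∀ A, traceNorm (Φ A) ≤ ℓ * traceNorm A) → ∀ (k : ℕ) (A : Matrix ι ι ℂ),
      ‖(Φ ^ k) A‖ ≤ C * ℓ ^ k * ‖A‖ := by
  obtain ⟨C, hC, hn⟩ := exists_norm_equiv_hsq (ι := ι)
  refine ⟨C * (Fintype.card ι + 1), fun Φ ℓ hℓ h k A => ?_⟩
  -- The contraction is iterated in the trace norm and only the final result is compared with the
  -- operator norm, so the equivalence constants enter once and the rate `ℓ` is kept.
  have h1 := traceNorm_pow_apply_le hℓ h k A
  have h2 := pow_le_pow_left₀ (traceNorm_nonneg _) h1 2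
  refine (pow_le_pow_iff_left₀ (norm_nonneg _) (by positivity) two_ne_zero).1 ?_
  set d := (Fintype.card ι : ℝ) with hd
  have hd0 : 0 ≤ d := Nat.cast_nonneg _
  calc ‖(Φ ^ k) A‖ ^ 2 ≤ C * hsq ((Φ ^ k) A) := (hn _).1
    _ ≤ C * (ℓ ^ k * traceNorm A) ^ 2 :=
        mul_le_mul_of_nonneg_left ((hsq_le_traceNorm_sq _).trans h2) hC.le
    _ = C * (ℓ ^ k) ^ 2 * traceNorm A ^ 2 := by ring
    _ ≤ C * (ℓ ^ k) ^ 2 * (d * (C * ‖A‖ ^ 2)) :=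
        mul_le_mul_of_nonneg_left ((traceNorm_sq_le A).trans
          (mul_le_mul_of_nonneg_left (hn A).2 hd0)) (by positivity)
    _ = (C * ℓ ^ k * ‖A‖) ^ 2 * d := by ring
    _ ≤ (C * ℓ ^ k * ‖A‖) ^ 2 * (d + 1) ^ 2 :=
        mul_le_mul_of_nonneg_left (by nlinarith) (by positivity)
    _ = (C * (d + 1) * ℓ ^ k * ‖A‖) ^ 2 := by ring

end TraceNorm

end RIS

end

noncomputable section

namespace RIS

open Filter Set Matrix
open scoped Matrix.Norms.L2Operator

/-! ### Consequences of the hypotheses for the reduced dynamics -/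

namespace ADRIS

variable {S E : Type*} [Fintype S] [DecidableEq S] [Fintype E] [DecidableEq E]

/-- The common core of the two sets of hypotheses. -/
structure Regular (R : ADRIS S E) (m : ℕ) : Prop where
  one_le : 1 ≤ m
  irr : ∀ s ∈ Icc (0 : ℝ) 1, IsIrreducible (R.L s)
  gap : ∃ ℓ < 1, H4With (fun s => R.L s ^ m) ℓ
  fixed : ∀ s ∈ Icc (0 : ℝ) 1, ∀ A, (R.L s ^ m) A = A → A = A.trace • R.ρinv s

variable [Nonempty S] [Nonempty E]

theorem isInvariantState_ρinv (R : ADRIS S E) {s : ℝ} (hs : s ∈ Icc (0 : ℝ) 1) :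
    IsInvariantState (R.L s) (R.ρinv s) :=
  Classical.epsilon_spec (exists_invariantState (Φ := R.L s)
    fun _ => (R.isDilation hs).isState_channel)

theorem isState_L (R : ADRIS S E) {s : ℝ} (hs : s ∈ Icc (0 : ℝ) 1) {ρ : Matrix S S ℂ}
    (hρ : IsState ρ) : IsState (R.L s ρ) :=
  (R.isDilation hs).isState_channel hρ

theorem isState_L_pow (R : ADRIS S E) {s : ℝ} (hs : s ∈ Icc (0 : ℝ) 1) {ρ : Matrix S S ℂ}
    (hρ : IsState ρ) (k : ℕ) : IsState ((R.L s ^ k) ρ) := by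
  induction k with
  | zero => exact hρ
  | succ k ih => rw [pow_succ']; exact R.isState_L hs ih

theorem trace_L_pow (R : ADRIS S E) {s : ℝ} (hs : s ∈ Icc (0 : ℝ) 1) (A : Matrix S S ℂ) (k : ℕ) :
    ((R.L s ^ k) A).trace = A.trace := by
  induction k with
  | zero => rfl
  | succ k ih => rw [pow_succ', ← ih]; exact (R.isDilation hs).trace_channel _

theorem L_pow_ρinv (R : ADRIS S E) {s : ℝ} (hs : s ∈ Icc (0 : ℝ) 1) (k : ℕ) :
    (R.L s ^ k) (R.ρinv s) = R.ρinv s := by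
  induction k with
  | zero => rfl
  | succ k ih => rw [pow_succ', Module.End.mul_apply, ih, (R.isInvariantState_ρinv hs).2]

theorem ρinv_ne_zero (R : ADRIS S E) {s : ℝ} (hs : s ∈ Icc (0 : ℝ) 1) : R.ρinv s ≠ 0 := by
  intro h0
  have := (R.isInvariantState_ρinv hs).1.2
  simp [h0] at this

theorem regular_of_caseI {R : ADRIS S E} {m : ℕ} (h : R.CaseI m) : R.Regular m := by
  obtain ⟨rfl, hirr, ℓ, hℓ, h4⟩ := h
  refine ⟨le_rfl, hirr, ⟨ℓ, hℓ, by simpa only [pow_one] using h4⟩, fun s hs A hA => ?_⟩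
  rw [pow_one] at hA
  exact (R.isDilation hs).eq_smul_of_fixed (hirr s hs) (R.isInvariantState_ρinv hs) hA

/-- Irreducibility does not pass from a map to its powers in general. The fixed points of the `m`-th
power are identified by the simplicity of its eigenvalue `1`, which is part of `H2`. -/
theorem regular_of_caseII {R : ADRIS S E} {m : ℕ} (h : R.CaseII m) : R.Regular m := by
  obtain ⟨hm, hirr, -, ℓ, -, hℓ, -, h2, -, h4⟩ := h
  refine ⟨hm, hirr, ⟨ℓ, hℓ, h4⟩, fun s hs A hA => ?_⟩
  have hmem : ∀ B, (R.L s ^ m) B = B → B ∈ (R.L s ^ m).maxGenEigenspace 1 := by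
    intro B hB
    rw [Module.End.mem_maxGenEigenspace]
    exact ⟨1, by simp [hB]⟩
  have hr := R.L_pow_ρinv hs m
  have h1 : (1 : ℂ) ∈ spectrum ℂ (R.L s ^ m) := by
    rw [← Module.End.hasEigenvalue_iff_mem_spectrum]
    exact Module.End.hasEigenvalue_of_hasEigenvector
      ⟨Module.End.mem_eigenspace_iff.2 (by rw [hr, one_smul]), R.ρinv_ne_zero hs⟩
  have hfr := h2.1 s hs 1 ⟨h1, by simp⟩
  obtain ⟨c, hc⟩ := (finrank_eq_one_iff_of_nonzero' (⟨R.ρinv s, hmem _ hr⟩ :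
    (R.L s ^ m).maxGenEigenspace 1) (fun h0 => R.ρinv_ne_zero hs (congrArg Subtype.val h0))).1 hfr
    ⟨A, hmem A hA⟩
  have hc' : c • R.ρinv s = A := congrArg Subtype.val hc
  have ht : A.trace = c := by
    rw [← hc', trace_smul, (R.isInvariantState_ρinv hs).1.2, smul_eq_mul, mul_one]
  rw [ht, hc']

variable {R : ADRIS S E} {m : ℕ}

theorem Regular.posDef_ρinv (h : R.Regular m) {s : ℝ} (hs : s ∈ Icc (0 : ℝ) 1) :
    (R.ρinv s).PosDef :=
  (R.isDilation hs).posDef_of_invariant (h.irr s hs) (R.isInvariantState_ρinv hs).1.1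
    (R.ρinv_ne_zero hs) (R.isInvariantState_ρinv hs).2

/-- The `m`-step dynamics as a family in the algebra of continuous linear maps. -/
def Mc (R : ADRIS S E) (m : ℕ) (s : ℝ) : Matrix S S ℂ →L[ℂ] Matrix S S ℂ := R.Lc s ^ m

/-- Its peripheral projector. -/
def Pc (R : ADRIS S E) (m : ℕ) (s : ℝ) : Matrix S S ℂ →L[ℂ] Matrix S S ℂ :=
  Module.End.toContinuousLinearMap _ (peripheralProj (R.L s ^ m))

theorem Mc_eq (R : ADRIS S E) (m : ℕ) (s : ℝ) :
    R.Mc m s = Module.End.toContinuousLinearMap _ (R.L s ^ m) := by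
  rw [map_pow]; rfl

theorem Mc_apply (R : ADRIS S E) (m : ℕ) (s : ℝ) (A : Matrix S S ℂ) :
    R.Mc m s A = (R.L s ^ m) A := R.Lc_pow_apply s m A

theorem twiceLip_Mc (R : ADRIS S E) (m : ℕ) : TwiceLip (R.Mc m) :=
  show TwiceLip fun s => R.Lc s ^ m from
    TwiceLip.pow (𝔸 := Matrix S S ℂ →L[ℂ] Matrix S S ℂ) R.twiceLip_Lc m

theorem isState_evol (R : ADRIS S E) (m : ℕ) {T k : ℕ} (hk : k ≤ T) {ρ : Matrix S S ℂ}
    (hρ : IsState ρ) : IsState (evol (R.Mc m) T k ρ) := by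
  induction k with
  | zero => exact hρ
  | succ k ih =>
    have : evol (R.Mc m) T (k + 1) ρ =
      R.Mc m (((k + 1 : ℕ) : ℝ) / T) (evol (R.Mc m) T k ρ) := rfl
    rw [this, Mc_apply]
    exact R.isState_L_pow (grid_mem hk) (ih (by omega)) m

theorem exists_norm_evol_le (R : ADRIS S E) (m : ℕ) :
    ∃ B, ∀ T k : ℕ, k ≤ T → ‖evol (R.Mc m) T k‖ ≤ B := by
  obtain ⟨B, hB⟩ := exists_norm_le_of_states (ι := S)
  exact ⟨B, fun T k hk => hB _ fun ρ hρ => R.isState_evol m hk hρ⟩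

theorem exists_norm_Mc_pow_le (R : ADRIS S E) (m : ℕ) :
    ∃ B, ∀ s ∈ Icc (0 : ℝ) 1, ∀ k : ℕ, ‖R.Mc m s ^ k‖ ≤ B := by
  obtain ⟨B, hB⟩ := exists_norm_le_of_states (ι := S)
  refine ⟨B, fun s hs k => hB _ fun ρ hρ => ?_⟩
  rw [Mc, ← pow_mul, Lc_pow_apply]
  exact R.isState_L_pow hs hρ _

/-- By spectral mapping a peripheral eigenvalue of the power is the `m`-th power of one of the
irreducible map, whose order divides the same factorial. -/
theorem Regular.pow_eq_one_of_hasEigenvalue (h : R.Regular m) {s : ℝ} (hs : s ∈ Icc (0 : ℝ) 1)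
    {θ : ℂ} (hθ : ‖θ‖ = 1) (he : (R.L s ^ m).HasEigenvalue θ) :
    θ ^ (Module.finrank ℂ (Matrix S S ℂ)).factorial = 1 := by
  rw [Module.End.hasEigenvalue_iff_mem_spectrum, spectrum.map_pow_of_pos _ h.one_le] at he
  obtain ⟨μ, hμ, rfl⟩ := he
  simp only [norm_pow] at hθ ⊢
  have hμ1 : ‖μ‖ = 1 := (pow_eq_one_iff_of_nonneg (norm_nonneg _) (by have := h.one_le; omega)).1 hθ
  have := (R.isDilation hs).pow_factorial_eq_one (h.irr s hs) (R.isInvariantState_ρinv hs)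
    (Module.End.hasEigenvalue_iff_mem_spectrum.2 hμ) hμ1
  rw [← pow_mul, mul_comm, pow_mul, this, one_pow]

/-- Spectral data of the `m`-step dynamics, uniformly in the parameter. -/
theorem Regular.exists_spectral_data (h : R.Regular m) : ∃ (n : ℕ) (C ℓ B : ℝ), 0 < n ∧ 0 ≤ ℓ ∧
    ℓ < 1 ∧ (∀ s ∈ Icc (0 : ℝ) 1, R.Pc m s * R.Pc m s = R.Pc m s) ∧
    (∀ s ∈ Icc (0 : ℝ) 1, Commute (R.Mc m s) (R.Pc m s)) ∧
    (∀ s ∈ Icc (0 : ℝ) 1, R.Mc m s ^ n * R.Pc m s = R.Pc m s) ∧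
    (∀ s ∈ Icc (0 : ℝ) 1, ∀ k : ℕ, ‖R.Mc m s ^ k * (1 - R.Pc m s)‖ ≤ C * ℓ ^ k) ∧
    (∀ s ∈ Icc (0 : ℝ) 1, ∀ k : ℕ, ‖R.Mc m s ^ k * R.Pc m s‖ ≤ B) := by
  obtain ⟨ℓ₀, hℓ₀, h4⟩ := h.gap
  obtain ⟨B, hB⟩ := R.exists_norm_Mc_pow_le m
  obtain ⟨C, hC⟩ := exists_pow_norm_le (ι := S)
  set n := (Module.finrank ℂ (Matrix S S ℂ)).factorial with hn
  have hn0 : 0 < n := Nat.factorial_pos _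
  set ℓ := max ℓ₀ 0 with hℓ
  have hℓ0 : 0 ≤ ℓ := le_max_right _ _
  have hPP : ∀ s, R.Pc m s * R.Pc m s = R.Pc m s := fun s => by
    rw [Pc, ← map_mul, peripheralProj_mul_self]
  have hMP : ∀ s, Commute (R.Mc m s) (R.Pc m s) := fun s => by
    rw [Mc_eq, Pc, Commute, SemiconjBy, ← map_mul, ← map_mul, (commute_peripheralProj _).eq]
  have hMn : ∀ s ∈ Icc (0 : ℝ) 1, R.Mc m s ^ n * R.Pc m s = R.Pc m s := by
    intro s hs
    rw [Mc_eq, Pc, ← map_pow, ← map_mul, pow_mul_peripheralProj]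
    · intro A
      refine ⟨B * ‖A‖, fun k => ?_⟩
      have := (R.Mc m s ^ k).le_of_opNorm_le (hB s hs k) A
      rwa [Mc, ← pow_mul, Lc_pow_apply, pow_mul] at this
    · exact fun θ hθ he => h.pow_eq_one_of_hasEigenvalue hs hθ he
  have hQk : ∀ s, ∀ k : ℕ, 0 < k → R.Mc m s ^ k * (1 - R.Pc m s) =
      (R.Mc m s * (1 - R.Pc m s)) ^ k := by
    intro s k hk
    have hc : Commute (R.Mc m s) (1 - R.Pc m s) := (Commute.one_right _).sub_right (hMP s)
    have hi : IsIdempotentElem (1 - R.Pc m s) := IsIdempotentElem.one_sub (hPP s)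
    rw [hc.mul_pow, hi.pow_eq hk.ne']
  have hC0 : 0 ≤ |C| := abs_nonneg C
  have hdecay : ∀ s ∈ Icc (0 : ℝ) 1, ∀ k : ℕ, 0 < k →
      ‖R.Mc m s ^ k * (1 - R.Pc m s)‖ ≤ |C| * ℓ ^ k := by
    intro s hs k hk
    rw [hQk s k hk]
    refine ContinuousLinearMap.opNorm_le_bound _ (by positivity) fun A => ?_
    have e : R.Mc m s * (1 - R.Pc m s) = Module.End.toContinuousLinearMap _
        (R.L s ^ m * contractingProj (R.L s ^ m)) := by
      rw [Mc_eq, Pc, contractingProj, map_mul, map_sub, map_one]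
    rw [e, ← map_pow]
    have h5 := hC (R.L s ^ m * contractingProj (R.L s ^ m)) ℓ hℓ0 (fun A => (h4 s hs A).trans
      (mul_le_mul_of_nonneg_right (le_max_left _ _) (traceNorm_nonneg _))) k A
    refine h5.trans ?_
    exact mul_le_mul_of_nonneg_right (mul_le_mul_of_nonneg_right (le_abs_self C) (by positivity))
      (norm_nonneg _)
  -- The projectors are bounded through `P = M ^ n - M ^ n (1 - P)`: a bounded power minus a
  -- decaying one. This bound in turn covers the exponent `k = 0`, excluded from the decay estimate.
  have hP : ∀ s ∈ Icc (0 : ℝ) 1, ‖R.Pc m s‖ ≤ B + |C| := by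
    intro s hs
    have e : R.Pc m s = R.Mc m s ^ n - R.Mc m s ^ n * (1 - R.Pc m s) := by
      rw [mul_sub, mul_one, hMn s hs, sub_sub_cancel]
    rw [e]
    refine (norm_sub_le _ _).trans (add_le_add (hB s hs n) ((hdecay s hs n hn0).trans ?_))
    exact mul_le_of_le_one_right hC0 (pow_le_one₀ hℓ0 (max_lt hℓ₀ one_pos).le)
  have hB0 : 0 ≤ B := (norm_nonneg _).trans (hB 0 ⟨le_rfl, zero_le_one⟩ 0)
  refine ⟨n, |C| + (B + (B + |C|)), ℓ, B * (B + |C|), hn0, hℓ0, max_lt hℓ₀ one_pos, fun s _ => hPP s,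
    fun s _ => hMP s, hMn, fun s hs k => ?_, fun s hs k => ?_⟩
  · rcases Nat.eq_zero_or_pos k with rfl | hk
    · have h1 := hB s hs 0
      rw [pow_zero] at h1 ⊢
      rw [one_mul, pow_zero, mul_one]
      refine (norm_sub_le _ _).trans ?_
      have := hP s hs
      linarith
    · refine (hdecay s hs k hk).trans (mul_le_mul_of_nonneg_right ?_ (by positivity))
      linarith
  · exact (norm_mul_le _ _).trans (mul_le_mul (hB s hs k) (hP s hs) (norm_nonneg _) hB0)

/-- The reduced resolvent at the eigenvalue `1`; the spectral projector there is
`A ↦ (Tr A) ρ_inv`. -/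
theorem Regular.exists_redRes (h : R.Regular m) : ∃ J G : ℝ → Matrix S S ℂ →L[ℂ] Matrix S S ℂ,
    RedRes (R.Mc m) J G ∧ ∀ s ∈ Icc (0 : ℝ) 1, ∀ A, J s A = A.trace • R.ρinv s := by
  obtain ⟨n, C, ℓ, B, hn, h0, h1, hPP, hMP, hMn, hQ, hP⟩ := h.exists_spectral_data
  obtain ⟨G, hG⟩ := RIS.exists_redRes (𝔸 := Matrix S S ℂ →L[ℂ] Matrix S S ℂ) (M := R.Mc m)
    (P := R.Pc m) hn hPP hMP hMn h0 h1 hQ hP (θ := 1) (one_pow n)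
  simp only [inv_one, one_smul] at hG
  refine ⟨_, G, hG, fun s hs A => ?_⟩
  -- `J A` is a fixed point, and it has the trace of `A` because `(1 - M) G A` is traceless. Both
  -- facts together determine it.
  set J := periodMean n (R.Mc m s) (R.Pc m s) with hJ
  have e1 : (R.L s ^ m) (J A) = J A := by
    have := DFunLike.congr_fun (hG.MR s hs) A
    rw [← Mc_apply]; exact this
  have e2 : (J A).trace = A.trace := by
    have := DFunLike.congr_fun (hG.MG s hs) A
    have e3 : G s A - (R.L s ^ m) (G s A) = A - J A := by
      rw [← Mc_apply]; exact this
    have e4 := congrArg trace e3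
    rw [trace_sub, trace_sub, R.trace_L_pow hs, sub_self] at e4
    exact (sub_eq_zero.1 e4.symm).symm
  rw [h.fixed s hs _ e1, e2]

end ADRIS

end RIS

end

noncomputable section

namespace RIS

open Filter Set Matrix
open scoped Matrix.Norms.L2Operator

/-! ### Total entropy production -/

theorem sum_range_mul_eq {M : Type*} [AddCommMonoid M] (f : ℕ → M) (m T : ℕ) :
    ∑ k ∈ Finset.range (m * T), f k = ∑ j ∈ Finset.range T, ∑ i ∈ Finset.range m, f (m * j + i) := by
  induction T with
  | zero => simp
  | succ T ih => rw [Finset.sum_range_succ, ← ih, Nat.mul_succ, Finset.sum_range_add]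

namespace ADRIS

theorem param_block {m i : ℕ} (hi : i < m) (T j : ℕ) :
    param m T (m * j + i + 1) = ((j + 1 : ℕ) : ℝ) / T := by
  have h : (m * j + i + 1 - 1) / m = j := by
    rw [Nat.add_sub_cancel, Nat.mul_add_div (by omega), Nat.div_eq_of_lt hi, add_zero]
  rw [param, h]

variable {S E : Type*} [Fintype S] [DecidableEq S] [Fintype E] [DecidableEq E]

/-- Including `i = m` is what links the blocks: the end of block `j` is the start of block `j + 1`.
-/
theorem state_block (R : ADRIS S E) (m T : ℕ) (ρ : Matrix S S ℂ) (j : ℕ) :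
    ∀ i ≤ m, R.state m T ρ (m * j + i) =
      (R.L (((j + 1 : ℕ) : ℝ) / T) ^ i) (evol (R.Mc m) T j ρ) := by
  induction j with
  | zero =>
    intro i
    induction i with
    | zero => intro _; rfl
    | succ i ih =>
      intro hi
      rw [pow_succ', Module.End.mul_apply, ← ih (by omega), ← param_block (m := m) (i := i) (by omega)]
      rfl
  | succ j ihj =>
    intro i
    induction i with
    | zero =>
      intro _
      have := ihj m le_rfl
      rw [add_zero, Nat.mul_succ, this, ← Lc_pow_apply]
      rfl
    | succ i ih =>
      intro hi
      rw [pow_succ', Module.End.mul_apply, ← ih (by omega), ← param_block (m := m) (i := i) (by omega)]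
      rfl

theorem totalEntropyProd_eq_sum (R : ADRIS S E) (m : ℕ) (ρ : Matrix S S ℂ) (T : ℕ) :
    R.totalEntropyProd m ρ T = ∑ j ∈ Finset.range T, ∑ i ∈ Finset.range m,
      R.entropyProd m T ρ (m * j + i + 1) := by
  rw [totalEntropyProd, ← sum_range_mul_eq (fun k => R.entropyProd m T ρ (k + 1)),
    Finset.range_eq_Ico, Finset.sum_Ico_add' (fun k => R.entropyProd m T ρ k) 0 (m * T) 1]
  rfl

theorem entropyProd_block (R : ADRIS S E) {m i : ℕ} (hi : i < m) (T : ℕ) (ρ : Matrix S S ℂ)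
    (j : ℕ) : R.entropyProd m T ρ (m * j + i + 1) =
      relEntropy (R.U (((j + 1 : ℕ) : ℝ) / T) *
        (((R.L (((j + 1 : ℕ) : ℝ) / T) ^ i) (evol (R.Mc m) T j ρ)) ⊗ₖ R.ξ (((j + 1 : ℕ) : ℝ) / T)) *
          (R.U (((j + 1 : ℕ) : ℝ) / T))ᴴ)
        (R.L (((j + 1 : ℕ) : ℝ) / T) ((R.L (((j + 1 : ℕ) : ℝ) / T) ^ i) (evol (R.Mc m) T j ρ)) ⊗ₖ
          R.ξ (((j + 1 : ℕ) : ℝ) / T)) := by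
  rw [entropyProd, param_block hi, Nat.add_sub_cancel, R.state_block m T ρ j i hi.le]

/-- The flux of `m` interactions with the same parameter. -/
def fluxSum (R : ADRIS S E) (m : ℕ) (s : ℝ) (A : Matrix S S ℂ) : ℂ :=
  ∑ i ∈ Finset.range m, R.flux s ((R.L s ^ i) A)

/-- The logarithm of the invariant state. -/
def K (R : ADRIS S E) (s : ℝ) : Matrix S S ℂ := cfc Real.log (R.ρinv s)

/-- The relative entropy with respect to the invariant state. -/
def free (R : ADRIS S E) (s : ℝ) (ρ : Matrix S S ℂ) : ℝ :=
  negEntropy ρ - (ρ * R.K s).trace.re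

variable [Nonempty S] [Nonempty E]

theorem evol_succ_apply (R : ADRIS S E) (m T j : ℕ) (ρ : Matrix S S ℂ) :
    evol (R.Mc m) T (j + 1) ρ = (R.L (((j + 1 : ℕ) : ℝ) / T) ^ m) (evol (R.Mc m) T j ρ) := by
  rw [← Mc_apply]; rfl

theorem totalEntropyProd_eq (R : ADRIS S E) (m : ℕ) {ρ : Matrix S S ℂ} (hρ : IsState ρ) (T : ℕ) :
    R.totalEntropyProd m ρ T = negEntropy ρ - negEntropy (evol (R.Mc m) T T ρ) +
      ∑ j ∈ Finset.range T, (R.fluxSum m (((j + 1 : ℕ) : ℝ) / T) (evol (R.Mc m) T j ρ)).re := by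
  have h0 : negEntropy ρ - negEntropy (evol (R.Mc m) T T ρ) =
      ∑ j ∈ Finset.range T,
        (negEntropy (evol (R.Mc m) T j ρ) - negEntropy (evol (R.Mc m) T (j + 1) ρ)) := by
    rw [Finset.sum_range_sub' fun j => negEntropy (evol (R.Mc m) T j ρ)]
    rfl
  rw [totalEntropyProd_eq_sum, h0, ← Finset.sum_add_distrib]
  refine Finset.sum_congr rfl fun j hj => ?_
  have hjT := Finset.mem_range.1 hj
  have hs := grid_mem (T := T) (k := j + 1) hjT
  have hy := R.isState_evol m hjT.le hρ
  rw [evol_succ_apply]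
  set s := ((j + 1 : ℕ) : ℝ) / T
  set y := evol (R.Mc m) T j ρ
  have e : negEntropy y - negEntropy ((R.L s ^ m) y) = ∑ i ∈ Finset.range m,
      (negEntropy ((R.L s ^ i) y) - negEntropy ((R.L s ^ (i + 1)) y)) := by
    rw [Finset.sum_range_sub' fun i => negEntropy ((R.L s ^ i) y)]
    rfl
  rw [fluxSum, Complex.re_sum, e, ← Finset.sum_add_distrib]
  refine Finset.sum_congr rfl fun i hi => ?_
  rw [R.entropyProd_block (Finset.mem_range.1 hi), R.relEntropy_eq_flux hs (R.isState_L_pow hs hy i),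
    pow_succ']
  rfl

variable {R : ADRIS S E} {m : ℕ}

theorem Regular.flux_eq (h : R.Regular m) {s : ℝ} (hs : s ∈ Icc (0 : ℝ) 1) (hX : R.X s = 0)
    (A : Matrix S S ℂ) : R.flux s A = (R.L s A * R.K s).trace - (A * R.K s).trace :=
  R.flux_eq_of_commute hs (h.posDef_ρinv hs) (sub_eq_zero.1 hX) A

theorem Regular.fluxSum_eq (h : R.Regular m) {s : ℝ} (hs : s ∈ Icc (0 : ℝ) 1) (hX : R.X s = 0)
    (A : Matrix S S ℂ) :
    R.fluxSum m s A = ((R.L s ^ m) A * R.K s).trace - (A * R.K s).trace := by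
  have := Finset.sum_range_sub (fun i => ((R.L s ^ i) A * R.K s).trace) m
  simp only [pow_zero, Module.End.one_apply] at this
  rw [← this, fluxSum]
  refine Finset.sum_congr rfl fun i _ => ?_
  rw [h.flux_eq hs hX, pow_succ']
  rfl

/-- The flux of `m` interactions as an operator. -/
def fluxSumOp (R : ADRIS S E) (m : ℕ) (s : ℝ) : Matrix S S ℂ →L[ℂ] Matrix S S ℂ :=
  ∑ i ∈ Finset.range m, R.fluxOp s * R.Lc s ^ i

theorem fluxSumOp_apply (R : ADRIS S E) (m : ℕ) (s : ℝ) (A : Matrix S S ℂ) :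
    R.fluxSumOp m s A = R.fluxSum m s A • (1 : Matrix S S ℂ) := by
  rw [fluxSumOp, _root_.sum_apply, fluxSum, Finset.sum_smul]
  refine Finset.sum_congr rfl fun i _ => ?_
  rw [← fluxOp_apply, ← Lc_pow_apply]
  rfl

theorem twiceLip_fluxSumOp (R : ADRIS S E) (m : ℕ) : TwiceLip (R.fluxSumOp m) :=
  TwiceLip.sum (F := Matrix S S ℂ →L[ℂ] Matrix S S ℂ) (Finset.range m)
    (f := fun i s => R.fluxOp s * R.Lc s ^ i) fun i _ =>
    TwiceLip.mul (𝔸 := Matrix S S ℂ →L[ℂ] Matrix S S ℂ) R.twiceLip_fluxOp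
      (TwiceLip.pow (𝔸 := Matrix S S ℂ →L[ℂ] Matrix S S ℂ) R.twiceLip_Lc i)

/-- A regular family that represents `A ↦ Tr (A K)` on traceless operators. -/
theorem Regular.exists_kappa (h : R.Regular m) (hX : ∀ s ∈ Icc (0 : ℝ) 1, R.X s = 0) :
    ∃ J G κ : ℝ → Matrix S S ℂ →L[ℂ] Matrix S S ℂ,
      RedRes (R.Mc m) J G ∧ (∀ s ∈ Icc (0 : ℝ) 1, ∀ A, J s A = A.trace • R.ρinv s) ∧
      TwiceLip κ ∧ ∀ s ∈ Icc (0 : ℝ) 1, ∀ A, A.trace = 0 →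
        κ s A = (A * R.K s).trace • (1 : Matrix S S ℂ) := by
  obtain ⟨J, G, hG, hJ⟩ := h.exists_redRes
  -- For traceless `A` the operator `B = G A` solves `(1 - M) B = A`, and the flux of `B` is `Tr ((M
  -- - 1) B K) = -Tr (A K)`. The regularity of `K` is thus inherited from the flux and `G`.
  refine ⟨J, G, fun s => -(R.fluxSumOp m s * G s), hG, hJ,
    TwiceLip.neg (F := Matrix S S ℂ →L[ℂ] Matrix S S ℂ)
      (TwiceLip.mul (𝔸 := Matrix S S ℂ →L[ℂ] Matrix S S ℂ) (R.twiceLip_fluxSumOp m)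
        (hG.twiceLipG (R.twiceLip_Mc m))), fun s hs A hA => ?_⟩
  have e3 : G s A - (R.L s ^ m) (G s A) = A - J s A := by
    rw [← Mc_apply]; exact DFunLike.congr_fun (hG.MG s hs) A
  rw [hJ s hs, hA, zero_smul, sub_zero] at e3
  change -(R.fluxSumOp m s (G s A)) = _
  rw [fluxSumOp_apply, h.fluxSum_eq hs (hX s hs), ← neg_smul, neg_sub, ← trace_sub,
    ← Matrix.sub_mul, e3]

end ADRIS

end RIS

end

noncomputable section

namespace RIS

open Filter Set Matrix
open scoped Matrix.Norms.L2Operator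

/-! ### Bounded total entropy production -/

namespace ADRIS

variable {S E : Type*} [Fintype S] [DecidableEq S] [Fintype E] [DecidableEq E]
  [Nonempty S] [Nonempty E] {R : ADRIS S E} {m : ℕ}

theorem relEntropy_nonneg_of_posDef {ι : Type*} [Fintype ι] [DecidableEq ι] {η ν : Matrix ι ι ℂ}
    (hη : IsState η) (hν : IsState ν) (hd : ν.PosDef) : 0 ≤ relEntropy η ν := by
  refine le_trans ?_ (half_sq_le_relEntropy hη hν (by rw [indZero_of_posDef hd, Matrix.mul_zero]))
  rw [trace_sq_of_isHermitian (hη.1.1.sub hν.1.1)]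
  exact div_nonneg (hsq_nonneg _) two_pos.le

/-- The variation of `K` in the direction of the invariant state is of second order. -/
theorem Regular.exists_trace_increment_le (h : R.Regular m)
    (hX : ∀ s ∈ Icc (0 : ℝ) 1, R.X s = 0) : ∃ C : ℝ, ∀ s ∈ Icc (0 : ℝ) 1, ∀ t ∈ Icc (0 : ℝ) 1,
      |(R.ρinv s * (R.K t - R.K s)).trace.re| ≤ C * |s - t| ^ 2 := by
  obtain ⟨J, G, κ, hG, hJ, hκ, hκK⟩ := h.exists_kappa hX
  obtain ⟨C₁, hC₁, -, hlip₁, -⟩ := hκ.exists_bound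
  obtain ⟨C₂, hC₂, -, hlip₂, -⟩ := (hG.twiceLipR (R.twiceLip_Mc m)).exists_bound
  set i₀ : S := Classical.arbitrary S
  let entry : Matrix S S ℂ →L[ℂ] ℂ := LinearMap.toContinuousLinearMap (entryLinearMap ℂ ℂ i₀ i₀)
  set ρ₀ := R.ρinv 0
  have hρ₀ : ρ₀.trace = 1 := (R.isInvariantState_ρinv ⟨le_rfl, zero_le_one⟩).1.2
  have hρJ : ∀ s ∈ Icc (0 : ℝ) 1, R.ρinv s = J s ρ₀ := fun s hs => by
    rw [hJ s hs, hρ₀, one_smul]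
  refine ⟨‖entry‖ * C₁ * (C₂ * ‖ρ₀‖), fun s hs t ht => ?_⟩
  have hst := (R.isInvariantState_ρinv hs).1
  have htt := (R.isInvariantState_ρinv ht).1
  have h1 := relEntropy_nonneg_of_posDef hst htt (h.posDef_ρinv ht)
  have h2 := relEntropy_nonneg_of_posDef htt hst (h.posDef_ρinv hs)
  set x := R.ρinv s - R.ρinv t with hx
  have hxt : x.trace = 0 := by rw [hx, trace_sub, hst.2, htt.2, sub_self]
  -- The symmetrized relative entropy is `Tr ((ρ_s - ρ_t)(K s - K t))`. The difference of states is
  -- traceless, so `κ` may replace `K`, and both factors are of order `|s - t|`.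
  have hsum : relEntropy (R.ρinv s) (R.ρinv t) + relEntropy (R.ρinv t) (R.ρinv s) =
      (entry ((κ s - κ t) x)).re := by
    rw [_root_.sub_apply, hκK s hs x hxt, hκK t ht x hxt, ← sub_smul, map_smul]
    have : entry (1 : Matrix S S ℂ) = 1 := by
      change (1 : Matrix S S ℂ) i₀ i₀ = 1
      simp
    rw [this, smul_eq_mul, mul_one, relEntropy, relEntropy, ← Complex.add_re, ← trace_add,
      ← trace_sub]
    congr 2
    change _ * (R.K s - R.K t) + _ * (R.K t - R.K s) = _
    rw [hx]
    noncomm_ring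
  have hneg : (R.ρinv s * (R.K t - R.K s)).trace.re = -relEntropy (R.ρinv s) (R.ρinv t) := by
    rw [relEntropy, ← Complex.neg_re, ← trace_neg, ← Matrix.mul_neg, neg_sub]
    rfl
  rw [hneg, abs_neg, abs_of_nonneg h1]
  have hxn : ‖x‖ ≤ C₂ * |s - t| * ‖ρ₀‖ := by
    rw [hx, hρJ s hs, hρJ t ht, ← _root_.sub_apply]
    exact (J s - J t).le_of_opNorm_le (hlip₂ s hs t ht) ρ₀
  calc relEntropy (R.ρinv s) (R.ρinv t) ≤ (entry ((κ s - κ t) x)).re := by linarith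
    _ ≤ ‖entry ((κ s - κ t) x)‖ := Complex.re_le_norm _
    _ ≤ ‖entry‖ * ((C₁ * |s - t|) * (C₂ * |s - t| * ‖ρ₀‖)) := by
        refine (entry.le_opNorm _).trans (mul_le_mul_of_nonneg_left ?_ (norm_nonneg _))
        exact ((κ s - κ t).le_of_opNorm_le (hlip₁ s hs t ht) x).trans
          (mul_le_mul_of_nonneg_left hxn (by positivity))
    _ = _ := by ring

/-- Split each state into the instantaneous invariant state, where the increment is of second order,
and a traceless rest, where `κ` represents `K` and summation by parts along the evolution applies.
-/
theorem Regular.tendsto_sum_trace_increments (h : R.Regular m)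
    (hX : ∀ s ∈ Icc (0 : ℝ) 1, R.X s = 0) {ρ : Matrix S S ℂ} (hρ : IsState ρ) :
    Tendsto (fun T : ℕ => ∑ j ∈ Finset.range T, (evol (R.Mc m) T j ρ *
      (R.K (((j + 1 : ℕ) : ℝ) / T) - R.K ((j : ℝ) / T))).trace.re) atTop (𝓝 0) := by
  obtain ⟨J, G, κ, hG, hJ, hκ, hκK⟩ := h.exists_kappa hX
  obtain ⟨B, hB⟩ := R.exists_norm_evol_le m
  have h1 := tendsto_sum_increments hG (R.twiceLip_Mc m) hB hκ
  obtain ⟨C, hC⟩ := h.exists_trace_increment_le hX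
  set i₀ : S := Classical.arbitrary S
  let entry : Matrix S S ℂ →L[ℂ] ℂ := LinearMap.toContinuousLinearMap (entryLinearMap ℂ ℂ i₀ i₀)
  have hent : entry (1 : Matrix S S ℂ) = 1 := by
    change (1 : Matrix S S ℂ) i₀ i₀ = 1
    simp
  let ev : (Matrix S S ℂ →L[ℂ] Matrix S S ℂ) →L[ℂ] Matrix S S ℂ :=
    ContinuousLinearMap.apply ℂ (Matrix S S ℂ) ρ
  have h2 : Tendsto (fun T : ℕ => (entry (ev (∑ k ∈ Finset.range T,
      (κ (((k + 1 : ℕ) : ℝ) / T) - κ ((k : ℝ) / T)) *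
        ((1 - J ((k : ℝ) / T)) * evol (R.Mc m) T k)))).re) atTop (𝓝 0) := by
    have hc : Continuous fun A => (entry (ev A)).re :=
      Complex.continuous_re.comp (entry.continuous.comp ev.continuous)
    have := (hc.tendsto 0).comp h1
    simp only [map_zero, Complex.zero_re] at this
    exact this
  have h3 : Tendsto (fun T : ℕ => ∑ j ∈ Finset.range T, (R.ρinv ((j : ℝ) / T) *
      (R.K (((j + 1 : ℕ) : ℝ) / T) - R.K ((j : ℝ) / T))).trace.re) atTop (𝓝 0) := by
    refine tendsto_zero_of_norm_le_div (D := C) fun T hT => ?_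
    refine (norm_sum_le_card_mul (c := C * (1 / T) ^ 2) fun j hj => ?_).trans (le_of_eq ?_)
    · have := hC _ (grid_mem hj.le) _ (grid_mem (T := T) (k := j + 1) hj)
      rwa [abs_sub_comm, grid_step] at this
    · have : (T : ℝ) ≠ 0 := by exact_mod_cast hT.ne'
      field_simp
  have h4 := h2.add h3
  rw [add_zero] at h4
  refine h4.congr fun T => ?_
  rw [map_sum, map_sum, Complex.re_sum, ← Finset.sum_add_distrib]
  refine Finset.sum_congr rfl fun j hj => ?_
  have hjT := Finset.mem_range.1 hj
  set y := evol (R.Mc m) T j ρ with hy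
  have hys : IsState y := R.isState_evol m hjT.le hρ
  have hs := grid_mem hjT.le
  have ht := grid_mem (T := T) (k := j + 1) hjT
  set s := (j : ℝ) / T
  set t := ((j + 1 : ℕ) : ℝ) / T
  have e : ev ((κ t - κ s) * ((1 - J s) * evol (R.Mc m) T j)) = κ t (y - J s y) - κ s (y - J s y) :=
    rfl
  have hJy : J s y = R.ρinv s := by rw [hJ s hs, hys.2, one_smul]
  have htr : (y - R.ρinv s).trace = 0 := by
    rw [trace_sub, hys.2, (R.isInvariantState_ρinv hs).1.2, sub_self]
  rw [e, hJy, hκK s hs _ htr, hκK t ht _ htr, ← sub_smul, map_smul, hent, smul_eq_mul, mul_one,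
    ← trace_sub, ← Complex.add_re, ← trace_add]
  congr 2
  noncomm_ring

/-- The flux of block `j` is `Tr ((y_{j+1} - y_j) K)` with `K` taken at `(j + 1) / T`. Telescoping
`Tr (y_j K(j / T))` leaves exactly the sum of the increments of `K`. -/
theorem Regular.tendsto_totalEntropyProd_sub (h : R.Regular m)
    (hX : ∀ s ∈ Icc (0 : ℝ) 1, R.X s = 0) {ρ : Matrix S S ℂ} (hρ : IsState ρ) :
    Tendsto (fun T : ℕ => R.totalEntropyProd m ρ T -
      (R.free 0 ρ - R.free 1 (evol (R.Mc m) T T ρ))) atTop (𝓝 0) := by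
  have h1 := (h.tendsto_sum_trace_increments hX hρ).neg
  rw [neg_zero] at h1
  refine h1.congr' ?_
  filter_upwards [eventually_gt_atTop 0] with T hT
  have hsum : ∑ j ∈ Finset.range T,
      (R.fluxSum m (((j + 1 : ℕ) : ℝ) / T) (evol (R.Mc m) T j ρ)).re =
      (evol (R.Mc m) T T ρ * R.K 1).trace.re - (ρ * R.K 0).trace.re -
      ∑ j ∈ Finset.range T, (evol (R.Mc m) T j ρ *
        (R.K (((j + 1 : ℕ) : ℝ) / T) - R.K ((j : ℝ) / T))).trace.re := by
    have e := Finset.sum_range_sub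
      (fun j : ℕ => (evol (R.Mc m) T j ρ * R.K ((j : ℝ) / T)).trace.re) T
    have e0 : evol (R.Mc m) T 0 ρ = ρ := rfl
    simp only [Nat.cast_zero, zero_div, e0, div_self (show (T : ℝ) ≠ 0 by exact_mod_cast hT.ne')] at e
    rw [← e, ← Finset.sum_sub_distrib]
    refine Finset.sum_congr rfl fun j hj => ?_
    have ht := grid_mem (T := T) (k := j + 1) (Finset.mem_range.1 hj)
    rw [h.fluxSum_eq ht (hX _ ht), evol_succ_apply, Matrix.mul_sub, trace_sub]
    simp only [Complex.sub_re]
    ring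
  rw [R.totalEntropyProd_eq m hρ, hsum, free, free]
  ring

theorem continuousOn_free (R : ADRIS S E) (s : ℝ) :
    ContinuousOn (R.free s) {ρ | IsState ρ} := by
  refine continuousOn_negEntropy.sub (Continuous.continuousOn ?_)
  exact Complex.continuous_re.comp
    (Continuous.matrix_trace (continuous_id.matrix_mul continuous_const))

/-- When `X s = 0`, the decrease of `free` in one interaction is exactly its entropy production,
which is nonnegative. -/
theorem Regular.free_L_le (h : R.Regular m) {s : ℝ} (hs : s ∈ Icc (0 : ℝ) 1) (hX : R.X s = 0)
    {ρ : Matrix S S ℂ} (hρ : IsState ρ) : R.free s (R.L s ρ) ≤ R.free s ρ := by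
  have h1 := (R.isDilation hs).hsq_le_relEntropy hρ
  have h2 : 0 ≤ relEntropy (R.U s * (ρ ⊗ₖ R.ξ s) * (R.U s)ᴴ) (R.L s ρ ⊗ₖ R.ξ s) :=
    (div_nonneg (hsq_nonneg _) two_pos.le).trans h1
  rw [R.relEntropy_eq_flux hs hρ, h.flux_eq hs hX, Complex.sub_re] at h2
  rw [free, free]
  linarith

theorem Regular.antitone_free (h : R.Regular m) {s : ℝ} (hs : s ∈ Icc (0 : ℝ) 1) (hX : R.X s = 0)
    {ρ : Matrix S S ℂ} (hρ : IsState ρ) : Antitone fun k : ℕ => R.free s ((R.L s ^ k) ρ) := by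
  refine antitone_nat_of_succ_le fun k => ?_
  rw [pow_succ']
  exact h.free_L_le hs hX (R.isState_L_pow hs hρ k)

theorem free_ρinv (R : ADRIS S E) (s : ℝ) : R.free s (R.ρinv s) = 0 := sub_self _

/-- Without correlations in the instantaneous invariant states, the total entropy production
converges; the limit vanishes if the system starts from the invariant state. -/
theorem Regular.exists_tendsto_totalEntropyProd (h : R.Regular m)
    (hX : ∀ s ∈ Icc (0 : ℝ) 1, R.X s = 0) {ρ : Matrix S S ℂ} (hρ : IsState ρ) :
    ∃ σ : ℝ, Tendsto (R.totalEntropyProd m ρ) atTop (𝓝 σ) ∧ (ρ = R.ρinv 0 → σ = 0) := by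
  obtain ⟨n, C, ℓ, B, hn, h0, h1, hPP, hMP, hMn, hQ, hP⟩ := h.exists_spectral_data
  obtain ⟨B', hB'⟩ := R.exists_norm_evol_le m
  obtain ⟨W, hW, hlim, hfix⟩ := exists_adiabatic_limit (𝔸 := Matrix S S ℂ →L[ℂ] Matrix S S ℂ)
    (M := R.Mc m) (P := R.Pc m) hn (R.twiceLip_Mc m) hPP hMP hMn h0 h1 hQ hP hB'
  have one_mem : (1 : ℝ) ∈ Icc (0 : ℝ) 1 := ⟨zero_le_one, le_rfl⟩
  have zero_mem : (0 : ℝ) ∈ Icc (0 : ℝ) 1 := ⟨le_rfl, zero_le_one⟩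
  set ω := W ρ with hω
  have hMk : ∀ k : ℕ, (R.Mc m 1 ^ k * W) ρ = (R.L 1 ^ (m * k)) ω := by
    intro k
    rw [Mc, ← pow_mul, ← Lc_pow_apply]
    rfl
  have hlim' : Tendsto (fun T => evol (R.Mc m) T T ρ - (R.L 1 ^ (m * T)) ω) atTop (𝓝 0) := by
    have hc := (ContinuousLinearMap.apply ℂ (Matrix S S ℂ) ρ).continuous
    have := (hc.tendsto (0 : Matrix S S ℂ →L[ℂ] Matrix S S ℂ)).comp hlim
    rw [map_zero] at this
    refine this.congr fun T => ?_
    rw [← hMk]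
    rfl
  have hper1 : (R.L 1 ^ (m * n)) ω = ω := by
    rw [← hMk, hW]
  have hper : ∀ q : ℕ, (R.L 1 ^ (m * n * q)) ω = ω := by
    intro q
    induction q with
    | zero => rfl
    | succ q ih => rw [Nat.mul_succ, pow_add, Module.End.mul_apply, hper1, ih]
  -- Along `T = n q` the periodic orbit returns to `ω`, which is therefore a limit of evolved
  -- states.
  have hst : IsState ω := by
    have h2 : Tendsto (fun q : ℕ => n * q) atTop atTop :=
      tendsto_id.const_mul_atTop' hn
    have h3 := (hlim'.comp h2).add_const ω
    rw [zero_add] at h3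
    refine isClosed_isState.mem_of_tendsto (h3.congr fun q => ?_) (Eventually.of_forall fun q =>
      R.isState_evol m (le_refl (n * q)) hρ)
    simp only [Function.comp_apply]
    rw [← mul_assoc, hper, sub_add_cancel]
  -- A sequence that is both nonincreasing and periodic is constant.
  have hconst : ∀ T : ℕ, R.free 1 ((R.L 1 ^ (m * T)) ω) = R.free 1 ω := by
    intro T
    have ha := h.antitone_free one_mem (hX 1 one_mem) hst
    have h3 : R.free 1 ((R.L 1 ^ (m * T)) ω) ≤ R.free 1 ((R.L 1 ^ 0) ω) := ha (Nat.zero_le _)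
    rw [pow_zero, Module.End.one_apply] at h3
    refine le_antisymm h3 ?_
    have h2 : R.free 1 ((R.L 1 ^ (m * n * T)) ω) ≤ R.free 1 ((R.L 1 ^ (m * T)) ω) := ha (show m * T ≤ m * n * T from by
      rw [mul_assoc]; exact Nat.mul_le_mul_left _ (Nat.le_mul_of_pos_left _ hn))
    rwa [hper] at h2
  have h2 := tendsto_sub_of_continuousOn_isState (f := R.free 1)
    (x := fun T => evol (R.Mc m) T T ρ) (y := fun T => (R.L 1 ^ (m * T)) ω) (R.continuousOn_free 1)
    (fun T => R.isState_evol m (le_refl T) hρ) (fun T => R.isState_L_pow one_mem hst (m * T)) hlim'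
  have h3 := (h.tendsto_totalEntropyProd_sub hX hρ).sub h2
  refine ⟨R.free 0 ρ - R.free 1 ω, ?_, fun hρ0 => ?_⟩
  · have h4 := h3.add_const (R.free 0 ρ - R.free 1 ω)
    rw [sub_zero, zero_add] at h4
    refine h4.congr fun T => ?_
    rw [hconst]
    ring
  -- The adiabatic limit respects fixed points in the operator algebra, so it is applied to the
  -- projection `J 0`, which fixes `ρ`. Then `ω` is invariant under the `m`-th power of `L(1)`.
  · obtain ⟨J, G, hG, hJ⟩ := h.exists_redRes
    have e := DFunLike.congr_fun (hfix (J 0) (hG.MR 0 zero_mem)) ρ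
    have hJρ : J 0 ρ = ρ := by rw [hJ 0 zero_mem, hρ.2, one_smul, hρ0]
    have e2 : (R.L 1 ^ m) ω = ω := by
      have e3 : R.Mc m 1 (W (J 0 ρ)) = W (J 0 ρ) := e
      rwa [hJρ, Mc_apply] at e3
    have e4 : ω = R.ρinv 1 := by rw [h.fixed 1 one_mem ω e2, hst.2, one_smul]
    rw [e4, hρ0, free_ρinv, free_ρinv, sub_zero]

end ADRIS

end RIS

end

noncomputable section

namespace RIS

open Filter Set Matrix
open scoped Matrix.Norms.L2Operator

/-! ### Divergence of the total entropy production -/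

namespace ADRIS

variable {S E : Type*} [Fintype S] [DecidableEq S] [Fintype E] [DecidableEq E]

/-- The correlations with the probe created by one interaction. -/
def corr (R : ADRIS S E) (s : ℝ) : Matrix S S ℂ →L[ℂ] Matrix (S × E) (S × E) ℂ :=
  LinearMap.toContinuousLinearMap
    { toFun := fun A => R.U s * (A ⊗ₖ R.ξ s) * (R.U s)ᴴ - R.L s A ⊗ₖ R.ξ s
      map_add' := fun A B => by
        simp only [add_kronecker, Matrix.mul_add, Matrix.add_mul, map_add]
        abel
      map_smul' := fun c A => by
        simp only [smul_kronecker, Matrix.mul_smul, Matrix.smul_mul, map_smul, smul_sub,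
          RingHom.id_apply] }

theorem corr_apply (R : ADRIS S E) (s : ℝ) (A : Matrix S S ℂ) :
    R.corr s A = R.U s * (A ⊗ₖ R.ξ s) * (R.U s)ᴴ - R.L s A ⊗ₖ R.ξ s := rfl

variable [Nonempty E]

theorem contDiffOn_L_kronecker (R : ADRIS S E) (A : Matrix S S ℂ) :
    ContDiffOn ℝ 2 (fun s => R.L s A ⊗ₖ R.ξ s) (Icc 0 1) := by
  have h1 : ContDiffOn ℝ 2 (fun s => R.L s A ⊗ₖ (1 : Matrix E E ℂ)) (Icc 0 1) :=
    contDiffOn_linearMap_comp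
      ({ toFun := fun C => C ⊗ₖ (1 : Matrix E E ℂ)
         map_add' := fun C D => add_kronecker C D 1
         map_smul' := fun c C => smul_kronecker c C 1 } : Matrix S S ℂ →ₗ[ℂ] _) (R.contDiffOn_L A)
  have h2 := h1.mul (contDiffOn_kronecker_right (1 : Matrix S S ℂ) R.contDiffOn_ξ)
  refine h2.congr fun s _ => ?_
  rw [← mul_kronecker_mul, Matrix.mul_one, Matrix.one_mul]

theorem twiceLip_corr (R : ADRIS S E) : TwiceLip R.corr :=
  twiceLip_of_apply fun A => twiceLip_of_contDiffOn
    ((R.contDiffOn_dilate A).sub (R.contDiffOn_L_kronecker A))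

variable [Nonempty S] {R : ADRIS S E} {m : ℕ}

theorem corr_ρinv (R : ADRIS S E) {s : ℝ} (hs : s ∈ Icc (0 : ℝ) 1) :
    R.corr s (R.ρinv s) = R.X s := by
  rw [corr_apply, (R.isInvariantState_ρinv hs).2, X]

theorem relEntropy_dilate_nonneg (R : ADRIS S E) {s : ℝ} (hs : s ∈ Icc (0 : ℝ) 1)
    {ρ : Matrix S S ℂ} (hρ : IsState ρ) :
    hsq (R.corr s ρ) / 2 ≤
      relEntropy (R.U s * (ρ ⊗ₖ R.ξ s) * (R.U s)ᴴ) (R.L s ρ ⊗ₖ R.ξ s) :=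
  (R.isDilation hs).hsq_le_relEntropy hρ

/-- Only the first interaction of each block is kept; this is where `m ≥ 1` matters. All other terms
are nonnegative. -/
theorem sum_hsq_le_totalEntropyProd (R : ADRIS S E) (hm : 1 ≤ m) {ρ : Matrix S S ℂ}
    (hρ : IsState ρ) (T : ℕ) :
    ∑ j ∈ Finset.range T, hsq (R.corr (((j + 1 : ℕ) : ℝ) / T) (evol (R.Mc m) T j ρ)) / 2 ≤
      R.totalEntropyProd m ρ T := by
  rw [totalEntropyProd_eq_sum]
  refine Finset.sum_le_sum fun j hj => ?_
  have hjT := Finset.mem_range.1 hj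
  have hs := grid_mem (T := T) (k := j + 1) hjT
  have hy := R.isState_evol m hjT.le hρ
  have h0 : ∀ i ∈ Finset.range m, 0 ≤ R.entropyProd m T ρ (m * j + i + 1) := by
    intro i hi
    rw [R.entropyProd_block (Finset.mem_range.1 hi)]
    exact (div_nonneg (hsq_nonneg _) two_pos.le).trans
      (R.relEntropy_dilate_nonneg hs (R.isState_L_pow hs hy i))
  refine le_trans ?_ (Finset.single_le_sum h0 (Finset.mem_range.2 (show 0 < m by omega)))
  rw [R.entropyProd_block (m := m) (i := 0) (by omega)]
  exact R.relEntropy_dilate_nonneg hs hy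

/-- A state that is almost invariant is correlated with the probe by an interaction. -/
theorem Regular.exists_pos_le (h : R.Regular m) {s : ℝ} (hs : s ∈ Icc (0 : ℝ) 1)
    (hX : R.X s ≠ 0) : ∃ c > 0, ∀ ρ, IsState ρ → c ≤ ‖R.Mc m s ρ - ρ‖ + ‖R.corr s ρ‖ := by
  have hc : ContinuousOn (fun ρ => ‖R.Mc m s ρ - ρ‖ + ‖R.corr s ρ‖) {ρ | IsState ρ} := by
    refine Continuous.continuousOn ?_
    exact (((R.Mc m s).continuous.sub continuous_id).norm).add (R.corr s).continuous.norm
  -- A minimizer with value zero would be invariant, hence equal to `ρ_s^inv`, and uncorrelated,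
  -- contradicting `X s ≠ 0`.
  obtain ⟨ρ₀, hρ₀, hmin⟩ := isCompact_isState.exists_isMinOn (exists_isState (ι := S)) hc
  refine ⟨‖R.Mc m s ρ₀ - ρ₀‖ + ‖R.corr s ρ₀‖, ?_, fun ρ hρ => hmin hρ⟩
  by_contra hneg
  push Not at hneg
  have h1 : ‖R.Mc m s ρ₀ - ρ₀‖ = 0 := by
    have := norm_nonneg (R.Mc m s ρ₀ - ρ₀); have := norm_nonneg (R.corr s ρ₀); linarith
  have h2 : ‖R.corr s ρ₀‖ = 0 := by
    have := norm_nonneg (R.Mc m s ρ₀ - ρ₀); have := norm_nonneg (R.corr s ρ₀); linarith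
  have h3 : (R.L s ^ m) ρ₀ = ρ₀ := by
    rw [← Mc_apply]; exact sub_eq_zero.1 (norm_eq_zero.1 h1)
  have h4 := h.fixed s hs ρ₀ h3
  rw [hρ₀.2, one_smul] at h4
  rw [h4, R.corr_ρinv hs] at h2
  exact hX (norm_eq_zero.1 h2)

theorem norm_sub_apply_le {V W : Type*} [NormedAddCommGroup V] [NormedSpace ℂ V]
    [NormedAddCommGroup W] [NormedSpace ℂ W] {f g : V →L[ℂ] W} {x : V} {C D δ r : ℝ} (hC : 0 ≤ C)
    (hfg : ‖f - g‖ ≤ C * |r|) (hr : |r| ≤ δ) (hx : ‖x‖ ≤ D) : ‖(f - g) x‖ ≤ C * δ * D :=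
  ((f - g).le_opNorm _).trans (mul_le_mul (hfg.trans (mul_le_mul_of_nonneg_left hr hC)) hx
    (norm_nonneg _) (mul_nonneg hC ((abs_nonneg _).trans hr)))

/-- Averaging over a window of parameters close to `s`. -/
theorem le_sum_norm_corr {c C D δ s : ℝ}
    (hc : ∀ ρ, IsState ρ → c ≤ ‖R.Mc m s ρ - ρ‖ + ‖R.corr s ρ‖)
    (hD : ∀ ρ : Matrix S S ℂ, IsState ρ → ‖ρ‖ ≤ D) (hC0 : 0 ≤ C)
    (hM : ∀ t ∈ Icc (0 : ℝ) 1, ‖R.Mc m s - R.Mc m t‖ ≤ C * |s - t|)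
    (hF : ∀ t ∈ Icc (0 : ℝ) 1, ‖R.corr s - R.corr t‖ ≤ C * |s - t|)
    {N : ℕ} (hN : 0 < N) {t : ℕ → ℝ} (ht : ∀ i < N, t i ∈ Icc (0 : ℝ) 1 ∧ |s - t i| ≤ δ)
    {y : ℕ → Matrix S S ℂ} (hy : ∀ i ≤ N, IsState (y i))
    (hstep : ∀ i < N, y (i + 1) = R.Mc m (t i) (y i)) :
    N * (c - 2 * (C * δ * D)) - 2 * D ≤ ∑ i ∈ Finset.range N, ‖R.corr (t i) (y i)‖ := by
  set A := ∑ i ∈ Finset.range N, y i with hA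
  have hN' : (0 : ℝ) < N := by exact_mod_cast hN
  have h1 := hc _ (isState_average hN fun k hk => hy k hk.le)
  rw [← hA, map_smul, map_smul, ← smul_sub, norm_smul, norm_smul, norm_inv, Complex.norm_natCast,
    ← mul_add, inv_mul_eq_div, le_div_iff₀ hN'] at h1
  -- With the parameters of the window in place of `s` this difference telescopes to `y N - y 0`;
  -- each replacement costs `C δ D`.
  have h2 : ‖R.Mc m s A - A‖ ≤ N * (C * δ * D) + 2 * D := by
    have e : R.Mc m s A - A = ∑ i ∈ Finset.range N, (R.Mc m s - R.Mc m (t i)) (y i) +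
        (y N - y 0) := by
      rw [← Finset.sum_range_sub, hA, map_sum, ← Finset.sum_sub_distrib, ← Finset.sum_add_distrib]
      refine Finset.sum_congr rfl fun i hi => ?_
      rw [hstep i (Finset.mem_range.1 hi), _root_.sub_apply]
      abel
    rw [e]
    refine (norm_add_le _ _).trans (add_le_add (norm_sum_le_card_mul fun i hi =>
      norm_sub_apply_le hC0 (hM _ (ht i hi).1) (ht i hi).2 (hD _ (hy i hi.le))) ?_)
    have := norm_sub_le (y N) (y 0)
    have := hD _ (hy N le_rfl)
    have := hD _ (hy 0 hN.le)
    linarith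
  have h3 : ‖R.corr s A‖ ≤ N * (C * δ * D) + ∑ i ∈ Finset.range N, ‖R.corr (t i) (y i)‖ := by
    have e : R.corr s A = ∑ i ∈ Finset.range N, (R.corr s - R.corr (t i)) (y i) +
        ∑ i ∈ Finset.range N, R.corr (t i) (y i) := by
      rw [hA, map_sum, ← Finset.sum_add_distrib]
      refine Finset.sum_congr rfl fun i hi => ?_
      rw [_root_.sub_apply, sub_add_cancel]
    rw [e]
    exact (norm_add_le _ _).trans (add_le_add (norm_sum_le_card_mul fun i hi =>
      norm_sub_apply_le hC0 (hF _ (ht i hi).1) (ht i hi).2 (hD _ (hy i hi.le)))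
      (norm_sum_le _ _))
  linarith

theorem exists_window {s δ : ℝ} (hs : s ∈ Icc (0 : ℝ) 1) (hδ : 0 < δ) (hδ' : δ ≤ 1 / 2) :
    ∃ p : ℝ, 0 ≤ p ∧ p + δ ≤ 1 ∧ p ≤ s ∧ s ≤ p + δ := by
  rcases le_total s (1 / 2) with h | h
  · exact ⟨s, hs.1, by linarith, le_rfl, by linarith⟩
  · exact ⟨s - δ, by linarith, by linarith [hs.2], by linarith, by linarith⟩

/-- If an instantaneous invariant state gets correlated with the probe, then the total entropy
production diverges. -/
theorem Regular.tendsto_totalEntropyProd_atTop (h : R.Regular m) {s : ℝ} (hs : s ∈ Icc (0 : ℝ) 1)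
    (hX : R.X s ≠ 0) {ρ : Matrix S S ℂ} (hρ : IsState ρ) :
    Tendsto (R.totalEntropyProd m ρ) atTop atTop := by
  obtain ⟨c, hc0, hc⟩ := h.exists_pos_le hs hX
  obtain ⟨C₁, hC₁, -, hlip₁, -⟩ := (R.twiceLip_Mc m).exists_bound
  obtain ⟨C₂, hC₂, -, hlip₂, -⟩ := R.twiceLip_corr.exists_bound
  obtain ⟨D₀, hD₀⟩ := exists_norm_isState_le (ι := S)
  obtain ⟨C₀, hC₀, hnorm⟩ := exists_norm_equiv_hsq (ι := S × E)
  set C := C₁ + C₂ with hC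
  have hCpos : 0 < C := by positivity
  set D := max D₀ 1 with hDdef
  have hDpos : 0 < D := lt_max_of_lt_right one_pos
  have hD : ∀ ρ : Matrix S S ℂ, IsState ρ → ‖ρ‖ ≤ D := fun ρ hρ => (hD₀ ρ hρ).trans (le_max_left _ _)
  -- The second bound keeps each freezing error below `c / 8`; the `1 / 2` lets a window of length
  -- `δ` fit into `[0,1]` on one side of `s`.
  set δ := min (1 / 2) (c / (8 * (C * D))) with hδdef
  have hδ : 0 < δ := lt_min (by norm_num) (by positivity)
  have hδc : C * δ * D ≤ c / 8 := by
    have : δ ≤ c / (8 * (C * D)) := min_le_right _ _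
    rw [le_div_iff₀ (by positivity)] at this
    linarith
  obtain ⟨p, hp0, hp1, hps, hsp⟩ := exists_window hs hδ (min_le_left _ _)
  have key : ∀ᶠ T : ℕ in atTop, (δ * T - 1) * (c ^ 2 / (8 * C₀)) ≤ R.totalEntropyProd m ρ T := by
    -- The window contains more than `δ T - 1` grid points, so this forces `8 D < N c`. The boundary
    -- term `2 D` is then below `N c / 4`, and with the freezing errors, also at most `N c / 4`,
    -- half of `N c` remains.
    have hTlarge : ∀ᶠ T : ℕ in atTop, 8 * D / c + 1 < δ * T := by
      have : Tendsto (fun T : ℕ => δ * (T : ℝ)) atTop atTop :=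
        tendsto_natCast_atTop_atTop.const_mul_atTop hδ
      exact this.eventually_gt_atTop _
    filter_upwards [hTlarge, eventually_gt_atTop 0] with T hT hT0
    have hTr : (0 : ℝ) < T := by exact_mod_cast hT0
    set a := ⌊p * T⌋₊ with ha
    set b := ⌊(p + δ) * T⌋₊ with hb
    have ha1 : (a : ℝ) ≤ p * T := Nat.floor_le (by positivity)
    have ha2 : p * T < a + 1 := Nat.lt_floor_add_one _
    have hb1 : (b : ℝ) ≤ (p + δ) * T := Nat.floor_le (by positivity)
    have hb2 : (p + δ) * T < b + 1 := Nat.lt_floor_add_one _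
    have hbT : b ≤ T := by
      have : (b : ℝ) ≤ T := hb1.trans (by nlinarith)
      exact_mod_cast this
    have hgap : δ * T - 1 < (b : ℝ) - a := by nlinarith
    have hab : a < b := by
      have h8 : 0 < 8 * D / c := by positivity
      have : (a : ℝ) < b := by linarith
      exact_mod_cast this
    obtain ⟨N, hN⟩ : ∃ N, b = a + N := ⟨b - a, by omega⟩
    have hN0 : 0 < N := by omega
    have hNr : (b : ℝ) - a = N := by rw [hN]; push_cast; ring
    have hNpos : (0 : ℝ) < N := by exact_mod_cast hN0
    set y : ℕ → Matrix S S ℂ := fun i => evol (R.Mc m) T (a + i) ρ with hy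
    set t : ℕ → ℝ := fun i => ((a + i + 1 : ℕ) : ℝ) / T with ht
    have hyst : ∀ i ≤ N, IsState (y i) := fun i hi => R.isState_evol m (by omega) hρ
    have htm : ∀ i < N, t i ∈ Icc (0 : ℝ) 1 ∧ |s - t i| ≤ δ := by
      intro i hi
      refine ⟨grid_mem (by omega), ?_⟩
      have e1 : p ≤ t i := by
        rw [ht]; simp only
        rw [le_div_iff₀ hTr]; push_cast
        have : (0 : ℝ) ≤ i := Nat.cast_nonneg _
        linarith
      have e2 : t i ≤ p + δ := by
        rw [ht]; simp only
        rw [div_le_iff₀ hTr]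
        have : ((a + i + 1 : ℕ) : ℝ) ≤ b := by exact_mod_cast (by omega : a + i + 1 ≤ b)
        linarith
      rw [abs_le]; constructor <;> linarith
    have hsum := le_sum_norm_corr (R := R) (m := m) hc hD hCpos.le
      (fun t ht => (hlip₁ s hs t ht).trans (mul_le_mul_of_nonneg_right (by linarith) (abs_nonneg _)))
      (fun t ht => (hlip₂ s hs t ht).trans (mul_le_mul_of_nonneg_right (by linarith) (abs_nonneg _)))
      hN0 htm hyst fun i _ => rfl
    have h8 : 8 * D < N * c := by
      have : 8 * D / c < N := by linarith
      rwa [div_lt_iff₀ hc0] at this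
    have hsum2 : N * c / 2 ≤ ∑ i ∈ Finset.range N, ‖R.corr (t i) (y i)‖ := by
      have : N * (C * δ * D) ≤ N * (c / 8) := mul_le_mul_of_nonneg_left hδc hNpos.le
      nlinarith
    have hsq1 : (N * c / 2) ^ 2 ≤ N * ∑ i ∈ Finset.range N, ‖R.corr (t i) (y i)‖ ^ 2 := by
      refine (pow_le_pow_left₀ (by positivity) hsum2 2).trans ?_
      simpa using sq_sum_le_card_mul_sum_sq (s := Finset.range N)
        (f := fun i => ‖R.corr (t i) (y i)‖)
    have hsq2 : N * c ^ 2 / 4 ≤ ∑ i ∈ Finset.range N, ‖R.corr (t i) (y i)‖ ^ 2 := by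
      have : N * (N * c ^ 2 / 4) ≤ N * ∑ i ∈ Finset.range N, ‖R.corr (t i) (y i)‖ ^ 2 := by
        refine le_trans (le_of_eq ?_) hsq1
        ring
      exact le_of_mul_le_mul_left this hNpos
    have hsq3 : ∑ i ∈ Finset.range N, ‖R.corr (t i) (y i)‖ ^ 2 ≤
        2 * C₀ * ∑ j ∈ Finset.range T,
          hsq (R.corr (((j + 1 : ℕ) : ℝ) / T) (evol (R.Mc m) T j ρ)) / 2 := by
      set f : ℕ → ℝ := fun j => hsq (R.corr (((j + 1 : ℕ) : ℝ) / T) (evol (R.Mc m) T j ρ)) / 2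
        with hf
      have hf0 : ∀ j, 0 ≤ f j := fun j => div_nonneg (hsq_nonneg _) two_pos.le
      have e1 : ∑ i ∈ Finset.range N, f (a + i) ≤ ∑ j ∈ Finset.range T, f j := by
        calc ∑ i ∈ Finset.range N, f (a + i)
            ≤ ∑ j ∈ Finset.range a, f j + ∑ i ∈ Finset.range N, f (a + i) :=
              le_add_of_nonneg_left (Finset.sum_nonneg fun j _ => hf0 j)
          _ = ∑ j ∈ Finset.range (a + N), f j := (Finset.sum_range_add _ _ _).symm
          _ ≤ _ := Finset.sum_le_sum_of_subset_of_nonneg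
              (Finset.range_subset_range.2 (by omega)) fun j _ _ => hf0 j
      refine le_trans ?_ (mul_le_mul_of_nonneg_left e1 (by positivity))
      rw [Finset.mul_sum]
      refine Finset.sum_le_sum fun i _ => ?_
      refine ((hnorm _).1).trans (le_of_eq ?_)
      rw [hf]; simp only [hy, ht]
      ring
    have hfin := R.sum_hsq_le_totalEntropyProd h.one_le hρ T
    have hfin2 : N * c ^ 2 / 4 ≤ 2 * C₀ * R.totalEntropyProd m ρ T :=
      (hsq2.trans hsq3).trans (mul_le_mul_of_nonneg_left hfin (by positivity))
    calc (δ * T - 1) * (c ^ 2 / (8 * C₀)) ≤ N * (c ^ 2 / (8 * C₀)) :=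
          mul_le_mul_of_nonneg_right (by linarith) (by positivity)
      _ = (N * c ^ 2 / 4) / (2 * C₀) := by field_simp; ring
      _ ≤ _ := by rw [div_le_iff₀ (by positivity)]; linarith
  refine tendsto_atTop_mono' atTop key ?_
  refine Tendsto.atTop_mul_const (by positivity) ?_
  exact tendsto_atTop_add_const_right _ _ (tendsto_natCast_atTop_atTop.const_mul_atTop hδ)

end ADRIS

theorem exists_ne_zero_of_iSup_traceNorm_pos {α ι : Type*} [Nonempty α] [Fintype ι] [DecidableEq ι]
    {f : α → Matrix ι ι ℂ} (h : 0 < ⨆ a, traceNorm (f a)) : ∃ a, f a ≠ 0 := by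
  obtain ⟨a, ha⟩ := exists_lt_of_lt_ciSup h
  refine ⟨a, fun h0 => ?_⟩
  have h1 := traceNorm_sq_le (f a)
  rw [h0] at h1 ha
  have h2 : hsq (0 : Matrix ι ι ℂ) = 0 := by simp [hsq]
  rw [h2, mul_zero] at h1
  nlinarith

end RIS

end

noncomputable section

namespace RIS

open Filter Set Matrix
open scoped Matrix.Norms.L2Operator

/-! ### A system with non-zero limit of the total entropy production -/

section Tools

variable {ι : Type*} [Fintype ι] [DecidableEq ι]

theorem negEntropy_diagonal (a : ι → ℝ) :
    negEntropy (diagonal fun i => (a i : ℂ)) = ∑ i, a i * Real.log (a i) := by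
  have h := cfc_conj_diagonal (W := (1 : Matrix ι ι ℂ)) (by simp) (by simp) a Real.log
  simp only [conjTranspose_one, Matrix.one_mul, Matrix.mul_one] at h
  rw [negEntropy, h, diagonal_mul_diagonal, trace_diagonal, ← Complex.ofReal_re (∑ i, _)]
  push_cast
  rfl

/-- In an eigenbasis of `A* A` the columns of `A W` have the singular values as norms. The trace is
the sum of their inner products with the unit columns of `W`, so Cauchy-Schwarz applies columnwise.
-/
theorem norm_trace_le_traceNorm (A : Matrix ι ι ℂ) : ‖A.trace‖ ≤ traceNorm A := by
  have hp := posSemidef_conjTranspose_mul_self A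
  obtain ⟨W, a, h1, h2, eA, hf, ha, -⟩ := exists_diag hp.1
  have ht : traceNorm A = ∑ i, √(a i) := by
    rw [traceNorm, hf, trace_mul_comm, ← Matrix.mul_assoc, h2, Matrix.one_mul, trace_diagonal]
    simp
  set B := A * W with hB
  have hBB : Bᴴ * B = diagonal fun i => (a i : ℂ) := by
    calc Bᴴ * B = Wᴴ * (Aᴴ * A) * W := by
          rw [hB, conjTranspose_mul]; simp only [Matrix.mul_assoc]
      _ = (Wᴴ * W) * diagonal (fun i => (a i : ℂ)) * (Wᴴ * W) := by
          rw [eA]; simp only [Matrix.mul_assoc]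
      _ = _ := by rw [h2]; simp
  have htr : A.trace = ∑ i, ∑ k, star (W k i) * B k i := by
    have : A.trace = (Wᴴ * B).trace := by
      rw [hB, ← Matrix.mul_assoc, trace_mul_comm, ← Matrix.mul_assoc, h1, Matrix.one_mul]
    rw [this]; rfl
  have hcol : ∀ (M : Matrix ι ι ℂ) (i : ι), ((Mᴴ * M) i i) = ((∑ k, ‖M k i‖ ^ 2 : ℝ) : ℂ) := by
    intro M i
    rw [mul_apply]
    push_cast
    refine Finset.sum_congr rfl fun k _ => ?_
    have := Complex.conj_mul' (M k i)
    simpa using this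
  rw [htr, ht]
  refine (norm_sum_le _ _).trans (Finset.sum_le_sum fun i _ => ?_)
  have e1 : ∑ k, ‖W k i‖ ^ 2 = 1 := by
    have := hcol W i
    rw [h2, one_apply_eq] at this
    exact_mod_cast this.symm
  have e2 : ∑ k, ‖B k i‖ ^ 2 = a i := by
    have := hcol B i
    rw [hBB, diagonal_apply_eq] at this
    exact_mod_cast this.symm
  calc ‖∑ k, star (W k i) * B k i‖ ≤ ∑ k, ‖W k i‖ * ‖B k i‖ :=
        (norm_sum_le _ _).trans (le_of_eq (Finset.sum_congr rfl fun k _ => by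
          rw [norm_mul, norm_star]))
    _ ≤ √(∑ k, ‖W k i‖ ^ 2) * √(∑ k, ‖B k i‖ ^ 2) := Real.sum_mul_le_sqrt_mul_sqrt _ _ _
    _ = √(a i) := by rw [e1, e2, Real.sqrt_one, one_mul]

theorem traceNorm_smul_one (c : ℂ) : traceNorm (c • (1 : Matrix ι ι ℂ)) = Fintype.card ι * ‖c‖ := by
  have e : (c • (1 : Matrix ι ι ℂ))ᴴ * (c • (1 : Matrix ι ι ℂ)) =
      1 * Matrix.diagonal (fun _ => ((‖c‖ ^ 2 : ℝ) : ℂ)) * (1 : Matrix ι ι ℂ)ᴴ := by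
    rw [conjTranspose_smul, conjTranspose_one, Matrix.smul_mul, Matrix.mul_smul, Matrix.one_mul,
      smul_smul, Matrix.one_mul, Matrix.mul_one, smul_one_eq_diagonal]
    congr 1
    ext i
    have := Complex.conj_mul' c
    simpa using this
  rw [traceNorm, e, cfc_conj_diagonal (by simp) (by simp)]
  simp

theorem traceNorm_zero : traceNorm (0 : Matrix ι ι ℂ) = 0 := by
  have := traceNorm_smul_one (ι := ι) 0
  simpa using this

/-- The exponential that maps an orthogonal projection to a reflection. -/
theorem exp_projection {p : Matrix ι ι ℂ} (hp : p.IsHermitian) (hpp : p * p = p) :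
    NormedSpace.exp ((-(Complex.I * Real.pi)) • p) = 1 - (2 : ℂ) • p := by
  obtain ⟨W, a, h1, h2, eA, -⟩ := exists_diag hp
  have ha : ∀ i, a i = 0 ∨ a i = 1 := by
    have e1 : Wᴴ * p * W = diagonal fun i => (a i : ℂ) := by
      rw [eA]
      calc _ = (Wᴴ * W) * diagonal (fun i => (a i : ℂ)) * (Wᴴ * W) := by
            simp only [Matrix.mul_assoc]
        _ = _ := by rw [h2]; simp
    have e2 : diagonal (fun i => (a i : ℂ)) * diagonal (fun i => (a i : ℂ)) =
        diagonal fun i => (a i : ℂ) := by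
      rw [← e1]
      calc _ = Wᴴ * p * (W * Wᴴ) * p * W := by simp only [Matrix.mul_assoc]
        _ = Wᴴ * (p * p) * W := by rw [h1]; simp only [Matrix.mul_assoc, Matrix.one_mul]
        _ = _ := by rw [hpp]
    intro i
    rw [diagonal_mul_diagonal] at e2
    have e3 := congrFun (diagonal_injective e2) i
    have e4 : a i * a i = a i := by exact_mod_cast e3
    have e5 : a i * (a i - 1) = 0 := by linarith
    rcases mul_eq_zero.1 e5 with h | h
    · exact .inl h
    · exact .inr (by linarith)
  have e : (fun i => Complex.exp (-(Complex.I * Real.pi) * a i)) =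
      fun i => 1 - 2 * (a i : ℂ) := by
    ext i
    rcases ha i with h | h
    · simp [h]
    · rw [h, Complex.ofReal_one, mul_one, Complex.exp_neg, mul_comm, Complex.exp_pi_mul_I]
      norm_num
  have e' : diagonal (fun i => 1 - 2 * (a i : ℂ)) =
      (1 : Matrix ι ι ℂ) - (2 : ℂ) • diagonal fun i => (a i : ℂ) := by
    rw [← diagonal_one, ← diagonal_smul, diagonal_sub]
    rfl
  conv_lhs => rw [eA]
  rw [exp_smul_conj_diagonal h1, e, e', Matrix.mul_sub, Matrix.sub_mul, Matrix.mul_one, h1,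
    Matrix.mul_smul, Matrix.smul_mul, ← eA]

theorem peripheralProj_of_idempotent {V : Type*} [AddCommGroup V] [Module ℂ V]
    [FiniteDimensional ℂ V] {Φ : Module.End ℂ V} (h : Φ * Φ = Φ) : peripheralProj Φ = Φ := by
  ext1 x
  have hc := isCompl_spectralSubspace Φ (Metric.sphere 0 1)
  have hΦ : ∀ y, Φ (Φ y) = Φ y := fun y => DFunLike.congr_fun h y
  have h1 : Φ x ∈ spectralSubspace Φ (Metric.sphere 0 1) := by
    refine (le_biSup (fun μ => Φ.maxGenEigenspace μ) (show (1 : ℂ) ∈ Metric.sphere 0 1 by simp)) ?_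
    rw [Module.End.mem_maxGenEigenspace]
    exact ⟨1, by simp [hΦ]⟩
  have h0 : x - Φ x ∈ spectralSubspace Φ (Metric.sphere 0 1)ᶜ := by
    refine (le_biSup (fun μ => Φ.maxGenEigenspace μ)
      (show (0 : ℂ) ∈ (Metric.sphere (0 : ℂ) 1)ᶜ by simp)) ?_
    rw [Module.End.mem_maxGenEigenspace]
    exact ⟨1, by simp [hΦ]⟩
  have e1 : peripheralProj Φ (Φ x) = Φ x := Submodule.projection_apply_of_mem_left hc h1
  have e0 : peripheralProj Φ (x - Φ x) = 0 := (Submodule.projection_apply_eq_zero_iff hc).2 h0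
  rw [map_sub, e1, sub_eq_zero] at e0
  exact e0

/-- The map to the maximally mixed state. -/
def depolarize : Module.End ℂ (Matrix (Fin 2) (Fin 2) ℂ) where
  toFun A := (A.trace / 2) • 1
  map_add' A B := by rw [trace_add, add_div, add_smul]
  map_smul' c A := by rw [trace_smul, smul_eq_mul, mul_div_assoc, ← smul_smul, RingHom.id_apply]

theorem depolarize_apply (A : Matrix (Fin 2) (Fin 2) ℂ) : depolarize A = (A.trace / 2) • 1 := rfl

theorem depolarize_mul_self : depolarize * depolarize = depolarize := by
  ext1 A
  rw [Module.End.mul_apply, depolarize_apply, depolarize_apply, trace_smul, trace_one]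
  simp

theorem depolarize_mul_contractingProj : depolarize * contractingProj depolarize = 0 := by
  rw [contractingProj, peripheralProj_of_idempotent depolarize_mul_self, mul_sub, mul_one,
    depolarize_mul_self, sub_self]

/-- The image of a nonzero projection is a nonzero multiple of the identity, which is supported in
no proper corner. -/
theorem isIrreducible_depolarize : IsIrreducible depolarize := by
  intro p hp h
  obtain ⟨B, hB⟩ := h 1
  by_cases h0 : p = 0
  · exact .inl h0
  refine .inr ?_
  have hpp : p * p = p := hp.1
  have hpH : pᴴ = p := hp.2
  have ht : p.trace ≠ 0 := by
    intro h1
    apply h0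
    rw [← trace_conjTranspose_mul_self_eq_zero_iff, hpH, hpp, h1]
  rw [Matrix.mul_one, hpp, depolarize_apply] at hB
  have h1 : p * ((p.trace / 2) • (1 : Matrix (Fin 2) (Fin 2) ℂ)) = (p.trace / 2) • 1 := by
    rw [hB, ← Matrix.mul_assoc, ← Matrix.mul_assoc, hpp]
  rw [Matrix.mul_smul, Matrix.mul_one] at h1
  exact smul_right_injective _ (div_ne_zero ht two_ne_zero) h1

theorem traceNorm_depolarize_le (A : Matrix (Fin 2) (Fin 2) ℂ) :
    traceNorm (depolarize A) ≤ traceNorm A := by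
  rw [depolarize_apply, traceNorm_smul_one]
  refine le_trans (le_of_eq ?_) (norm_trace_le_traceNorm A)
  simp
  ring

theorem depolarize_eq_one_of_mem {e : ℂ} (he : e ∈ spectrum ℂ depolarize ∩ Metric.sphere 0 1) :
    e = 1 := by
  obtain ⟨h1, h2⟩ := he
  rw [← Module.End.hasEigenvalue_iff_mem_spectrum] at h1
  obtain ⟨x, hx⟩ := h1.exists_hasEigenvector
  have hx1 : depolarize x = e • x := hx.apply_eq_smul
  have h3 : depolarize (depolarize x) = depolarize x := DFunLike.congr_fun depolarize_mul_self x
  rw [hx1, map_smul, hx1, smul_smul] at h3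
  have h4 : (e * e - e) • x = 0 := by rw [sub_smul, h3, sub_self]
  have h5 : e * e - e = 0 := (smul_eq_zero.1 h4).resolve_right hx.2
  have he0 : e ≠ 0 := by
    rintro rfl
    simp at h2
  have h6 : e * (e - 1) = 0 := by linear_combination h5
  exact sub_eq_zero.1 ((mul_eq_zero.1 h6).resolve_left he0)

theorem finrank_maxGenEigenspace_depolarize :
    Module.finrank ℂ (depolarize.maxGenEigenspace 1) = 1 := by
  have h1 : depolarize (1 : Matrix (Fin 2) (Fin 2) ℂ) = 1 := by
    rw [depolarize_apply, trace_one]; simp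
  have hmem : (1 : Matrix (Fin 2) (Fin 2) ℂ) ∈ depolarize.maxGenEigenspace 1 := by
    rw [Module.End.mem_maxGenEigenspace]
    exact ⟨1, by simp [h1]⟩
  refine (finrank_eq_one_iff_of_nonzero' (⟨1, hmem⟩ : depolarize.maxGenEigenspace 1)
    (fun h0 => one_ne_zero (congrArg Subtype.val h0))).2 fun w => ?_
  have hb : ∀ x : Matrix (Fin 2) (Fin 2) ℂ, ∃ C, ∀ k : ℕ, ‖(depolarize ^ k) x‖ ≤ C := by
    intro x
    refine ⟨max ‖x‖ ‖depolarize x‖, fun k => ?_⟩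
    rcases Nat.eq_zero_or_pos k with rfl | hk
    · exact le_max_left _ _
    · rw [IsIdempotentElem.pow_eq depolarize_mul_self hk.ne']
      exact le_max_right _ _
  have hw := apply_eq_smul_of_mem_maxGenEigenspace (by simp) hb w.2
  rw [one_smul, depolarize_apply] at hw
  exact ⟨(w : Matrix (Fin 2) (Fin 2) ℂ).trace / 2, Subtype.ext hw⟩

end Tools

/-! ### Two qubits that exchange their states -/

/-- The exchange of the two factors. -/
def swapMatrix : Matrix (Fin 2 × Fin 2) (Fin 2 × Fin 2) ℂ :=
  of fun a b => if b = a.swap then 1 else 0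

theorem swapMatrix_mul (M : Matrix (Fin 2 × Fin 2) (Fin 2 × Fin 2) ℂ) :
    swapMatrix * M = M.submatrix Prod.swap id := by
  ext a b
  simp only [swapMatrix, mul_apply, of_apply, ite_mul, one_mul, zero_mul, submatrix_apply, id]
  simp

theorem conjTranspose_swapMatrix : swapMatrixᴴ = swapMatrix := by
  ext a b
  have : a = b.swap ↔ b = a.swap := ⟨fun h => by simp [h], fun h => by simp [h]⟩
  simp only [swapMatrix, conjTranspose_apply, of_apply, this]
  split_ifs <;> simp

theorem swapMatrix_mul_self : swapMatrix * swapMatrix = 1 := by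
  rw [swapMatrix_mul]
  ext a b
  simp only [swapMatrix, submatrix_apply, of_apply, id, Prod.swap_swap, one_apply, eq_comm]

theorem swapMatrix_conj (A B : Matrix (Fin 2) (Fin 2) ℂ) :
    swapMatrix * (A ⊗ₖ B) * swapMatrix = B ⊗ₖ A := by
  have h : swapMatrix * (A ⊗ₖ B) = (B ⊗ₖ A) * swapMatrix := by
    have h2 : (B ⊗ₖ A) * swapMatrix = ((swapMatrix * (Bᴴ ⊗ₖ Aᴴ)))ᴴ := by
      rw [conjTranspose_mul, conjTranspose_kronecker, conjTranspose_swapMatrix]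
      simp
    rw [h2, swapMatrix_mul, swapMatrix_mul]
    ext a b
    simp [mul_comm]
  rw [h, Matrix.mul_assoc, swapMatrix_mul_self, Matrix.mul_one]

/-- The projection onto antisymmetric vectors. -/
def antisym : Matrix (Fin 2 × Fin 2) (Fin 2 × Fin 2) ℂ := (2 : ℂ)⁻¹ • (1 - swapMatrix)

theorem isHermitian_antisym : antisym.IsHermitian := by
  rw [IsHermitian, antisym, conjTranspose_smul, conjTranspose_sub, conjTranspose_one,
    conjTranspose_swapMatrix]
  simp

theorem antisym_mul_self : antisym * antisym = antisym := by
  have : (1 - swapMatrix) * (1 - swapMatrix) = (2 : ℂ) • (1 - swapMatrix) := by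
    simp only [Matrix.mul_sub, Matrix.sub_mul, Matrix.mul_one, Matrix.one_mul, swapMatrix_mul_self,
      two_smul]
    abel
  rw [antisym, Matrix.smul_mul, Matrix.mul_smul, this, smul_smul, smul_smul]
  norm_num

/-- Two qubits at infinite temperature that exchange their states. -/
def swapSystem : ADRIS (Fin 2) (Fin 2) where
  hS := 0
  -- With a projection as the only Hamiltonian, time `π` yields `exp (-iπp) = 1 - 2p`; for the
  -- antisymmetric projection this is the swap.
  τ := Real.pi
  coupling := 1
  hE := fun _ => 0
  β := fun _ => 0
  v := fun _ => antisym
  hS_herm := isHermitian_zero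
  τ_pos := Real.pi_pos
  hE_herm := fun _ _ => isHermitian_zero
  v_herm := fun _ _ => isHermitian_antisym
  hE_C2 := fun _ _ => contDiffOn_const
  β_C2 := contDiffOn_const
  v_C2 := fun _ _ => contDiffOn_const

theorem swapSystem_U (s : ℝ) : swapSystem.U s = swapMatrix := by
  have e : swapSystem.U s = NormedSpace.exp ((-(Complex.I * Real.pi)) • antisym) := by
    simp [ADRIS.U, swapSystem]
  rw [e, exp_projection isHermitian_antisym antisym_mul_self, antisym, smul_smul]
  simp

theorem swapSystem_ξ (s : ℝ) : swapSystem.ξ s = (2 : ℂ)⁻¹ • 1 := by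
  simp [ADRIS.ξ, swapSystem, gibbs]

theorem swapSystem_L (s : ℝ) : swapSystem.L s = depolarize := by
  ext1 A
  rw [ADRIS.L, channel_apply, swapSystem_U, swapSystem_ξ, conjTranspose_swapMatrix,
    swapMatrix_conj, partialTrace_kronecker, depolarize_apply, smul_smul, div_eq_mul_inv]

theorem swapSystem_ρinv {s : ℝ} (hs : s ∈ Icc (0 : ℝ) 1) :
    swapSystem.ρinv s = (2 : ℂ)⁻¹ • 1 := by
  have h := swapSystem.isInvariantState_ρinv hs
  rw [← h.2, swapSystem_L, depolarize_apply, h.1.2, one_div]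

theorem swapSystem_X {s : ℝ} (hs : s ∈ Icc (0 : ℝ) 1) : swapSystem.X s = 0 := by
  rw [ADRIS.X, swapSystem_ρinv hs, swapSystem_ξ, swapSystem_U, conjTranspose_swapMatrix,
    swapMatrix_conj, sub_self]

theorem h4With_depolarize {ℓ : ℝ} (hℓ : 0 ≤ ℓ) : H4With (fun _ => depolarize) ℓ := by
  intro s _ A
  simp only [depolarize_mul_contractingProj, LinearMap.zero_apply, traceNorm_zero]
  exact mul_nonneg hℓ (traceNorm_nonneg _)

theorem supSpr_depolarize : supSpr (fun _ => depolarize) = 0 := by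
  simp only [supSpr, depolarize_mul_contractingProj]
  simp [spectralRadius, spectrum.zero_eq]

theorem swapSystem_L_eq : swapSystem.L = fun _ => depolarize := funext swapSystem_L

theorem swapSystem_caseI : swapSystem.CaseI 1 := by
  refine ⟨rfl, fun s _ => by rw [swapSystem_L]; exact isIrreducible_depolarize, 0, zero_lt_one, ?_⟩
  rw [swapSystem_L_eq]
  exact h4With_depolarize le_rfl

theorem swapSystem_caseII : swapSystem.CaseII 1 := by
  -- The value `1 / 2` is arbitrary in `(0, 1)`, as the contracting part of the dynamics is zero.
  refine ⟨le_rfl, fun s _ => by rw [swapSystem_L]; exact isIrreducible_depolarize, ?_, 1 / 2, ?_⟩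
  · rw [WeakH4, swapSystem_L_eq, supSpr_depolarize]
    exact zero_lt_one
  · simp only [swapSystem_L_eq, supSpr_depolarize, pow_one]
    refine ⟨ENNReal.ofReal_pos.2 (by norm_num), by norm_num, fun s _ A => traceNorm_depolarize_le A,
      ⟨fun s _ e he => ?_, 1, one_pos, fun s _ e he e' he' hne => ?_⟩,
      fun A i j => contDiffOn_const, h4With_depolarize (by norm_num)⟩
    · rw [depolarize_eq_one_of_mem he]
      exact finrank_maxGenEigenspace_depolarize
    · exact absurd ((depolarize_eq_one_of_mem he).trans (depolarize_eq_one_of_mem he').symm) hne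

/-- A pure state. -/
def pureState : Matrix (Fin 2) (Fin 2) ℂ := diagonal fun i => ((if i = 0 then 1 else 0 : ℝ) : ℂ)

theorem isState_pureState : IsState pureState := by
  refine ⟨.diagonal fun i => ?_, ?_⟩
  · fin_cases i <;> simp
  · simp [pureState, trace_diagonal]

theorem pureState_ne : pureState ≠ swapSystem.ρinv 0 := by
  rw [swapSystem_ρinv ⟨le_rfl, zero_le_one⟩]
  intro h
  have := congrFun (congrFun h 1) 1
  simp [pureState] at this

theorem negEntropy_pureState : negEntropy pureState = 0 := by
  rw [pureState, negEntropy_diagonal]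
  simp

theorem negEntropy_half : negEntropy ((2 : ℂ)⁻¹ • (1 : Matrix (Fin 2) (Fin 2) ℂ)) =
    -Real.log 2 := by
  have : (2 : ℂ)⁻¹ • (1 : Matrix (Fin 2) (Fin 2) ℂ) =
      Matrix.diagonal fun _ => ((2⁻¹ : ℝ) : ℂ) := by
    rw [smul_one_eq_diagonal]; simp
  rw [this, negEntropy_diagonal]
  simp

/-- There is no flux, and from the first interaction on the state is maximally mixed. The total
production is the entropy gained from a pure state, the same for all `T ≥ 1`. -/
theorem tendsto_totalEntropyProd_swapSystem :
    Tendsto (swapSystem.totalEntropyProd 1 pureState) atTop (𝓝 (Real.log 2)) := by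
  refine tendsto_const_nhds.congr' ?_
  filter_upwards [eventually_gt_atTop 0] with T hT
  obtain ⟨k, rfl⟩ : ∃ k, T = k + 1 := ⟨T - 1, by omega⟩
  have hev : evol (swapSystem.Mc 1) (k + 1) (k + 1) pureState = (2 : ℂ)⁻¹ • 1 := by
    rw [ADRIS.evol_succ_apply, pow_one, swapSystem_L, depolarize_apply,
      (swapSystem.isState_evol 1 (Nat.le_succ k) isState_pureState).2, one_div]
  rw [swapSystem.totalEntropyProd_eq 1 isState_pureState, hev, negEntropy_half,
    negEntropy_pureState]
  have hf : ∀ (s : ℝ) (A : Matrix (Fin 2) (Fin 2) ℂ), swapSystem.fluxSum 1 s A = 0 := by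
    intro s A
    simp [ADRIS.fluxSum, ADRIS.flux, swapSystem]
  simp [hf]

end RIS

end

/-! ### The corollary -/

theorem corollary6p4 :
    (∀ (S E : Type*) [Fintype S] [DecidableEq S] [Nonempty S]
        [Fintype E] [DecidableEq E] [Nonempty E]
        (R : RIS.ADRIS S E) (m : ℕ), R.CaseI m ∨ R.CaseII m →
      -- the invariant states are well defined
      (∀ s ∈ Set.Icc (0 : ℝ) 1, ∃! ρ, RIS.IsInvariantState (R.L s) ρ) ∧
      ∀ ρi : Matrix S S ℂ, RIS.IsState ρi →
        ((∀ s ∈ Set.Icc (0 : ℝ) 1, R.X s = 0) → ρi = R.ρinv 0 →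
          Filter.Tendsto (R.totalEntropyProd m ρi) Filter.atTop (𝓝 0)) ∧
        ((∀ s ∈ Set.Icc (0 : ℝ) 1, R.X s = 0) → ρi ≠ R.ρinv 0 →
          ∃ σ : ℝ, Filter.Tendsto (R.totalEntropyProd m ρi) Filter.atTop (𝓝 σ)) ∧
        (0 < (⨆ s : Set.Icc (0 : ℝ) 1, RIS.traceNorm (R.X s)) →
          Filter.Tendsto (R.totalEntropyProd m ρi) Filter.atTop Filter.atTop)) ∧
    -- the limit in the second case may be non-zero, under either set of hypotheses
    (∃ (R : RIS.ADRIS (Fin 2) (Fin 2)) (m : ℕ) (ρi : Matrix (Fin 2) (Fin 2) ℂ) (σ : ℝ),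
      R.CaseI m ∧ R.CaseII m ∧ RIS.IsState ρi ∧ (∀ s ∈ Set.Icc (0 : ℝ) 1, R.X s = 0) ∧
        ρi ≠ R.ρinv 0 ∧ Filter.Tendsto (R.totalEntropyProd m ρi) Filter.atTop (𝓝 σ) ∧ σ ≠ 0) := by
  refine ⟨fun S E _ _ _ _ _ _ R m hcase => ?_, ?_⟩
  -- Both sets of hypotheses enter only through `Regular`.
  · have hR : R.Regular m := hcase.elim RIS.ADRIS.regular_of_caseI RIS.ADRIS.regular_of_caseII
    refine ⟨fun s hs => (R.isDilation hs).existsUnique_invariantState (hR.irr s hs),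
      fun ρi hρi => ⟨fun hX h0 => ?_, fun hX _ => ?_, fun hsup => ?_⟩⟩
    · obtain ⟨σ, hσ, hσ0⟩ := hR.exists_tendsto_totalEntropyProd hX hρi
      rwa [hσ0 h0] at hσ
    · obtain ⟨σ, hσ, -⟩ := hR.exists_tendsto_totalEntropyProd hX hρi
      exact ⟨σ, hσ⟩
    · obtain ⟨s, hs⟩ := RIS.exists_ne_zero_of_iSup_traceNorm_pos hsup
      exact hR.tendsto_totalEntropyProd_atTop s.2 hs hρi
  · exact ⟨RIS.swapSystem, 1, RIS.pureState, Real.log 2, RIS.swapSystem_caseI,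
      RIS.swapSystem_caseII, RIS.isState_pureState, fun s hs => RIS.swapSystem_X hs,
      RIS.pureState_ne, RIS.tendsto_totalEntropyProd_swapSystem,
      (Real.log_pos one_lt_two).ne'⟩
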